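/- Let $(M,\omega)$ be a compact connected Kähler manifold of complex dimension $n$, with volume form $dV=\omega^n/n!$, and let $\Gamma=\pi_1(M)$ act on the universal covering $p_0:\tilde M\to M$ by deck transformations. Let $\Gamma=\Gamma_0\supsetneq\Gamma_1\supsetneq\cdots$ be normal subgroups of $\Gamma$ with $2\le[\Gamma_j:\Gamma_{j+1}]<\infty$ for all $j$ and $\bigcap_j\Gamma_j=\{1\}$. Put $M_j=\tilde M/\Gamma_j$, with the covering maps $p_j:\tilde M\to M_j$ and $q_j:M_j\to M$, $q_j\circ p_j=p_0$; the complex structures and Kähler forms of $M_j$ and $\tilde M$ are those pulled back from $M$. Let $(E,h)$ be a holomorphic line bundle over $M$ with a smooth Hermitian metric; its pullbacks to $M_j$ and $\tilde M$ are again denoted by $(E,h)$. For a Hilbert space $V$ of holomorphic sections with inner product $\int (s,s')_h\,dV$ and orthonormal basis $(S_k)$, the Bergman kernel is $\Pi(z,w)=\sum_k S_k(z)\otimes\overline{S_k(w)}$, the base locus is the set of common zeros of all $s\in V$, and off the base locus the Bergman metric is $\Omega=\frac{\sqrt{-1}}{2}\partial\bar\partial\log\sum_k|f_k|^2$, where $S_k=f_ke$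 in a local holomorphic frame $e$. Let $\Pi_j$, $B_j$, $\Omega_j$ be these objects for $V=H^0(M_j,E)$, and $\tilde\Pi$, $\tilde B$, $\tilde\Omega$ those for the space $V$ of square integrable holomorphic sections of $E$ over $\tilde M$. Suppose that the tower is Bergman stable, i.e. $\Pi_j(p_j(z),p_j(w))\to\tilde\Pi(z,w)$ locally uniformly on $\tilde M\times\tilde M$ (with respect to $h$), and that $\tilde B=\emptyset$. Then there is $J\ge0$ such that for all $j\ge J$ the base locus $B_j$ is empty, so that $\Omega_j$ is a smooth form defined on all of $M_j$. Moreover, for $j\ge J$ there are (necessarily unique) smooth $2$-forms $\underline\Omega_j$ and $\underline{\tilde\Omega}$ on $M$ with $q_j^*\underline\Omega_j=\Omega_j$ and $p_0^*\underline{\tilde\Omega}=\tilde\Omega$, and $\underline\Omega_j\to\underline{\tilde\Omega}$ in $C^\infty$, i.e. uniformly on $M$ with all derivatives. -/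

import Mathlib

open Set Filter Topology MeasureTheory Bundle
open scoped Manifold ContDiff ComplexConjugate

noncomputable section

namespace BergmanTower

/-! ### Real two-forms on a complex manifold modelled on `ℂⁿ` -/

/-- Real two-forms (not assumed continuous) on the complex manifold `X`. -/
abbrev TwoForm (n : ℕ) (X : Type*) [TopologicalSpace X] [ChartedSpace (Fin n → ℂ) X] : Type _ :=
  ∀ x : X, TangentSpace 𝓘(ℂ, Fin n → ℂ) x [⋀^Fin 2]→L[ℝ] ℝ

section Forms

variable {n : ℕ} {X : Type*} [TopologicalSpace X] [ChartedSpace (Fin n → ℂ) X]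

/-- The pullback `(c⁻¹)^* α` of the two-form `α` to the range of the holomorphic chart `c`
(meaningful on `c.target`). -/
def TwoForm.inChart (α : TwoForm n X) (c : OpenPartialHomeomorph X (Fin n → ℂ)) :
    (Fin n → ℂ) → (Fin n → ℂ) [⋀^Fin 2]→L[ℝ] ℝ := fun z =>
  (α (c.symm z)).compContinuousLinearMap
    ((mfderiv 𝓘(ℂ, Fin n → ℂ) 𝓘(ℂ, Fin n → ℂ) c.symm z).restrictScalars ℝ)

/-- The two-form `α` is (real) smooth: its expression in every holomorphic chart is. -/
def TwoForm.IsSmooth (α : TwoForm n X) : Prop :=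
  ∀ c ∈ IsManifold.maximalAtlas 𝓘(ℂ, Fin n → ℂ) ω X, ContDiffOn ℝ ∞ (α.inChart c) c.target

/-- The pullback `f^* α` of a two-form along a map `f : Y → X` of complex manifolds. -/
def TwoForm.pullback {Y : Type*} [TopologicalSpace Y] [ChartedSpace (Fin n → ℂ) Y]
    (f : Y → X) (α : TwoForm n X) : TwoForm n Y := fun y =>
  (α (f y)).compContinuousLinearMap
    ((mfderiv 𝓘(ℂ, Fin n → ℂ) 𝓘(ℂ, Fin n → ℂ) f y).restrictScalars ℝ)

/-- `α` is a Kähler form: smooth, of type `(1,1)`, positive, and closed. -/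
structure TwoForm.IsKaehler (α : TwoForm n X) : Prop where
  smooth : α.IsSmooth
  type_one_one : ∀ (x : X) (v w : TangentSpace 𝓘(ℂ, Fin n → ℂ) x),
    α x ![Complex.I • v, Complex.I • w] = α x ![v, w]
  positive : ∀ (x : X) (v : TangentSpace 𝓘(ℂ, Fin n → ℂ) x), v ≠ 0 →
    0 < α x ![v, Complex.I • v]
  closed : ∀ c ∈ IsManifold.maximalAtlas 𝓘(ℂ, Fin n → ℂ) ω X, ∀ z ∈ c.target,
    extDeriv (α.inChart c) z = 0

/-- The matrix `(h_{ab})` with `η = (i/2) ∑ h_{ab} dz_a ∧ d\bar z_b`, for a real `(1,1)`-form `η`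
on `ℂⁿ`, namely `h_{ab} = η(e_a, i e_b) - i η(e_a, e_b)`. -/
def hermitianMatrix (η : (Fin n → ℂ) [⋀^Fin 2]→L[ℝ] ℝ) : Matrix (Fin n) (Fin n) ℂ := fun a b =>
  (η ![Pi.single a 1, Pi.single b Complex.I] : ℂ) - Complex.I * η ![Pi.single a 1, Pi.single b 1]

/-- The volume measure `α^n / n!` of a Kähler form `α`.  In a holomorphic chart `c` the form
`α^n / n!` is `det (h_{ab})` times Lebesgue measure; the measure on `X` is the supremum of these
local measures, which agree on overlaps, so it restricts to each of them on the chart domain. -/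
def TwoForm.volume (α : TwoForm n X) : @Measure X (borel X) :=
  letI : MeasurableSpace X := borel X
  ⨆ x : X, Measure.map (chartAt (Fin n → ℂ) x).symm
    (((MeasureTheory.volume : Measure (Fin n → ℂ)).restrict
      (chartAt (Fin n → ℂ) x).target).withDensity
        fun z => ENNReal.ofReal (hermitianMatrix (α.inChart (chartAt (Fin n → ℂ) x) z)).det.re)

/-- Convergence in the `C^∞` topology: in every holomorphic chart, all derivatives converge
uniformly on compact sets.  On a compact manifold this is uniform convergence of all
derivatives. -/
def TendstoSmooth (α : ℕ → TwoForm n X) (β : TwoForm n X) : Prop :=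
  ∀ c ∈ IsManifold.maximalAtlas 𝓘(ℂ, Fin n → ℂ) ω X, ∀ K ⊆ c.target, IsCompact K → ∀ k : ℕ,
    TendstoUniformlyOn (fun j z => iteratedFDeriv ℝ k ((α j).inChart c) z)
      (fun z => iteratedFDeriv ℝ k (β.inChart c) z) atTop K

/-- The one-form `d^c u = i (\bar∂ - ∂) u`, that is `v ↦ - du (i v)`, of a real function `u`. -/
def dc (u : (Fin n → ℂ) → ℝ) (z : Fin n → ℂ) : (Fin n → ℂ) [⋀^Fin 1]→L[ℝ] ℝ :=
  ContinuousAlternatingMap.ofSubsingleton ℝ (Fin n → ℂ) ℝ (0 : Fin 1)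
    (-((fderiv ℝ u z).comp (Complex.I • ContinuousLinearMap.id ℝ (Fin n → ℂ))))

/-- The real two-form `(i/2) ∂ \bar∂ u = (1/4) d d^c u` of a real function `u` on `ℂⁿ`. -/
def halfIddbar (u : (Fin n → ℂ) → ℝ) (z : Fin n → ℂ) : (Fin n → ℂ) [⋀^Fin 2]→L[ℝ] ℝ :=
  (1 / 4 : ℝ) • extDeriv (dc u) z

end Forms

/-! ### Bergman kernels, base loci and Bergman metrics -/

section Orthonormal

variable {n : ℕ} {X : Type*} [TopologicalSpace X] [ChartedSpace (Fin n → ℂ) X]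
  {L : X → Type*} [∀ x, AddCommMonoid (L x)] [∀ x, Module ℂ (L x)]
  (h : ∀ x, L x →ₗ[ℂ] L x →ₗ⋆[ℂ] ℂ) (α : TwoForm n X)

/-- The inner product `∫ (s, t)_h dV` of sections, `dV = α^n / n!`. -/
def sectionInner (s t : ∀ x, L x) : ℂ :=
  letI : MeasurableSpace X := borel X
  ∫ x, h x (s x) (t x) ∂α.volume

/-- `B` is an orthonormal set of sections belonging to `V`. -/
def IsOrthonormalSet (V B : Set (∀ x, L x)) : Prop :=
  B ⊆ V ∧ (∀ s ∈ B, sectionInner h α s s = 1) ∧ B.Pairwise fun s t => sectionInner h α s t = 0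

theorem exists_maximal_orthonormalSet (V : Set (∀ x, L x)) :
    ∃ B, Maximal (IsOrthonormalSet h α V) B := by
  refine zorn_subset {B | IsOrthonormalSet h α V B} fun C hC hchain => ?_
  refine ⟨⋃₀ C, ⟨sUnion_subset fun B hB => (hC hB).1, ?_, ?_⟩, fun B hB =>
    subset_sUnion_of_mem hB⟩
  · rintro s ⟨B, hB, hs⟩
    exact (hC hB).2.1 s hs
  · exact (pairwise_sUnion hchain.directedOn).2 fun B hB => (hC hB).2.2

/-- An orthonormal basis (maximal orthonormal set) of the Hilbert space `V` of sections. -/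
def orthonormalBasis (V : Set (∀ x, L x)) : Set (∀ x, L x) :=
  (exists_maximal_orthonormalSet h α V).choose

/-- The Bergman kernel `Π(z,w) = ∑ S_k(z) ⊗ conj (S_k(w))` of the Hilbert space `V` of sections,
`(S_k)` being an orthonormal basis.  An element `a ⊗ conj b` of `L_z ⊗ conj L_w` is regarded as
the form `(ξ, η) ↦ ξ a * conj (η b)` on `L_z^* × L_w^*`. -/
def bergmanKernel (V : Set (∀ x, L x)) (z w : X) (ξ : Module.Dual ℂ (L z))
    (η : Module.Dual ℂ (L w)) : ℂ :=
  ∑' s : orthonormalBasis h α V, ξ (s.1 z) * conj (η (s.1 w))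

/-- The base locus: the common zeros of the sections in `V`. -/
def baseLocus (V : Set (∀ x, L x)) : Set X :=
  {z | ∀ s ∈ V, s z = 0}

end Orthonormal

section Bergman

variable {n : ℕ} {X : Type*} [TopologicalSpace X] [ChartedSpace (Fin n → ℂ) X]
  (L : X → Type*) [∀ x, AddCommMonoid (L x)] [∀ x, Module ℂ (L x)]
  [TopologicalSpace (TotalSpace ℂ L)] [∀ x, TopologicalSpace (L x)] [FiberBundle ℂ L]

/-- `h` is a smooth Hermitian metric on the line bundle `L`, linear in the first argument:
smoothness is that of `|e|²_h` for the local frames `e` of `L`, in holomorphic charts. -/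
structure IsHermitianMetric (h : ∀ x, L x →ₗ[ℂ] L x →ₗ⋆[ℂ] ℂ) : Prop where
  conj_symm : ∀ x (v w : L x), h x v w = conj (h x w v)
  positive : ∀ x (v : L x), v ≠ 0 → 0 < (h x v v).re
  smooth : ∀ (e : Trivialization ℂ (TotalSpace.proj : TotalSpace ℂ L → X))
    [MemTrivializationAtlas e],
    ∀ c ∈ IsManifold.maximalAtlas 𝓘(ℂ, Fin n → ℂ) ω X,
      ContDiffOn ℝ ∞
        (fun z => (h (c.symm z) (e.symm (c.symm z) (1 : ℂ)) (e.symm (c.symm z) (1 : ℂ))).re)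
        (c.target ∩ c.symm ⁻¹' e.baseSet)

/-- The space `H^0(X, L)` of holomorphic sections. -/
def holomorphicSections : Set (∀ x, L x) :=
  {s | MDifferentiable 𝓘(ℂ, Fin n → ℂ) (𝓘(ℂ, Fin n → ℂ).prod 𝓘(ℂ, ℂ))
    fun x => (TotalSpace.mk' ℂ x (s x) : TotalSpace ℂ L)}

variable {L}
variable (h : ∀ x, L x →ₗ[ℂ] L x →ₗ⋆[ℂ] ℂ) (α : TwoForm n X)

/-- The space of square integrable holomorphic sections. -/
def l2HolomorphicSections : Set (∀ x, L x) :=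
  letI : MeasurableSpace X := borel X
  {s ∈ holomorphicSections (n := n) L | Integrable (fun x => h x (s x) (s x)) α.volume}

/-- The Bergman metric `Ω = (i/2) ∂ \bar∂ log φ`, where `φ(y) = Π(y,y)(e^*, e^*) = ∑ |f_k(y)|²` for
`S_k = f_k e` in a local frame `e` (the frame of the preferred trivialization at the point), with
derivatives computed in the preferred holomorphic chart.  Meaningful off the base locus. -/
def bergmanMetric [VectorBundle ℂ ℂ L] (V : Set (∀ x, L x)) : TwoForm n X := fun x =>
  (halfIddbar (fun z : Fin n → ℂ =>
      let y : X := (chartAt (Fin n → ℂ) x).symm z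
      let e' : Module.Dual ℂ (L y) := (trivializationAt ℂ L x).linearMapAt ℂ y
      Real.log (bergmanKernel h α V y y e' e').re)
    (chartAt (Fin n → ℂ) x x)).compContinuousLinearMap
    ((mfderiv 𝓘(ℂ, Fin n → ℂ) 𝓘(ℂ, Fin n → ℂ) (chartAt (Fin n → ℂ) x) x).restrictScalars ℝ)

end Bergman

/-! ### Towers of normal coverings -/

/-- The structure of a manifold on `X` determined by that of `M` via a local homeomorphism
`f : X → M`: charts are compositions of local restrictions of `f` with charts of `M`. -/
@[reducible] def pullbackChartedSpace {H X M : Type*} [TopologicalSpace H] [TopologicalSpace X]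
    [TopologicalSpace M] [ChartedSpace H M] (f : X → M) (hf : IsLocalHomeomorph f) :
    ChartedSpace H X where
  atlas := {c | ∃ e : OpenPartialHomeomorph X M, f = e ∧ ∃ c' ∈ atlas H M, c = e.trans c'}
  chartAt x := (hf x).choose.trans (chartAt H (f x))
  mem_chart_source x := by
    have h1 := (hf x).choose_spec.1
    have h2 : f x = (hf x).choose x := congrFun (hf x).choose_spec.2 x
    have h3 : (hf x).choose x ∈ (chartAt H (f x)).source := h2 ▸ mem_chart_source H (f x)
    exact ⟨h1, h3⟩
  chart_mem_atlas x := ⟨_, (hf x).choose_spec.2, _, chart_mem_atlas H (f x), rfl⟩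

/-- The group of deck transformations of `p`. For a universal covering `p` of `M` this is the
fundamental group of `M`. -/
def DeckGroup {Y M : Type*} [TopologicalSpace Y] (p : Y → M) : Subgroup (Y ≃ₜ Y) where
  carrier := {g | ∀ y, p (g y) = p y}
  one_mem' _ := rfl
  mul_mem' {a b} ha hb y := (ha (b y)).trans (hb y)
  inv_mem' {a} ha y := by
    have := ha (a.symm y)
    rw [a.apply_symm_apply] at this
    exact this.symm

instance {Y M : Type*} [TopologicalSpace Y] (p : Y → M) : MulAction (DeckGroup p) Y where
  smul g y := g.1 y
  one_smul _ := rfl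
  mul_smul _ _ _ := rfl

/-- A tower of normal coverings of `M`: the universal covering `p : Y → M` and a decreasing
sequence `Γ = Γ_0 ⊋ Γ_1 ⊋ ...` of normal subgroups of the deck transformation group `Γ ≅ π_1(M)`,
with `2 ≤ [Γ_j : Γ_{j+1}] < ∞` and trivial intersection. -/
structure CoveringTower (Y M : Type*) [TopologicalSpace Y] [SimplyConnectedSpace Y]
    [TopologicalSpace M] where
  p : C(Y, M)
  isCoveringMap : IsCoveringMap p
  surjective : Function.Surjective p
  Γ : ℕ → Subgroup (DeckGroup p)
  Γ_zero : Γ 0 = ⊤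
  Γ_lt : ∀ j, Γ (j + 1) < Γ j
  Γ_normal : ∀ j, (Γ j).Normal
  /- the index is `0` by convention if it is infinite, so this includes finiteness -/
  two_le_index : ∀ j, 2 ≤ (Γ (j + 1)).relIndex (Γ j)
  iInf_Γ : ⨅ j, Γ j = ⊥

namespace CoveringTower

section Topology

variable {Y M : Type*} [TopologicalSpace Y] [SimplyConnectedSpace Y] [TopologicalSpace M]
  (T : CoveringTower Y M)

/-- The universal covering `Y` with the manifold structure determined by `M`. -/
def Univ (_T : CoveringTower Y M) : Type _ := Y

instance : TopologicalSpace T.Univ := inferInstanceAs (TopologicalSpace Y)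

/-- The covering map `p_0` from the universal covering to `M`. -/
def toBase : C(T.Univ, M) := T.p

/-- `M_j`, the quotient of the universal covering by `Γ_j`. -/
def Level (j : ℕ) : Type _ := MulAction.orbitRel.Quotient (T.Γ j) Y

instance (j : ℕ) : TopologicalSpace (T.Level j) :=
  inferInstanceAs (TopologicalSpace (Quotient (MulAction.orbitRel (T.Γ j) Y)))

/-- The covering map `p_j` from the universal covering to `M_j`. -/
def toLevel (j : ℕ) (z : T.Univ) : T.Level j :=
  Quotient.mk (MulAction.orbitRel (T.Γ j) Y) z

/-- The covering map `q_j : M_j → M`, characterized by `q_j ∘ p_j = p_0`. -/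
def levelToBase (j : ℕ) : C(T.Level j, M) where
  toFun := Quotient.lift T.p (by
    rintro a b ⟨g, rfl⟩
    exact g.1.2 b)
  continuous_toFun := T.p.continuous.quotient_lift _

theorem isLocalHomeomorph_toBase : IsLocalHomeomorph T.toBase :=
  T.isCoveringMap.isLocalHomeomorph

theorem isLocalHomeomorph_levelToBase (j : ℕ) : IsLocalHomeomorph (T.levelToBase j) := by
  have hcont : Continuous (T.toLevel j) := continuous_quot_mk
  have hopen : IsOpenMap (T.toLevel j) := by
    have : ContinuousConstSMul (T.Γ j) Y := ⟨fun g => g.1.1.continuous⟩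
    exact isOpenMap_quotient_mk'_mul (Γ := T.Γ j) (T := Y)
  have hproj : IsLocalHomeomorph (T.toLevel j) := by
    refine isLocalHomeomorph_iff_isOpenEmbedding_restrict.2 fun x => ?_
    obtain ⟨e, hxe, he⟩ := T.isLocalHomeomorph_toBase x
    refine ⟨e.source, e.open_source.mem_nhds hxe,
      .of_continuous_injective_isOpenMap (hcont.comp continuous_subtype_val) ?_
        (hopen.comp e.open_source.isOpenMap_subtype_val)⟩
    intro a b hab
    have hab' : T.toBase a.1 = T.toBase b.1 := congrArg (T.levelToBase j) hab
    rw [he] at hab'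
    exact Subtype.ext (e.injOn a.2 b.2 hab')
  have hcomp : IsLocalHomeomorph (T.levelToBase j ∘ T.toLevel j) := T.isLocalHomeomorph_toBase
  have h := (hcomp.isLocalHomeomorphOn (s := univ)).of_comp_right hproj.isLocalHomeomorphOn
  have hsurj : Function.Surjective (T.toLevel j) := Quotient.mk_surjective
  rw [image_univ, hsurj.range_eq] at h
  exact isLocalHomeomorph_iff_isLocalHomeomorphOn_univ.2 h

variable {H : Type*} [TopologicalSpace H] [ChartedSpace H M]

instance : ChartedSpace H T.Univ := pullbackChartedSpace T.toBase T.isLocalHomeomorph_toBase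

instance (j : ℕ) : ChartedSpace H (T.Level j) :=
  pullbackChartedSpace (T.levelToBase j) (T.isLocalHomeomorph_levelToBase j)

end Topology

/-! Throughout, `κ` is the Kähler form of `M` and `h` the Hermitian metric of the line bundle `E`;
the coverings carry the pullback forms, bundles and metrics. -/

variable {n : ℕ} {Y M : Type*} [TopologicalSpace Y] [SimplyConnectedSpace Y] [TopologicalSpace M]
  [ChartedSpace (Fin n → ℂ) M] (T : CoveringTower Y M) (κ : TwoForm n M)
  {E : M → Type*} [∀ x, AddCommMonoid (E x)] [∀ x, Module ℂ (E x)]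
  [TopologicalSpace (TotalSpace ℂ E)] [∀ x, TopologicalSpace (E x)] [FiberBundle ℂ E]
  [VectorBundle ℂ ℂ E] (h : ∀ x, E x →ₗ[ℂ] E x →ₗ⋆[ℂ] ℂ)

/-- The Bergman kernel `Π_{j,E}` of `H^0(M_j, E)`. -/
def levelKernel (j : ℕ) (z w : T.Level j) (ξ : Module.Dual ℂ (E (T.levelToBase j z)))
    (η : Module.Dual ℂ (E (T.levelToBase j w))) : ℂ :=
  bergmanKernel (L := T.levelToBase j *ᵖ E) (fun x => h (T.levelToBase j x))
    (κ.pullback (T.levelToBase j)) (holomorphicSections (n := n) (T.levelToBase j *ᵖ E)) z w ξ η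

/-- The base locus `B_{j,E}`. -/
def levelBaseLocus (n : ℕ) {Y M : Type*} [TopologicalSpace Y] [SimplyConnectedSpace Y]
    [TopologicalSpace M] [ChartedSpace (Fin n → ℂ) M] (T : CoveringTower Y M)
    (E : M → Type*) [∀ x, AddCommMonoid (E x)] [∀ x, Module ℂ (E x)]
    [TopologicalSpace (TotalSpace ℂ E)] [∀ x, TopologicalSpace (E x)] [FiberBundle ℂ E]
    (j : ℕ) : Set (T.Level j) :=
  baseLocus (holomorphicSections (n := n) (T.levelToBase j *ᵖ E))

/-- The Bergman metric `Ω_{j,E}`. -/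
def levelMetric (j : ℕ) : TwoForm n (T.Level j) :=
  bergmanMetric (L := T.levelToBase j *ᵖ E) (fun x => h (T.levelToBase j x))
    (κ.pullback (T.levelToBase j)) (holomorphicSections (n := n) (T.levelToBase j *ᵖ E))

/-- The square integrable holomorphic sections of `E` over the universal covering. -/
def univSections : Set (∀ x, (T.toBase *ᵖ E) x) :=
  l2HolomorphicSections (L := T.toBase *ᵖ E) (fun x => h (T.toBase x)) (κ.pullback T.toBase)

/-- The `L²`-Bergman kernel of `E` over the universal covering. -/
def univKernel (z w : T.Univ) (ξ : Module.Dual ℂ (E (T.toBase z)))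
    (η : Module.Dual ℂ (E (T.toBase w))) : ℂ :=
  bergmanKernel (L := T.toBase *ᵖ E) (fun x => h (T.toBase x)) (κ.pullback T.toBase)
    (T.univSections κ h) z w ξ η

/-- The `L²`-base locus of `E` over the universal covering. -/
def univBaseLocus : Set T.Univ := baseLocus (T.univSections κ h)

/-- The `L²`-Bergman metric of `E` over the universal covering. -/
def univMetric : TwoForm n T.Univ :=
  bergmanMetric (L := T.toBase *ᵖ E) (fun x => h (T.toBase x)) (κ.pullback T.toBase)
    (T.univSections κ h)

/-- Bergman stability: `Π_{j,E}(p_j(z), p_j(w))` converges to the `L²`-Bergman kernel locally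
uniformly in `(z, w)`, for the pointwise norm on `E_z ⊗ conj E_w` induced by `h` (the supremum over
pairs of functionals of `h`-norm at most one). -/
def BergmanStable : Prop :=
  ∀ z₀ w₀ : T.Univ, ∃ U ∈ 𝓝 z₀, ∃ W ∈ 𝓝 w₀, ∀ ε > (0 : ℝ), ∃ J : ℕ, ∀ j ≥ J,
    ∀ z ∈ U, ∀ w ∈ W,
    ∀ (ξ : Module.Dual ℂ (E (T.toBase z))) (η : Module.Dual ℂ (E (T.toBase w))),
      (∀ v, ‖ξ v‖ ^ 2 ≤ (h _ v v).re) → (∀ v, ‖η v‖ ^ 2 ≤ (h _ v v).re) →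
      ‖T.levelKernel κ h j (T.toLevel j z) (T.toLevel j w) ξ η - T.univKernel κ h z w ξ η‖ ≤ ε

end CoveringTower

end BergmanTower

end

/-! The convergence is local on `M`. A chart `c` of `M` and a local inverse of `p_0` give
coordinates that are used at once on the universal covering and on every `M_j`, and a frame of `E`
pulls back to all of them. In these coordinates the Bergman kernels are functions `K_j(z, w)`,
holomorphic in `z` and antiholomorphic in `w`, and Bergman stability says that they converge
uniformly near a point to the kernel `K` of the universal covering (`exists_uniform_localKernel`).
The polarizations `K_j(z, conj w)` are holomorphic in `2n` variables, so by the Cauchy estimates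
they converge with all derivatives (`smoothTendstoOn_of_holomorphic`). Since the `L²` base locus
upstairs is empty, `K(z, z) > 0`; hence the polarizations eventually have positive real part near a
given point of the conjugate diagonal, their principal logarithms are holomorphic and converge
smoothly, and restriction to that diagonal gives convergence of `log K_j(z, z)`
(`exists_smoothTendstoOn_log`). Finally `(i/2) ∂∂̄` is a fixed linear map of the second derivative
(`exists_smoothTendstoOn_levelMetric`).

Positivity of `K_j` is first obtained at one point of `M_j` over each point of a small open set of
`M`. Compactness of `M` makes the index uniform, and the deck group, which is transitive on the
fibres of `q_j` because `Γ_j` is normal, carries the nonvanishing to the whole fibre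
(`exists_levelL2Sections_ne_zero`).

The metrics descend because automorphisms over `M` preserve the volume and the Hermitian metric,
hence the `L²` norm, and the kernel on the diagonal is determined by that norm through an extremal
property (`diagonalKernel_eq`). A change of frame by `g` adds `log |g|²`, which `∂∂̄` kills, so the
Bergman metric may be computed in any chart and frame (`inChart_bergmanMetric`).

The Hilbert space theory is carried out for any set `V` of sections between the square integrable
holomorphic and all holomorphic sections: an orthonormal set in `V` automatically consists of square
integrable sections. This treats the coverings `M_j` and the universal covering together. The mean
value inequality bounds point evaluations (`exists_le_normSq`), which gives completeness and
identifies the kernel with the inner product of the vectors representing the evaluations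
(`bergmanKernel_eq_inner`), independently of the orthonormal basis. -/

set_option linter.unusedSectionVars false

noncomputable section

universe u
namespace BergmanTower

/-! ### Holomorphic maps in several variables: Cauchy estimates, limits, regularity. -/

section Holomorphic

open Metric

variable {E F : Type*} [NormedAddCommGroup E] [NormedSpace ℂ E]
  [NormedAddCommGroup F] [NormedSpace ℂ F]

/-- Schwarz lemma: `f` maps the ball into the closed ball about `f z` of radius `2 * C`, whence the
factor two. -/
theorem norm_fderiv_le_of_norm_le {f : E → F} {z : E} {r C : ℝ} (hr : 0 < r)
    (hf : DifferentiableOn ℂ f (ball z r)) (hC : ∀ w ∈ ball z r, ‖f w‖ ≤ C) :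
    ‖fderiv ℂ f z‖ ≤ 2 * C / r := by
  refine Complex.norm_fderiv_le_div_of_mapsTo_ball hf (fun w hw => ?_) hr
  rw [mem_closedBall, dist_eq_norm]
  have := norm_sub_le (f w) (f z)
  have := hC w hw
  have := hC z (mem_ball_self hr)
  linarith

theorem dist_le_of_norm_le {f : E → F} {z w : E} {r C : ℝ}
    (hf : DifferentiableOn ℂ f (ball z r)) (hC : ∀ w ∈ ball z r, ‖f w‖ ≤ C) (hw : w ∈ ball z r) :
    dist (f w) (f z) ≤ 2 * C / r * dist w z := by
  refine Complex.dist_le_div_mul_dist_of_mapsTo_ball hf (fun w hw => ?_) hw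
  rw [mem_closedBall, dist_eq_norm]
  have := norm_sub_le (f w) (f z)
  have := hC w hw
  have := hC z (mem_ball_self (pos_of_mem_ball hw))
  linarith

/-- Second order Taylor estimate for a bounded holomorphic function. -/
theorem norm_sub_sub_fderiv_le {f : E → F} {z w : E} {r C : ℝ}
    (hf : DifferentiableOn ℂ f (ball z r)) (hC : ∀ w ∈ ball z r, ‖f w‖ ≤ C) (hw : w ∈ ball z r) :
    ‖f w - f z - fderiv ℂ f z (w - z)‖ ≤ 4 * C * (‖w - z‖ / r) ^ 2 := by
  have hr : 0 < r := pos_of_mem_ball hw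
  have hfz : DifferentiableAt ℂ f z := hf.differentiableAt (ball_mem_nhds z hr)
  -- Without its linear part the function has zero derivative at `z`, so the Schwarz lemma for maps
  -- agreeing with a constant to higher order applies. The radius `4 * C` is `2 * C` for the
  -- oscillation of `f` plus `2 * C` for the linear part.
  set g : E → F := fun w => f w - fderiv ℂ f z (w - z) with hg
  have hgd : DifferentiableOn ℂ g (ball z r) := by
    refine hf.sub (DifferentiableOn.comp (t := univ) (g := fderiv ℂ f z)
      (fderiv ℂ f z).differentiable.differentiableOn ?_ (mapsTo_univ _ _))
    fun_prop
  have hgz : g z = f z := by simp [hg]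
  have hmaps : MapsTo g (ball z r) (closedBall (g z) (4 * C)) := by
    intro v hv
    rw [mem_closedBall, dist_eq_norm, hgz]
    have h1 := norm_sub_le (f v) (f z)
    have h2 := hC v hv
    have h3 := hC z (mem_ball_self hr)
    have h4 := norm_fderiv_le_of_norm_le hr hf hC
    have h5 : ‖fderiv ℂ f z (v - z)‖ ≤ 2 * C := by
      refine ((fderiv ℂ f z).le_opNorm _).trans ?_
      have h6 : ‖v - z‖ ≤ r := by simpa [dist_eq_norm] using (mem_ball.1 hv).le
      have hC0 : 0 ≤ C := (norm_nonneg _).trans h3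
      calc ‖fderiv ℂ f z‖ * ‖v - z‖ ≤ 2 * C / r * r := by gcongr
        _ = 2 * C := by field_simp
    have h7 : g v - f z = (f v - f z) - fderiv ℂ f z (v - z) := by simp only [hg]; abel
    rw [h7]
    have := norm_sub_le (f v - f z) (fderiv ℂ f z (v - z))
    linarith
  have hlo : (fun w => g w - g z) =o[𝓝 z] fun w => ‖w - z‖ ^ 1 := by
    have := hfz.hasFDerivAt.isLittleO
    simp only [pow_one]
    refine (this.congr_left fun w => ?_).norm_right
    simp only [hg, sub_self, map_zero, sub_zero]; abel
  have := Complex.dist_le_mul_div_pow_of_mapsTo_ball_of_isLittleO (n := 1) hgd hmaps hlo hw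
  rw [dist_eq_norm, dist_eq_norm, hgz] at this
  have h8 : f w - f z - fderiv ℂ f z (w - z) = g w - f z := sub_right_comm _ _ _
  rw [h8]
  exact this

/-- Locally uniform limits of holomorphic functions are holomorphic and the derivatives converge
locally uniformly. -/
theorem differentiableOn_and_tendsto_fderiv [ProperSpace E] [CompleteSpace F] {ι : Type*}
    {l : Filter ι} [l.NeBot] {f : ι → E → F} {g : E → F} {U : Set E} (hU : IsOpen U)
    (hfg : TendstoLocallyUniformlyOn f g l U) (hf : ∀ᶠ n in l, DifferentiableOn ℂ (f n) U) :
    DifferentiableOn ℂ g U ∧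
      TendstoLocallyUniformlyOn (fun n => fderiv ℂ (f n)) (fderiv ℂ g) l U := by
  -- The Cauchy estimate for the differences `f m - f n` on balls of radius `R / 2` makes the
  -- derivatives uniformly Cauchy.
  have key : ∀ z₀ ∈ U, ∃ r > 0, ball z₀ r ⊆ U ∧
      UniformCauchySeqOn (fun n => fderiv ℂ (f n)) l (ball z₀ r) := by
    intro z₀ hz₀
    obtain ⟨R, hR, hRU⟩ := nhds_basis_closedBall.mem_iff.1 (hU.mem_nhds hz₀)
    have hun := (tendstoLocallyUniformlyOn_iff_forall_isCompact hU).1 hfg _ hRU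
      (isCompact_closedBall z₀ R)
    refine ⟨R / 2, by positivity,
      (ball_subset_ball (by linarith)).trans (ball_subset_closedBall.trans hRU), ?_⟩
    have hc := hun.uniformCauchySeqOn
    intro u hu
    obtain ⟨ε, hε, hεu⟩ := Metric.mem_uniformity_dist.1 hu
    -- Chosen so that the Cauchy estimate gives `2 * (ε * R / 8) / (R / 2) = ε / 2`.
    have hδ : 0 < ε * R / 8 := by positivity
    filter_upwards [hc _ (Metric.dist_mem_uniformity hδ), hf.prod_mk hf] with p hp hpd z hz
    refine hεu ?_
    have hsub : ball z (R / 2) ⊆ closedBall z₀ R := by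
      intro w hw
      rw [mem_ball] at hw hz
      rw [mem_closedBall]
      linarith [dist_triangle w z z₀]
    have hsubU := hsub.trans hRU
    have hz' : U ∈ 𝓝 z := mem_of_superset (ball_mem_nhds z (by positivity)) hsubU
    have := norm_fderiv_le_of_norm_le (f := f p.1 - f p.2) (z := z) (r := R / 2)
      (C := ε * R / 8) (by positivity) ((hpd.1.sub hpd.2).mono hsubU) (fun w hw => by
        rw [Pi.sub_apply, ← dist_eq_norm]; exact (hp w (hsub hw)).le)
    rw [fderiv_sub (hpd.1.differentiableAt hz') (hpd.2.differentiableAt hz'),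
      ← dist_eq_norm] at this
    refine this.trans_lt ?_
    have : 2 * (ε * R / 8) / (R / 2) = ε / 2 := by field_simp; norm_num
    rw [this]
    linarith
  have hex : ∀ z ∈ U, ∃ A, Tendsto (fun n => fderiv ℂ (f n) z) l (𝓝 A) := by
    intro z hz
    obtain ⟨r, hr, -, hc⟩ := key z hz
    exact cauchy_map_iff_exists_tendsto.1 (hc.cauchy_map (mem_ball_self hr))
  choose! A hA using hex
  have hfd : ∀ z ∈ U, HasFDerivAt g (A z) z := by
    intro z hz
    obtain ⟨r, hr, hrU, hc⟩ := key z hz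
    have hunif := hc.tendstoUniformlyOn_of_tendsto fun w hw => hA w (hrU hw)
    refine hasFDerivAt_of_tendstoUniformlyOnFilter (l := l) (f := f)
      (hunif.tendstoUniformlyOnFilter.mono_right (le_principal_iff.2 (ball_mem_nhds z hr)))
      ?_ ?_
    · filter_upwards [prod_mem_prod hf (hU.mem_nhds hz)] with p hp
      exact (hp.1.differentiableAt (hU.mem_nhds hp.2)).hasFDerivAt
    · filter_upwards [hU.mem_nhds hz] with w hw using hfg.tendsto_at hw
  refine ⟨fun z hz => (hfd z hz).differentiableAt.differentiableWithinAt, ?_⟩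
  refine tendstoLocallyUniformlyOn_of_forall_exists_nhds fun z hz => ?_
  obtain ⟨r, hr, hrU, hc⟩ := key z hz
  refine ⟨ball z r, mem_nhdsWithin_of_mem_nhds (ball_mem_nhds z hr), ?_⟩
  refine hc.tendstoUniformlyOn_of_tendsto fun w hw => ?_
  rw [(hfd w (hrU hw)).fderiv]
  exact hA w (hrU hw)

/-- In a basis of the finite-dimensional source, an operator-valued map is a tuple of its values on
basis vectors. -/
theorem differentiableOn_clm_apply [FiniteDimensional ℂ E] {D : Type*} [NormedAddCommGroup D]
    [NormedSpace ℂ D] {f : D → E →L[ℂ] F} {s : Set D}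
    (h : ∀ y, DifferentiableOn ℂ (fun x => f x y) s) : DifferentiableOn ℂ f s := by
  let d := Module.finrank ℂ E
  have hd : d = Module.finrank ℂ (Fin d → ℂ) := (Module.finrank_fin_fun ℂ).symm
  let e₁ := ContinuousLinearEquiv.ofFinrankEq hd
  let e₂ := (e₁.arrowCongr (1 : F ≃L[ℂ] F)).trans (ContinuousLinearEquiv.piRing (Fin d))
  rw [← Function.id_comp f, ← e₂.symm_comp_self]
  exact e₂.symm.differentiable.comp_differentiableOn (differentiableOn_pi.2 fun i => h _)

/-- The derivative of a holomorphic function is holomorphic. -/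
theorem differentiableOn_fderiv [FiniteDimensional ℂ E] [CompleteSpace F] {f : E → F} {U : Set E}
    (hU : IsOpen U) (hf : DifferentiableOn ℂ f U) : DifferentiableOn ℂ (fderiv ℂ f) U := by
  have : ProperSpace E := FiniteDimensional.proper ℂ E
  refine differentiableOn_clm_apply fun v => ?_
  intro z₀ hz₀
  refine DifferentiableAt.differentiableWithinAt ?_
  obtain ⟨R, hR, hRU⟩ := nhds_basis_closedBall.mem_iff.1 (hU.mem_nhds hz₀)
  obtain ⟨C, hC⟩ := (isCompact_closedBall z₀ R).exists_bound_of_continuousOn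
    (hf.continuousOn.mono hRU)
  have hC0 : 0 ≤ C := (norm_nonneg _).trans (hC z₀ (mem_closedBall_self hR.le))
  have hsub : ∀ z ∈ ball z₀ (R / 2), ball z (R / 2) ⊆ closedBall z₀ R := by
    intro z hz w hw
    rw [mem_ball] at hw hz
    rw [mem_closedBall]
    linarith [dist_triangle w z z₀]
  -- The directional derivative is a uniform limit of difference quotients, by the second order
  -- Taylor estimate. These are holomorphic in `z`, so the limit is too.
  have hlim : TendstoUniformlyOn (fun (t : ℂ) z => t⁻¹ • (f (z + t • v) - f z))
      (fun z => fderiv ℂ f z v) (𝓝[≠] 0) (ball z₀ (R / 2)) := by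
    rw [Metric.tendstoUniformlyOn_iff]
    intro ε hε
    have h1 : ∀ᶠ t : ℂ in 𝓝[≠] 0, ‖t • v‖ < R / 2 := by
      have : Tendsto (fun t : ℂ => ‖t • v‖) (𝓝[≠] 0) (𝓝 0) := by
        have : Continuous fun t : ℂ => ‖t • v‖ := by fun_prop
        simpa using (this.tendsto 0).mono_left nhdsWithin_le_nhds
      exact this.eventually_lt_const (by positivity)
    have h2 : ∀ᶠ t : ℂ in 𝓝[≠] 0, ‖t‖ * (4 * C * (‖v‖ / (R / 2)) ^ 2) < ε := by
      have : Tendsto (fun t : ℂ => ‖t‖ * (4 * C * (‖v‖ / (R / 2)) ^ 2)) (𝓝[≠] 0) (𝓝 0) := by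
        have : Continuous fun t : ℂ => ‖t‖ * (4 * C * (‖v‖ / (R / 2)) ^ 2) := by fun_prop
        simpa using (this.tendsto 0).mono_left nhdsWithin_le_nhds
      exact this.eventually_lt_const hε
    filter_upwards [h1, h2, self_mem_nhdsWithin] with t ht1 ht2 ht0 z hz
    have ht0 : t ≠ 0 := ht0
    have h3 := norm_sub_sub_fderiv_le (f := f) (z := z) (w := z + t • v) (r := R / 2) (C := C)
      (hf.mono ((hsub z hz).trans hRU)) (fun w hw => hC w (hsub z hz hw))
      (by simpa [dist_eq_norm] using ht1)
    rw [add_sub_cancel_left, map_smul] at h3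
    have h4 : fderiv ℂ f z v - t⁻¹ • (f (z + t • v) - f z)
        = -(t⁻¹ • (f (z + t • v) - f z - t • fderiv ℂ f z v)) := by
      rw [smul_sub t⁻¹ _ (t • _), smul_smul, inv_mul_cancel₀ ht0, one_smul]; abel
    rw [dist_eq_norm, h4, norm_neg, norm_smul, norm_inv]
    refine lt_of_le_of_lt ?_ ht2
    rw [inv_mul_le_iff₀ (norm_pos_iff.2 ht0)]
    refine h3.trans (le_of_eq ?_)
    rw [norm_smul]; ring
  refine ((differentiableOn_and_tendsto_fderiv isOpen_ball hlim.tendstoLocallyUniformlyOn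
    ?_).1).differentiableAt (ball_mem_nhds z₀ (by positivity))
  have h1 : ∀ᶠ t : ℂ in 𝓝[≠] 0, ‖t • v‖ < R / 2 := by
    have : Tendsto (fun t : ℂ => ‖t • v‖) (𝓝[≠] 0) (𝓝 0) := by
      have : Continuous fun t : ℂ => ‖t • v‖ := by fun_prop
      simpa using (this.tendsto 0).mono_left nhdsWithin_le_nhds
    exact this.eventually_lt_const (by positivity)
  filter_upwards [h1] with t ht
  have hfz : ∀ z ∈ closedBall z₀ R, DifferentiableAt ℂ f z := fun z hz =>
    hf.differentiableAt (hU.mem_nhds (hRU hz))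
  intro z hz
  have hA : DifferentiableAt ℂ f (z + t • v) :=
    hfz _ (hsub z hz (by simpa [dist_eq_norm] using ht))
  have hB : DifferentiableAt ℂ f z := hfz _ (hsub z hz (mem_ball_self (by positivity)))
  refine DifferentiableAt.differentiableWithinAt ?_
  exact ((hA.comp z (by fun_prop)).sub hB).const_smul _

/-- Iterates the holomorphy of the derivative. The induction replaces `F` by `E →L[ℂ] F`, which is
why both spaces live in one universe. -/
theorem contDiffOn_of_differentiableOn {E F : Type u} [NormedAddCommGroup E] [NormedSpace ℂ E]
    [NormedAddCommGroup F] [NormedSpace ℂ F] [FiniteDimensional ℂ E] [CompleteSpace F] {f : E → F}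
    {U : Set E} (hU : IsOpen U) (hf : DifferentiableOn ℂ f U) : ContDiffOn ℂ ∞ f U := by
  rw [contDiffOn_infty]
  intro k
  induction k generalizing F with
  | zero => exact contDiffOn_zero.2 hf.continuousOn
  | succ k ih =>
    rw [Nat.cast_succ, contDiffOn_succ_iff_fderiv_of_isOpen hU]
    exact ⟨hf, by simp, ih (differentiableOn_fderiv hU hf)⟩

theorem contDiffOn_real_of_differentiableOn {E F : Type u} [NormedAddCommGroup E] [NormedSpace ℂ E]
    [NormedAddCommGroup F] [NormedSpace ℂ F] [FiniteDimensional ℂ E] [CompleteSpace F] {f : E → F}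
    {U : Set E} (hU : IsOpen U) (hf : DifferentiableOn ℂ f U) :
    ContDiffOn ℝ ∞ f U :=
  (contDiffOn_of_differentiableOn hU hf).restrict_scalars ℝ

/-- A locally bounded pointwise convergent family of holomorphic functions converges locally
uniformly. -/
theorem tendstoLocallyUniformlyOn_of_tendsto {ι : Type*} {l : Filter ι} [l.NeBot] {f : ι → E → F}
    {g : E → F} {U : Set E} (hf : ∀ i, DifferentiableOn ℂ (f i) U)
    (hb : ∀ z ∈ U, ∃ r > 0, ∃ C, ball z r ⊆ U ∧ ∀ i, ∀ w ∈ ball z r, ‖f i w‖ ≤ C)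
    (hg : ∀ z ∈ U, Tendsto (fun i => f i z) l (𝓝 (g z))) :
    TendstoLocallyUniformlyOn f g l U := by
  rw [Metric.tendstoLocallyUniformlyOn_iff]
  intro ε hε z hz
  obtain ⟨r, hr, C, hrU, hC⟩ := hb z hz
  -- The local bound gives a common Lipschitz constant at `z`, which the pointwise limit inherits;
  -- convergence at `z` then controls a neighbourhood.
  have hlip : ∀ i, ∀ w ∈ ball z r, dist (f i w) (f i z) ≤ 2 * C / r * dist w z := fun i w hw =>
    dist_le_of_norm_le ((hf i).mono hrU) (hC i) hw
  have hlip' : ∀ w ∈ ball z r, dist (g w) (g z) ≤ 2 * C / r * dist w z := fun w hw =>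
    le_of_tendsto ((hg w (hrU hw)).dist (hg z hz)) (Eventually.of_forall fun i => hlip i w hw)
  have h1 : ∀ᶠ w in 𝓝 z, 2 * C / r * dist w z < ε / 3 := by
    have : Tendsto (fun w => 2 * C / r * dist w z) (𝓝 z) (𝓝 0) := by
      have : Continuous fun w => 2 * C / r * dist w z := by fun_prop
      simpa using this.tendsto z
    exact this.eventually_lt_const (by positivity)
  refine ⟨_, mem_nhdsWithin_of_mem_nhds (h1.and (ball_mem_nhds z hr)), ?_⟩
  filter_upwards [(Metric.tendsto_nhds.1 (hg z hz)) (ε / 3) (by positivity)] with i hi w hw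
  have h2 := hlip i w hw.2
  have h3 := hlip' w hw.2
  have h4 := hw.1
  have h5 := dist_triangle4 (g w) (g z) (f i z) (f i w)
  rw [dist_comm (g z), dist_comm (f i z) (f i w)] at h5
  linarith

end Holomorphic
end BergmanTower

namespace BergmanTower

/-! ### Locally uniform convergence with all derivatives. -/

section SmoothConvergence

variable {ι α β : Type*} {l : Filter ι}

/-- For a continuous limit, locally uniform convergence is joint convergence in index and point. In
this form it is stable under continuous maps by mere composition of limits. -/
theorem tendstoLocallyUniformlyOn_iff_tendsto_prod [TopologicalSpace α] [UniformSpace β]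
    {f : ι → α → β} {g : α → β} {U : Set α} (hU : IsOpen U) (hg : ContinuousOn g U) :
    TendstoLocallyUniformlyOn f g l U ↔
      ∀ x ∈ U, Tendsto (fun p : ι × α => f p.1 p.2) (l ×ˢ 𝓝 x) (𝓝 (g x)) := by
  rw [hU.tendstoLocallyUniformlyOn_iff_forall_tendsto]
  refine forall₂_congr fun x hx => ?_
  have hgx : Tendsto (fun p : ι × α => g p.2) (l ×ˢ 𝓝 x) (𝓝 (g x)) :=
    ((hg.continuousAt (hU.mem_nhds hx)).tendsto).comp tendsto_snd
  constructor
  · intro h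
    exact hgx.congr_uniformity h
  · intro h
    exact (hgx.prodMk_nhds h).mono_right (nhds_le_uniformity (g x))

variable {E F G : Type*} [NormedAddCommGroup E] [NormedSpace ℝ E]
  [NormedAddCommGroup F] [NormedSpace ℝ F] [NormedAddCommGroup G] [NormedSpace ℝ G]

/-- Convergence of smooth functions on an open set, locally uniformly with all derivatives. -/
structure SmoothTendstoOn (l : Filter ι) (f : ι → E → F) (g : E → F) (U : Set E) : Prop where
  eventually : ∀ᶠ n in l, ContDiffOn ℝ ∞ (f n) U
  limit : ContDiffOn ℝ ∞ g U
  tendsto : ∀ k : ℕ, ∀ x ∈ U, Tendsto (fun p : ι × E => iteratedFDeriv ℝ k (f p.1) p.2)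
    (l ×ˢ 𝓝 x) (𝓝 (iteratedFDeriv ℝ k g x))

namespace SmoothTendstoOn

variable {f f' : ι → E → F} {g g' : E → F} {U V : Set E}

theorem mono (h : SmoothTendstoOn l f g U) (hVU : V ⊆ U) : SmoothTendstoOn l f g V :=
  ⟨h.eventually.mono fun _ hn => hn.mono hVU, h.limit.mono hVU, fun k x hx => h.tendsto k x (hVU hx)⟩

theorem congr (h : SmoothTendstoOn l f g U) (hU : IsOpen U) (hf : ∀ᶠ n in l, EqOn (f' n) (f n) U)
    (hg : EqOn g' g U) : SmoothTendstoOn l f' g' U := by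
  refine ⟨?_, h.limit.congr hg, fun k x hx => ?_⟩
  · filter_upwards [h.eventually, hf] with n hn hfn using hn.congr hfn
  · have h1 : iteratedFDeriv ℝ k g' x = iteratedFDeriv ℝ k g x :=
      ((hg.eventuallyEq_of_mem (hU.mem_nhds hx)).iteratedFDeriv ℝ k).self_of_nhds
    rw [h1]
    refine (h.tendsto k x hx).congr' ?_
    filter_upwards [prod_mem_prod hf (hU.mem_nhds hx)] with p hp
    exact (((hp.1).eventuallyEq_of_mem (hU.mem_nhds hp.2)).iteratedFDeriv ℝ k).self_of_nhds.symm

theorem clm_comp (h : SmoothTendstoOn l f g U) (hU : IsOpen U) (L : F →L[ℝ] G) :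
    SmoothTendstoOn l (fun n x => L (f n x)) (fun x => L (g x)) U := by
  refine ⟨h.eventually.mono fun n hn => L.contDiff.comp_contDiffOn hn,
    L.contDiff.comp_contDiffOn h.limit, fun k x hx => ?_⟩
  have h1 : ∀ (u : E → F), ContDiffOn ℝ ∞ u U → ∀ y ∈ U,
      iteratedFDeriv ℝ k (fun x => L (u x)) y
        = L.compContinuousMultilinearMap (iteratedFDeriv ℝ k u y) := fun u hu y hy =>
    L.iteratedFDeriv_comp_left (hu.contDiffAt (hU.mem_nhds hy)) (by exact_mod_cast le_top)
  rw [h1 g h.limit x hx]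
  refine Tendsto.congr' ?_ (((ContinuousLinearMap.compContinuousMultilinearMapL ℝ (fun _ : Fin k => E) F G L).continuous.tendsto _).comp (h.tendsto k x hx))
  filter_upwards [prod_mem_prod h.eventually (hU.mem_nhds hx)] with p hp
  exact (h1 _ hp.1 _ hp.2).symm

theorem comp_clm (h : SmoothTendstoOn l f g U) (hU : IsOpen U) (L : G →L[ℝ] E) :
    SmoothTendstoOn l (fun n x => f n (L x)) (fun x => g (L x)) (L ⁻¹' U) := by
  refine ⟨h.eventually.mono fun n hn => hn.comp L.contDiff.contDiffOn (mapsTo_preimage _ _),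
    h.limit.comp L.contDiff.contDiffOn (mapsTo_preimage _ _), fun k x hx => ?_⟩
  have hU' : IsOpen (L ⁻¹' U) := hU.preimage L.continuous
  have h1 : ∀ (u : E → F), ContDiffOn ℝ ∞ u U → ∀ y ∈ L ⁻¹' U,
      iteratedFDeriv ℝ k (fun x => u (L x)) y
        = (iteratedFDeriv ℝ k u (L y)).compContinuousLinearMap fun _ => L := fun u hu y hy => by
    have := L.iteratedFDerivWithin_comp_right hu hU.uniqueDiffOn hU'.uniqueDiffOn hy
      (i := k) (by exact_mod_cast le_top)
    rwa [iteratedFDerivWithin_of_isOpen k hU' hy, iteratedFDerivWithin_of_isOpen k hU hy] at this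
  rw [h1 g h.limit x hx]
  have hL : Tendsto (fun p : ι × G => (p.1, L p.2)) (l ×ˢ 𝓝 x) (l ×ˢ 𝓝 (L x)) :=
    tendsto_id.prodMap (L.continuous.tendsto x)
  refine Tendsto.congr' ?_ (((ContinuousMultilinearMap.compContinuousLinearMapL (fun _ : Fin k => L)).continuous.tendsto _).comp ((h.tendsto k (L x) hx).comp hL))
  filter_upwards [prod_mem_prod h.eventually (hU'.mem_nhds hx)] with p hp
  exact (h1 _ hp.1 _ hp.2).symm

/-- The derivative of order `k` of the differential is the derivative of order `k + 1`, up to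
currying. -/
theorem fderiv (h : SmoothTendstoOn l f g U) (hU : IsOpen U) :
    SmoothTendstoOn l (fun n => fderiv ℝ (f n)) (fderiv ℝ g) U := by
  refine ⟨h.eventually.mono fun n hn => hn.fderiv_of_isOpen hU (by simp),
    h.limit.fderiv_of_isOpen hU (by simp), fun k x hx => ?_⟩
  have h1 : ∀ (u : E → F) y, iteratedFDeriv ℝ k (_root_.fderiv ℝ u) y
      = continuousMultilinearCurryRightEquiv' ℝ k E F (iteratedFDeriv ℝ (k + 1) u y) := by
    intro u y
    rw [iteratedFDeriv_succ_eq_comp_right]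
    simp
  simp only [h1]
  exact ((continuousMultilinearCurryRightEquiv' ℝ k E F).continuous.tendsto _).comp
    (h.tendsto (k + 1) x hx)

theorem tendstoUniformlyOn [LocallyCompactSpace E] (h : SmoothTendstoOn l f g U) (hU : IsOpen U)
    {K : Set E} (hKU : K ⊆ U) (hK : IsCompact K) (k : ℕ) :
    TendstoUniformlyOn (fun n => iteratedFDeriv ℝ k (f n)) (iteratedFDeriv ℝ k g) l K := by
  refine (tendstoLocallyUniformlyOn_iff_forall_isCompact hU).1
    ((tendstoLocallyUniformlyOn_iff_tendsto_prod hU ?_).2 (h.tendsto k)) K hKU hK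
  have := h.limit.continuousOn_iteratedFDerivWithin (m := k) (by exact_mod_cast le_top)
    hU.uniqueDiffOn
  exact this.congr fun x hx => (iteratedFDerivWithin_of_isOpen k hU hx).symm

end SmoothTendstoOn

end SmoothConvergence

theorem fderiv_real_eq_restrictScalars {E F : Type*} [NormedAddCommGroup E] [NormedSpace ℂ E]
    [NormedAddCommGroup F] [NormedSpace ℂ F] {f : E → F} {z : E} (h : DifferentiableAt ℂ f z) :
    fderiv ℝ f z = (fderiv ℂ f z).restrictScalars ℝ :=
  (h.hasFDerivAt.restrictScalars ℝ).fderiv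

/-- Locally uniform convergence of holomorphic functions is convergence with all derivatives. -/
theorem smoothTendstoOn_of_holomorphic {ι : Type*} {l : Filter ι} [l.NeBot] {E F : Type u}
    [NormedAddCommGroup E] [NormedSpace ℂ E] [FiniteDimensional ℂ E]
    [NormedAddCommGroup F] [NormedSpace ℂ F] [CompleteSpace F] {f : ι → E → F} {g : E → F}
    {U : Set E} (hU : IsOpen U) (hfg : TendstoLocallyUniformlyOn f g l U)
    (hf : ∀ᶠ n in l, DifferentiableOn ℂ (f n) U) : SmoothTendstoOn l f g U := by
  have hproper : ProperSpace E := FiniteDimensional.proper ℂ E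
  have hg := (differentiableOn_and_tendsto_fderiv hU hfg hf).1
  refine ⟨hf.mono fun n hn => contDiffOn_real_of_differentiableOn hU hn,
    contDiffOn_real_of_differentiableOn hU hg, fun k => ?_⟩
  induction k generalizing F with
  | zero =>
    intro x hx
    have h0 := (tendstoLocallyUniformlyOn_iff_tendsto_prod hU hg.continuousOn).1 hfg x hx
    simp only [iteratedFDeriv_zero_eq_comp]
    exact ((continuousMultilinearCurryFin0 ℝ E F).symm.continuous.tendsto _).comp h0
  | succ k ih =>
    intro x hx
    have h1 := (differentiableOn_and_tendsto_fderiv hU hfg hf).2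
    have hf' : ∀ᶠ n in l, DifferentiableOn ℂ (fderiv ℂ (f n)) U :=
      hf.mono fun n hn => differentiableOn_fderiv hU hn
    have h2 := ih h1 hf' (differentiableOn_fderiv hU hg)
    -- The real derivative is the restriction of scalars of the complex one, so real derivatives of
    -- order `k + 1` are fixed continuous images of those of order `k` of the holomorphic map
    -- `fderiv ℂ u`, to which the induction hypothesis applies.
    let R : (E →L[ℂ] F) →L[ℝ] (E →L[ℝ] F) := ContinuousLinearMap.restrictScalarsL ℂ E F ℝ ℝ
    have h3 : ∀ u : E → F, DifferentiableOn ℂ u U → ∀ y ∈ U, iteratedFDeriv ℝ (k + 1) u y =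
        (continuousMultilinearCurryRightEquiv' ℝ k E F).symm
          (R.compContinuousMultilinearMap (iteratedFDeriv ℝ k (fderiv ℂ u) y)) := by
      intro u hu y hy
      rw [iteratedFDeriv_succ_eq_comp_right, Function.comp_apply]
      congr 1
      have h4 : fderiv ℝ u =ᶠ[𝓝 y] R ∘ fderiv ℂ u := by
        filter_upwards [hU.mem_nhds hy] with w hw
        exact fderiv_real_eq_restrictScalars (hu.differentiableAt (hU.mem_nhds hw))
      rw [(h4.iteratedFDeriv ℝ k).self_of_nhds]
      exact R.iteratedFDeriv_comp_left ((contDiffOn_real_of_differentiableOn hU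
        (differentiableOn_fderiv hU hu)).contDiffAt (hU.mem_nhds hy)) (by exact_mod_cast le_top)
    rw [h3 g hg x hx]
    refine Tendsto.congr' ?_ ((((continuousMultilinearCurryRightEquiv' ℝ k E F).symm.continuous.comp
      (ContinuousLinearMap.compContinuousMultilinearMapL ℝ (fun _ : Fin k => E) _ _ R).continuous).tendsto
      _).comp (h2 x hx))
    filter_upwards [prod_mem_prod hf (hU.mem_nhds hx)] with p hp
    exact (h3 _ hp.1 _ hp.2).symm

end BergmanTower

namespace BergmanTower

/-! ### The mean value inequality for squares of holomorphic functions. -/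

section MeanValue

open Metric

variable {n : ℕ}

theorem measurePreserving_smul_of_norm_eq_one (a : Circle) :
    MeasurePreserving (fun v : Fin n → ℂ => (a : ℂ) • v) := by
  exact volume_preserving_pi fun _ : Fin n => (rotation a).measurePreserving

/-- The one-variable mean value property of `ζ ↦ f (z + ζ • v) ^ 2` on the unit disc, followed by
the triangle inequality for the integral. -/
theorem enorm_sq_le_lintegral_circle {f : (Fin n → ℂ) → ℂ} {z v : Fin n → ℂ} {r : ℝ}
    (hf : DifferentiableOn ℂ f (ball z r)) (hv : v ∈ ball (0 : Fin n → ℂ) r) :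
    ENNReal.ofReal (2 * Real.pi) * ‖f z‖ₑ ^ 2 ≤
      ∫⁻ θ in Ioc 0 (2 * Real.pi), ‖f (z + circleMap 0 1 θ • v)‖ₑ ^ 2 := by
  have hv' : ‖v‖ < r := by simpa using hv
  have hmaps : MapsTo (fun ζ : ℂ => z + ζ • v) (closedBall 0 1) (ball z r) := by
    intro ζ hζ
    have hζ : ‖ζ‖ ≤ 1 := by simpa using hζ
    rw [mem_ball, dist_eq_norm, add_sub_cancel_left, norm_smul]
    calc ‖ζ‖ * ‖v‖ ≤ 1 * ‖v‖ := by gcongr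
      _ < r := by linarith
  have hd : DifferentiableOn ℂ (fun ζ : ℂ => f (z + ζ • v) ^ 2) (closedBall 0 1) :=
    (hf.comp (by fun_prop) hmaps).pow 2
  have hdc : DiffContOnCl ℂ (fun ζ : ℂ => f (z + ζ • v) ^ 2) (ball 0 |1|) := by
    refine DifferentiableOn.diffContOnCl ?_
    rw [abs_one, closure_ball _ one_ne_zero]
    exact hd
  have h1 := hdc.circleAverage
  simp only [zero_smul, add_zero] at h1
  rw [Real.circleAverage_def] at h1
  have h2 : (2 * Real.pi) • f z ^ 2
      = ∫ θ in Ioc 0 (2 * Real.pi), f (z + circleMap 0 1 θ • v) ^ 2 := by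
    rw [← h1, smul_smul, mul_inv_cancel₀ (by positivity), one_smul,
      intervalIntegral.integral_of_le (by positivity)]
  have h3 := enorm_integral_le_lintegral_enorm (μ := volume.restrict (Ioc 0 (2 * Real.pi)))
    (fun θ => f (z + circleMap 0 1 θ • v) ^ 2)
  rw [← h2, enorm_smul, enorm_pow, Real.enorm_of_nonneg (by positivity)] at h3
  simpa only [enorm_pow] using h3

/-- The mean value inequality for `|f|²` on balls of `ℂⁿ`, `f` holomorphic. -/
theorem enorm_sq_mul_volume_le {f : (Fin n → ℂ) → ℂ} {z : Fin n → ℂ} {r : ℝ}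
    (hf : DifferentiableOn ℂ f (ball z r)) :
    ‖f z‖ₑ ^ 2 * volume (ball (0 : Fin n → ℂ) r) ≤ ∫⁻ w in ball z r, ‖f w‖ₑ ^ 2 := by
  set B := ball (0 : Fin n → ℂ) r with hB
  have hπ0 : ENNReal.ofReal (2 * Real.pi) ≠ 0 := by
    simp [Real.pi_pos]
  have hcirc : ∀ θ, ‖circleMap 0 1 θ‖ = 1 := by simp
  -- Multiplication by a scalar of modulus one preserves Lebesgue measure and the ball, here a
  -- polydisc.
  have hrot : ∀ θ, ∫⁻ v in B, ‖f (z + circleMap 0 1 θ • v)‖ₑ ^ 2 = ∫⁻ w in ball z r, ‖f w‖ₑ ^ 2 := by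
    intro θ
    obtain ⟨a, ha'⟩ : ∃ a : Circle, (a : ℂ) = circleMap 0 1 θ :=
      ⟨Circle.exp θ, by simp [circleMap]⟩
    rw [← ha']
    have h1 : MeasurePreserving (fun v : Fin n → ℂ => z + (a : ℂ) • v) :=
      (measurePreserving_add_left volume z).comp (measurePreserving_smul_of_norm_eq_one a)
    have ha : (a : ℂ) ≠ 0 := a.coe_ne_zero
    have h2 : MeasurableEmbedding (fun v : Fin n → ℂ => z + (a : ℂ) • v) :=
      ((Homeomorph.smulOfNeZero (a : ℂ) ha).trans (Homeomorph.addLeft z)).measurableEmbedding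
    have h3 : (fun v : Fin n → ℂ => z + (a : ℂ) • v) ⁻¹' ball z r = B := by
      ext v
      simp [hB, norm_smul, Circle.norm_coe]
    rw [← h1.setLIntegral_comp_preimage_emb h2 (fun w => ‖f w‖ₑ ^ 2) (ball z r), h3]
  have hmeas : AEMeasurable (Function.uncurry fun (v : Fin n → ℂ) (θ : ℝ) =>
      ‖f (z + circleMap 0 1 θ • v)‖ₑ ^ 2)
      ((volume.restrict B).prod (volume.restrict (Ioc 0 (2 * Real.pi)))) := by
    rw [Measure.prod_restrict]
    have hcont : ContinuousOn (fun p : (Fin n → ℂ) × ℝ => f (z + circleMap 0 1 p.2 • p.1))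
        (B ×ˢ univ) := by
      refine hf.continuousOn.comp (by fun_prop) ?_
      rintro ⟨v, θ⟩ ⟨hv, -⟩
      have hv : ‖v‖ < r := by simpa [hB] using hv
      simpa [norm_smul] using hv
    have hm : AEMeasurable (fun p : (Fin n → ℂ) × ℝ => f (z + circleMap 0 1 p.2 • p.1))
        ((volume.prod volume).restrict (B ×ˢ univ)) :=
      hcont.aemeasurable (isOpen_ball.measurableSet.prod MeasurableSet.univ)
    exact ((hm.mono_measure (Measure.restrict_mono (prod_mono_right (subset_univ _)) le_rfl)).enorm).pow_const 2
  -- Integrate the circle inequality over `v` in the ball and exchange the integrals: every inner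
  -- integral is then the same.
  have hmain : ENNReal.ofReal (2 * Real.pi) * (‖f z‖ₑ ^ 2 * volume B) ≤
      ENNReal.ofReal (2 * Real.pi) * ∫⁻ w in ball z r, ‖f w‖ₑ ^ 2 := by
    calc ENNReal.ofReal (2 * Real.pi) * (‖f z‖ₑ ^ 2 * volume B)
        = ∫⁻ _ in B, ENNReal.ofReal (2 * Real.pi) * ‖f z‖ₑ ^ 2 := by
          rw [setLIntegral_const, mul_assoc]
      _ ≤ ∫⁻ v in B, ∫⁻ θ in Ioc 0 (2 * Real.pi), ‖f (z + circleMap 0 1 θ • v)‖ₑ ^ 2 :=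
          setLIntegral_mono' isOpen_ball.measurableSet fun v hv =>
            enorm_sq_le_lintegral_circle hf hv
      _ = ∫⁻ θ in Ioc 0 (2 * Real.pi), ∫⁻ v in B, ‖f (z + circleMap 0 1 θ • v)‖ₑ ^ 2 :=
          lintegral_lintegral_swap hmeas
      _ = ENNReal.ofReal (2 * Real.pi) * ∫⁻ w in ball z r, ‖f w‖ₑ ^ 2 := by
          simp_rw [hrot]
          rw [setLIntegral_const, Real.volume_Ioc, sub_zero, mul_comm]
  exact (ENNReal.mul_le_mul_iff_right hπ0 ENNReal.ofReal_ne_top).1 hmain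

end MeanValue

/-! ### The operator `(i/2) ∂∂̄`: linearity, pluriharmonic functions, holomorphic pullback. -/

section HalfIddbar

variable {n : ℕ}

/-- The linear map `φ ↦ (v ↦ - φ (i v))`. -/
def dcLinear (n : ℕ) :
    ((Fin n → ℂ) →L[ℝ] ℝ) →L[ℝ] (Fin n → ℂ) [⋀^Fin 1]→L[ℝ] ℝ :=
  (ContinuousAlternatingMap.ofSubsingletonLIE (𝕜 := ℝ) (E := Fin n → ℂ) (F := ℝ)
    (0 : Fin 1)).toContinuousLinearEquiv.toContinuousLinearMap ∘L
    (-(ContinuousLinearMap.compL ℝ (Fin n → ℂ) (Fin n → ℂ) ℝ).flip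
      (Complex.I • ContinuousLinearMap.id ℝ (Fin n → ℂ)))

theorem dc_eq (u : (Fin n → ℂ) → ℝ) (z : Fin n → ℂ) : dc u z = dcLinear n (fderiv ℝ u z) := by
  rfl

/-- `(i/2) ∂ \bar∂` as a linear map of the second derivative. -/
def halfIddbarLinear (n : ℕ) :
    ((Fin n → ℂ) →L[ℝ] (Fin n → ℂ) →L[ℝ] ℝ) →L[ℝ] (Fin n → ℂ) [⋀^Fin 2]→L[ℝ] ℝ :=
  (1 / 4 : ℝ) • (ContinuousAlternatingMap.alternatizeUncurryFinCLM ℝ (Fin n → ℂ) ℝ ∘L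
    ContinuousLinearMap.compL ℝ (Fin n → ℂ) _ _ (dcLinear n))

/-- Reduces smoothness and convergence of `(i/2) ∂∂̄ u` to those of the second derivative of `u`. -/
theorem halfIddbar_eq {u : (Fin n → ℂ) → ℝ} {z : Fin n → ℂ} (hu : ContDiffAt ℝ 2 u z) :
    halfIddbar u z = halfIddbarLinear n (fderiv ℝ (fderiv ℝ u) z) := by
  have h1 : DifferentiableAt ℝ (fderiv ℝ u) z :=
    (hu.fderiv_right (m := 1) (by norm_num)).differentiableAt (by norm_num)
  have h2 : fderiv ℝ (dc u) z = (dcLinear n).comp (fderiv ℝ (fderiv ℝ u) z) := by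
    have : dc u = fun z => dcLinear n (fderiv ℝ u z) := funext fun z => dc_eq u z
    rw [this]
    exact ((dcLinear n).hasFDerivAt.comp z h1.hasFDerivAt).fderiv
  rw [halfIddbar, extDeriv, h2]
  rfl

theorem differentiableAt_dc {u : (Fin n → ℂ) → ℝ} {z : Fin n → ℂ} (hu : ContDiffAt ℝ 2 u z) :
    DifferentiableAt ℝ (dc u) z := by
  have h1 : DifferentiableAt ℝ (fderiv ℝ u) z :=
    (hu.fderiv_right (m := 1) (by norm_num)).differentiableAt (by norm_num)
  exact ((dcLinear n).hasFDerivAt.comp z h1.hasFDerivAt).differentiableAt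

theorem halfIddbar_congr {u v : (Fin n → ℂ) → ℝ} {z : Fin n → ℂ} (h : u =ᶠ[𝓝 z] v) :
    halfIddbar u z = halfIddbar v z := by
  have : dc u =ᶠ[𝓝 z] dc v := by
    filter_upwards [h.fderiv (𝕜 := ℝ)] with w hw
    rw [dc_eq, dc_eq, hw]
  rw [halfIddbar, halfIddbar, this.extDeriv_eq]

theorem halfIddbar_add {u v : (Fin n → ℂ) → ℝ} {z : Fin n → ℂ} (hu : ContDiffAt ℝ 2 u z)
    (hv : ContDiffAt ℝ 2 v z) :
    halfIddbar (fun w => u w + v w) z = halfIddbar u z + halfIddbar v z := by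
  have h1 : dc (fun w => u w + v w) =ᶠ[𝓝 z] dc u + dc v := by
    filter_upwards [hu.eventually (by simp), hv.eventually (by simp)] with w hw hw'
    simp only [Pi.add_apply, dc_eq]
    rw [fderiv_fun_add (hw.differentiableAt (by norm_num)) (hw'.differentiableAt (by norm_num)),
      map_add]
  rw [halfIddbar, h1.extDeriv_eq, extDeriv_add (differentiableAt_dc hu) (differentiableAt_dc hv),
    smul_add]
  rfl

/-- The real part of a holomorphic function is pluriharmonic. -/
theorem halfIddbar_re_eq_zero {f : (Fin n → ℂ) → ℂ} {z : Fin n → ℂ} {U : Set (Fin n → ℂ)}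
    (hU : U ∈ 𝓝 z) (hf : DifferentiableOn ℂ f U) : halfIddbar (fun w => (f w).re) z = 0 := by
  set g : (Fin n → ℂ) → ℝ := fun w => (f w).im with hg
  have hfU : DifferentiableOn ℂ f (interior U) := hf.mono interior_subset
  have hsm : ContDiffAt ℝ 2 f z :=
    ((contDiffOn_real_of_differentiableOn isOpen_interior hfU).contDiffAt
      (isOpen_interior.mem_nhds (mem_interior_iff_mem_nhds.2 hU))).of_le (WithTop.coe_le_coe.2 (le_top : (2 : ℕ∞) ≤ ⊤))
  have hgsm : ContDiffAt ℝ 2 g z := Complex.imCLM.contDiff.contDiffAt.comp z hsm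
  -- Cauchy–Riemann: `d^c Re f = d Im f`, so a further exterior derivative vanishes.
  have h1 : dc (fun w => (f w).re) =ᶠ[𝓝 z] fun w =>
      extDeriv (fun x => ContinuousAlternatingMap.constOfIsEmpty ℝ (Fin n → ℂ) (Fin 0) (g x)) w := by
    filter_upwards [isOpen_interior.mem_nhds (mem_interior_iff_mem_nhds.2 hU)] with w hw
    have hd : HasFDerivAt f ((fderiv ℂ f w).restrictScalars ℝ) w :=
      (hfU.differentiableAt (isOpen_interior.mem_nhds hw)).hasFDerivAt.restrictScalars ℝ
    have hre : HasFDerivAt (fun w => (f w).re) _ w := Complex.reCLM.hasFDerivAt.comp w hd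
    have him : HasFDerivAt g _ w := Complex.imCLM.hasFDerivAt.comp w hd
    rw [extDeriv_constOfIsEmpty, dc, hre.fderiv, him.fderiv]
    congr 1
    ext v
    simp
  rw [halfIddbar, h1.extDeriv_eq]
  have h2 : extDeriv (extDeriv fun x =>
      ContinuousAlternatingMap.constOfIsEmpty ℝ (Fin n → ℂ) (Fin 0) (g x)) z = 0 :=
    extDeriv_extDeriv_apply (r := 2)
    ((ContinuousAlternatingMap.constOfIsEmptyLIE ℝ (Fin n → ℂ) ℝ (Fin 0)).contDiff.contDiffAt.comp
      z hgsm) (by simp)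
  exact (congrArg _ h2).trans (smul_zero _)

/-- `(i/2) ∂ \bar∂` commutes with pullback by holomorphic maps. -/
theorem halfIddbar_comp {u : (Fin n → ℂ) → ℝ} {φ : (Fin n → ℂ) → Fin n → ℂ} {z : Fin n → ℂ}
    {U : Set (Fin n → ℂ)} (hU : U ∈ 𝓝 z) (hφ : DifferentiableOn ℂ φ U)
    (hu : ContDiffAt ℝ 2 u (φ z)) :
    halfIddbar (u ∘ φ) z = (halfIddbar u (φ z)).compContinuousLinearMap
      ((fderiv ℂ φ z).restrictScalars ℝ) := by
  have hzU := mem_interior_iff_mem_nhds.2 hU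
  have hφU : DifferentiableOn ℂ φ (interior U) := hφ.mono interior_subset
  have hsm : ContDiffAt ℝ 2 φ z :=
    ((contDiffOn_real_of_differentiableOn isOpen_interior hφU).contDiffAt
      (isOpen_interior.mem_nhds hzU)).of_le (WithTop.coe_le_coe.2 (le_top : (2 : ℕ∞) ≤ ⊤))
  -- The derivative of `φ` commutes with multiplication by `i`, so `d^c` commutes with the pullback,
  -- as `d` always does.
  have h1 : dc (u ∘ φ) =ᶠ[𝓝 z] fun w => (dc u (φ w)).compContinuousLinearMap (fderiv ℝ φ w) := by
    filter_upwards [isOpen_interior.mem_nhds hzU, hsm.continuousAt.eventually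
      (hu.eventually (by simp))] with w hw huw
    have hd := (hφU.differentiableAt (isOpen_interior.mem_nhds hw))
    rw [fderiv_real_eq_restrictScalars hd, dc, dc, fderiv_comp w
      (huw.differentiableAt (by norm_num)) (hd.restrictScalars ℝ),
      fderiv_real_eq_restrictScalars hd]
    ext v
    simp
  rw [halfIddbar, h1.extDeriv_eq, extDeriv_pullback (differentiableAt_dc hu) hsm (by simp),
    fderiv_real_eq_restrictScalars (hφU.differentiableAt (isOpen_interior.mem_nhds hzU))]
  rfl

end HalfIddbar

end BergmanTower

/-! ### Local expressions of sections and the Bergman inequality. -/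

namespace BergmanTower

/-- The density of `α^n / n!` with respect to Lebesgue measure in the chart `c`. -/
def TwoForm.density {n : ℕ} {X : Type*} [TopologicalSpace X] [ChartedSpace (Fin n → ℂ) X]
    (α : TwoForm n X) (c : OpenPartialHomeomorph X (Fin n → ℂ)) (z : Fin n → ℂ) : ℝ :=
  (hermitianMatrix (α.inChart c z)).det.re

section Data

variable {n : ℕ} {X : Type*} [TopologicalSpace X] [ChartedSpace (Fin n → ℂ) X]
  {L : X → Type*} [∀ x, AddCommGroup (L x)] [∀ x, Module ℂ (L x)]
  [TopologicalSpace (TotalSpace ℂ L)] [∀ x, TopologicalSpace (L x)] [FiberBundle ℂ L]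

/-- The squared norm of the frame of the trivialization `e`. -/
def frameNorm (h : ∀ x, L x →ₗ[ℂ] L x →ₗ⋆[ℂ] ℂ)
    (e : Trivialization ℂ (TotalSpace.proj : TotalSpace ℂ L → X)) (x : X) : ℝ :=
  (h x (e.symm x (1 : ℂ)) (e.symm x (1 : ℂ))).re

/-- The properties of a Hermitian metric and a two-form which are needed for the theory of
square integrable holomorphic sections. -/
structure IsBergmanData (h : ∀ x, L x →ₗ[ℂ] L x →ₗ⋆[ℂ] ℂ) (α : TwoForm n X) : Prop where
  conj_symm : ∀ x (v w : L x), h x v w = conj (h x w v)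
  positive : ∀ x (v : L x), v ≠ 0 → 0 < (h x v v).re
  continuousOn_frameNorm : ∀ x₀ : X, ContinuousOn (frameNorm h (trivializationAt ℂ L x₀))
    (trivializationAt ℂ L x₀).baseSet
  continuousOn_density : ∀ x₀ : X,
    ContinuousOn (α.density (chartAt (Fin n → ℂ) x₀)) (chartAt (Fin n → ℂ) x₀).target
  density_pos : ∀ x₀ : X, ∀ z ∈ (chartAt (Fin n → ℂ) x₀).target,
    0 < α.density (chartAt (Fin n → ℂ) x₀) z

/-- The expression of the section `s` in the chart `c` and the trivialization `e`. -/
def localRep (e : Trivialization ℂ (TotalSpace.proj : TotalSpace ℂ L → X))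
    (c : OpenPartialHomeomorph X (Fin n → ℂ)) (s : ∀ x, L x) (z : Fin n → ℂ) : ℂ :=
  (e (TotalSpace.mk' ℂ (c.symm z) (s (c.symm z)))).2

/-- The set on which chart and trivialization are defined. -/
def localDomain (e : Trivialization ℂ (TotalSpace.proj : TotalSpace ℂ L → X))
    (c : OpenPartialHomeomorph X (Fin n → ℂ)) : Set (Fin n → ℂ) :=
  c.target ∩ c.symm ⁻¹' e.baseSet

theorem isOpen_localDomain (e : Trivialization ℂ (TotalSpace.proj : TotalSpace ℂ L → X))
    (c : OpenPartialHomeomorph X (Fin n → ℂ)) : IsOpen (localDomain e c) :=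
  c.isOpen_inter_preimage_symm e.open_baseSet

section Holomorphic

variable [VectorBundle ℂ ℂ L] [ContMDiffVectorBundle 1 ℂ L 𝓘(ℂ, Fin n → ℂ)]
  [IsManifold 𝓘(ℂ, Fin n → ℂ) ω X]

theorem differentiableAt_comp_symm {c : OpenPartialHomeomorph X (Fin n → ℂ)}
    (hc : c ∈ IsManifold.maximalAtlas 𝓘(ℂ, Fin n → ℂ) ω X) {F : Type*} [NormedAddCommGroup F]
    [NormedSpace ℂ F] {f : X → F} {z : Fin n → ℂ} (hz : z ∈ c.target)
    (hf : MDifferentiableAt 𝓘(ℂ, Fin n → ℂ) 𝓘(ℂ, F) f (c.symm z)) :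
    DifferentiableAt ℂ (fun w => f (c.symm w)) z := by
  rw [← mdifferentiableAt_iff_differentiableAt]
  exact hf.comp z (((contMDiffOn_symm_of_mem_maximalAtlas hc).contMDiffAt
    (c.open_target.mem_nhds hz)).mdifferentiableAt (by simp))

theorem differentiableOn_localRep
    (e : Trivialization ℂ (TotalSpace.proj : TotalSpace ℂ L → X)) [MemTrivializationAtlas e]
    {c : OpenPartialHomeomorph X (Fin n → ℂ)}
    (hc : c ∈ IsManifold.maximalAtlas 𝓘(ℂ, Fin n → ℂ) ω X) {s : ∀ x, L x}
    (hs : s ∈ holomorphicSections (n := n) L) :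
    DifferentiableOn ℂ (localRep e c s) (localDomain e c) := by
  intro z hz
  refine DifferentiableAt.differentiableWithinAt (differentiableAt_comp_symm hc hz.1
    (f := fun x => (e (TotalSpace.mk' ℂ x (s x))).2) ?_)
  exact (e.mdifferentiableAt_section_iff 𝓘(ℂ, Fin n → ℂ) s hz.2).1 (hs _)

end Holomorphic

variable [VectorBundle ℂ ℂ L]

/-- The fibres are lines: this reduces statements about `h` and functionals on a fibre to one
complex coordinate. -/
theorem eq_smul_frame (e : Trivialization ℂ (TotalSpace.proj : TotalSpace ℂ L → X))
    [MemTrivializationAtlas e] {x : X} (hx : x ∈ e.baseSet) (v : L x) :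
    v = (e (TotalSpace.mk' ℂ x v)).2 • e.symm x (1 : ℂ) := by
  have h1 : e.symm x (e (TotalSpace.mk' ℂ x v)).2 = v := e.symm_apply_apply_mk hx v
  have h2 := (e.symmₗ ℂ x).map_smul (e (TotalSpace.mk' ℂ x v)).2 1
  rw [e.symmₗ_apply hx, e.symmₗ_apply hx, smul_eq_mul, mul_one, h1] at h2
  exact h2

variable {h : ∀ x, L x →ₗ[ℂ] L x →ₗ⋆[ℂ] ℂ} {α : TwoForm n X}

namespace IsBergmanData

theorem apply_self_im (hd : IsBergmanData h α) (x : X) (v : L x) : (h x v v).im = 0 :=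
  Complex.conj_eq_iff_im.1 (hd.conj_symm x v v).symm

theorem apply_self_eq (hd : IsBergmanData h α) (x : X) (v : L x) :
    h x v v = ((h x v v).re : ℂ) :=
  Complex.ext rfl (hd.apply_self_im x v)

theorem apply_self_nonneg (hd : IsBergmanData h α) (x : X) (v : L x) : 0 ≤ (h x v v).re := by
  rcases eq_or_ne v 0 with rfl | hv
  · simp
  · exact (hd.positive x v hv).le

theorem frameNorm_pos (hd : IsBergmanData h α)
    (e : Trivialization ℂ (TotalSpace.proj : TotalSpace ℂ L → X)) [MemTrivializationAtlas e]
    {x : X} (hx : x ∈ e.baseSet) : 0 < frameNorm h e x := by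
  refine hd.positive x _ fun h0 => ?_
  have h1 := e.apply_mk_symm hx (1 : ℂ)
  have h2 := (e.linear ℂ hx).map_smul 0 (0 : L x)
  rw [h0] at h1
  rw [zero_smul, h1, zero_smul] at h2
  exact one_ne_zero h2

theorem apply_eq (hd : IsBergmanData h α)
    (e : Trivialization ℂ (TotalSpace.proj : TotalSpace ℂ L → X)) [MemTrivializationAtlas e]
    {x : X} (hx : x ∈ e.baseSet) (v w : L x) :
    h x v w = (e (TotalSpace.mk' ℂ x v)).2 * conj (e (TotalSpace.mk' ℂ x w)).2 *
      (frameNorm h e x : ℂ) := by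
  conv_lhs => rw [eq_smul_frame e hx v, eq_smul_frame e hx w]
  rw [LinearMap.map_smul, LinearMap.smul_apply, LinearMap.map_smulₛₗ, smul_eq_mul, smul_eq_mul,
    hd.apply_self_eq, mul_assoc]
  rfl

theorem re_apply_self_eq (hd : IsBergmanData h α)
    (e : Trivialization ℂ (TotalSpace.proj : TotalSpace ℂ L → X)) [MemTrivializationAtlas e]
    {x : X} (hx : x ∈ e.baseSet) (v : L x) :
    (h x v v).re = ‖(e (TotalSpace.mk' ℂ x v)).2‖ ^ 2 * frameNorm h e x := by
  rw [hd.apply_eq e hx, Complex.mul_conj, ← Complex.ofReal_mul, Complex.ofReal_re,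
    Complex.normSq_eq_norm_sq]

variable [ContMDiffVectorBundle 1 ℂ L 𝓘(ℂ, Fin n → ℂ)] [IsManifold 𝓘(ℂ, Fin n → ℂ) ω X]

theorem continuous_apply (hd : IsBergmanData h α) {s t : ∀ x, L x}
    (hs : s ∈ holomorphicSections (n := n) L) (ht : t ∈ holomorphicSections (n := n) L) :
    Continuous fun x => h x (s x) (t x) := by
  rw [continuous_iff_continuousAt]
  intro x₀
  set e := trivializationAt ℂ L x₀ with he
  have hx₀ : x₀ ∈ e.baseSet := mem_baseSet_trivializationAt ℂ L x₀
  have hcs := ((e.mdifferentiableAt_section_iff 𝓘(ℂ, Fin n → ℂ) s hx₀).1 (hs x₀)).continuousAt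
  have hct := ((e.mdifferentiableAt_section_iff 𝓘(ℂ, Fin n → ℂ) t hx₀).1 (ht x₀)).continuousAt
  have hcn := (hd.continuousOn_frameNorm x₀).continuousAt (e.open_baseSet.mem_nhds hx₀)
  refine ContinuousAt.congr (f := fun x => (e (TotalSpace.mk' ℂ x (s x))).2 *
    conj (e (TotalSpace.mk' ℂ x (t x))).2 * (frameNorm h e x : ℂ)) ?_ ?_
  · exact (hcs.mul (Complex.continuous_conj.continuousAt.comp hct)).mul
      (Complex.continuous_ofReal.continuousAt.comp hcn)
  · filter_upwards [e.open_baseSet.mem_nhds hx₀] with x hx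
    exact (hd.apply_eq e hx _ _).symm

end IsBergmanData

variable (h α) in
/-- The square of the `L²` norm. -/
def normSq (s : ∀ x, L x) : ENNReal :=
  letI : MeasurableSpace X := borel X
  ∫⁻ x, ENNReal.ofReal (h x (s x) (s x)).re ∂α.volume

/-- The volume is a supremum of chart measures, hence dominates each. An inequality suffices for
lower bounds on the `L²` norm. -/
theorem setLIntegral_chart_le (α : TwoForm n X) (x₀ : X)
    (hα : ContinuousOn (α.density (chartAt (Fin n → ℂ) x₀)) (chartAt (Fin n → ℂ) x₀).target)
    {g : X → ENNReal} (hg : Measurable[borel X] g) :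
    ∫⁻ z in (chartAt (Fin n → ℂ) x₀).target, g ((chartAt (Fin n → ℂ) x₀).symm z) *
        ENNReal.ofReal (α.density (chartAt (Fin n → ℂ) x₀) z) ≤
      letI : MeasurableSpace X := borel X
      ∫⁻ x, g x ∂α.volume := by
  let _ : MeasurableSpace X := borel X
  have : BorelSpace X := ⟨rfl⟩
  set c := chartAt (Fin n → ℂ) x₀ with hc
  set μ : Measure (Fin n → ℂ) := ((MeasureTheory.volume : Measure (Fin n → ℂ)).restrict
      c.target).withDensity fun z => ENNReal.ofReal (α.density c z) with hμ
  have hden : AEMeasurable (fun z => ENNReal.ofReal (α.density c z))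
      ((MeasureTheory.volume : Measure (Fin n → ℂ)).restrict c.target) :=
    (hα.aemeasurable c.open_target.measurableSet).ennreal_ofReal
  have hsymm : AEMeasurable c.symm
      ((MeasureTheory.volume : Measure (Fin n → ℂ)).restrict c.target) :=
    c.continuousOn_symm.aemeasurable c.open_target.measurableSet
  have hsymm' : AEMeasurable c.symm μ := hsymm.mono_ac (withDensity_absolutelyContinuous _ _)
  have hle : Measure.map c.symm μ ≤ α.volume :=
    le_iSup (fun x : X => Measure.map (chartAt (Fin n → ℂ) x).symm
    (((MeasureTheory.volume : Measure (Fin n → ℂ)).restrict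
      (chartAt (Fin n → ℂ) x).target).withDensity
        fun z => ENNReal.ofReal (α.density (chartAt (Fin n → ℂ) x) z))) x₀
  refine le_trans (le_of_eq ?_) (lintegral_mono' hle le_rfl)
  rw [lintegral_map' hg.aemeasurable hsymm']
  refine Eq.trans ?_ (lintegral_withDensity_eq_lintegral_mul₀ hden
    (hg.comp_aemeasurable hsymm)).symm
  refine lintegral_congr fun z => ?_
  simp [mul_comm]

theorem enorm_sq_eq_ofReal {z : ℂ} : ‖z‖ₑ ^ 2 = ENNReal.ofReal (‖z‖ ^ 2) := by
  rw [← ofReal_norm, ENNReal.ofReal_pow (norm_nonneg _)]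

variable [ContMDiffVectorBundle 1 ℂ L 𝓘(ℂ, Fin n → ℂ)] [IsManifold 𝓘(ℂ, Fin n → ℂ) ω X]

/-- The Bergman inequality: point evaluations are locally uniformly bounded. -/
theorem IsBergmanData.exists_le_normSq (hd : IsBergmanData h α) (x₀ : X) :
    ∃ C : ℝ, 0 ≤ C ∧ ∀ᶠ x in 𝓝 x₀, ∀ s ∈ holomorphicSections (n := n) L,
      ENNReal.ofReal (h x (s x) (s x)).re ≤ ENNReal.ofReal C * normSq h α s := by
  set c := chartAt (Fin n → ℂ) x₀ with hc
  set e := trivializationAt ℂ L x₀ with he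
  have hcmem : c ∈ IsManifold.maximalAtlas 𝓘(ℂ, Fin n → ℂ) ω X :=
    IsManifold.chart_mem_maximalAtlas x₀
  have hx₀c : x₀ ∈ c.source := mem_chart_source _ x₀
  have hx₀e : x₀ ∈ e.baseSet := mem_baseSet_trivializationAt ℂ L x₀
  set D := localDomain e c with hD
  have hz₀ : c x₀ ∈ D := ⟨c.map_source hx₀c, by simpa [c.left_inv hx₀c] using hx₀e⟩
  obtain ⟨R, hR, hRD⟩ := Metric.nhds_basis_closedBall.mem_iff.1
    ((isOpen_localDomain e c).mem_nhds hz₀)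
  set K := Metric.closedBall (c x₀) R with hK
  have hKc : IsCompact K := isCompact_closedBall _ _
  have hKne : K.Nonempty := ⟨c x₀, Metric.mem_closedBall_self hR.le⟩
  have hW : ContinuousOn (fun z => frameNorm h e (c.symm z)) K :=
    (hd.continuousOn_frameNorm x₀).comp (c.continuousOn_symm.mono fun z hz => (hRD hz).1)
      fun z hz => (hRD hz).2
  have hρ : ContinuousOn (α.density c) K :=
    (hd.continuousOn_density x₀).mono fun z hz => (hRD hz).1
  -- The minimum of frame norm times density compares the flat `L²` norm of the coordinate function
  -- with that of the section; the maximum of the frame norm turns the coordinate back into the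
  -- pointwise norm.
  obtain ⟨z₁, hz₁, hz₁min⟩ := hKc.exists_isMinOn hKne (hW.mul hρ)
  obtain ⟨z₂, hz₂, hz₂max⟩ := hKc.exists_isMaxOn hKne hW
  set m := frameNorm h e (c.symm z₁) * α.density c z₁ with hm
  have hmpos : 0 < m := mul_pos (hd.frameNorm_pos e (hRD hz₁).2) (hd.density_pos x₀ _ (hRD hz₁).1)
  set W := frameNorm h e (c.symm z₂) with hWdef
  have hWpos : 0 < W := hd.frameNorm_pos e (hRD hz₂).2
  set v := (volume (Metric.ball (0 : Fin n → ℂ) (R / 2))).toReal with hv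
  have hvol : volume (Metric.ball (0 : Fin n → ℂ) (R / 2)) = ENNReal.ofReal v :=
    (ENNReal.ofReal_toReal measure_ball_lt_top.ne).symm
  have hvpos : 0 < v := ENNReal.toReal_pos (Metric.measure_ball_pos _ _ (by positivity)).ne'
    measure_ball_lt_top.ne
  -- The mean value inequality on a ball of volume `v` gives `m * v * |F z|² ≤ ‖s‖²`. For centres
  -- within `R / 2` of `c x₀` the balls of radius `R / 2` stay in `K`, so the constant is uniform.
  refine ⟨W / (v * m), by positivity, ?_⟩
  have hnhds : ∀ᶠ x in 𝓝 x₀, x ∈ c.source ∧ c x ∈ Metric.ball (c x₀) (R / 2) :=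
    (c.open_source.eventually_mem hx₀c).and ((c.continuousAt hx₀c).eventually
      (Metric.ball_mem_nhds _ (by positivity)))
  filter_upwards [hnhds] with x hx s hs
  set z := c x with hz
  have hxz : c.symm z = x := c.left_inv hx.1
  have hballK : Metric.ball z (R / 2) ⊆ K := by
    intro w hw
    have h1 := hx.2
    rw [Metric.mem_ball] at hw h1
    rw [hK, Metric.mem_closedBall]
    linarith [dist_triangle w z (c x₀)]
  have hzK : z ∈ K := hballK (Metric.mem_ball_self (by positivity))
  set F := localRep e c s with hF
  have hFd : DifferentiableOn ℂ F (Metric.ball z (R / 2)) :=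
    (differentiableOn_localRep e hcmem hs).mono (hballK.trans hRD)
  have hmeas : @Measurable X ENNReal (borel X) _ fun x => ENNReal.ofReal (h x (s x) (s x)).re := by
    let _ : MeasurableSpace X := borel X
    have : BorelSpace X := ⟨rfl⟩
    exact (Complex.continuous_re.comp (hd.continuous_apply hs hs)).measurable.ennreal_ofReal
  have key : ENNReal.ofReal m * (‖F z‖ₑ ^ 2 * ENNReal.ofReal v) ≤ normSq h α s := by
    calc ENNReal.ofReal m * (‖F z‖ₑ ^ 2 * ENNReal.ofReal v)
        ≤ ENNReal.ofReal m * ∫⁻ w in Metric.ball z (R / 2), ‖F w‖ₑ ^ 2 := by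
          rw [← hvol]; gcongr; exact enorm_sq_mul_volume_le hFd
      _ = ∫⁻ w in Metric.ball z (R / 2), ENNReal.ofReal m * ‖F w‖ₑ ^ 2 :=
          (lintegral_const_mul' _ _ ENNReal.ofReal_ne_top).symm
      _ ≤ ∫⁻ w in Metric.ball z (R / 2), ENNReal.ofReal (h (c.symm w) (s (c.symm w))
            (s (c.symm w))).re * ENNReal.ofReal (α.density c w) := by
          refine setLIntegral_mono' Metric.isOpen_ball.measurableSet fun w hw => ?_
          have hwD := hRD (hballK hw)
          rw [enorm_sq_eq_ofReal, ← ENNReal.ofReal_mul hmpos.le,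
            ← ENNReal.ofReal_mul (hd.apply_self_nonneg _ _), hd.re_apply_self_eq e hwD.2]
          refine ENNReal.ofReal_le_ofReal ?_
          have h1 : m ≤ frameNorm h e (c.symm w) * α.density c w := hz₁min (hballK hw)
          calc m * ‖F w‖ ^ 2 ≤ (frameNorm h e (c.symm w) * α.density c w) * ‖F w‖ ^ 2 := by gcongr
            _ = ‖F w‖ ^ 2 * frameNorm h e (c.symm w) * α.density c w := by ring
      _ ≤ ∫⁻ w in c.target, ENNReal.ofReal (h (c.symm w) (s (c.symm w))
            (s (c.symm w))).re * ENNReal.ofReal (α.density c w) :=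
          lintegral_mono_set fun w hw => (hRD (hballK hw)).1
      _ ≤ normSq h α s := setLIntegral_chart_le α x₀ (hd.continuousOn_density x₀) hmeas
  have hxe : x ∈ e.baseSet := hxz ▸ (hRD hzK).2
  have h2 : frameNorm h e x ≤ W := by
    have : frameNorm h e (c.symm z) ≤ W := hz₂max hzK
    rwa [hxz] at this
  have h3 : (e (TotalSpace.mk' ℂ x (s x))).2 = F z := by
    rw [hF, localRep, hxz]
  rw [hd.re_apply_self_eq e hxe, h3]
  calc ENNReal.ofReal (‖F z‖ ^ 2 * frameNorm h e x)
      ≤ ENNReal.ofReal (W / (v * m) * (m * (‖F z‖ ^ 2 * v))) := by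
        refine ENNReal.ofReal_le_ofReal ?_
        have : W / (v * m) * (m * (‖F z‖ ^ 2 * v)) = ‖F z‖ ^ 2 * W := by field_simp
        rw [this]; gcongr
    _ = ENNReal.ofReal (W / (v * m)) * (ENNReal.ofReal m * (‖F z‖ₑ ^ 2 * ENNReal.ofReal v)) := by
        rw [enorm_sq_eq_ofReal, ENNReal.ofReal_mul (div_pos hWpos (mul_pos hvpos hmpos)).le,
          ENNReal.ofReal_mul hmpos.le, ENNReal.ofReal_mul (sq_nonneg _)]
    _ ≤ _ := by gcongr

end Data

end BergmanTower

namespace BergmanTower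

/-! ### The Hilbert space of square integrable holomorphic sections. -/

section Hilbert

variable {n : ℕ} {X : Type*} [TopologicalSpace X] [ChartedSpace (Fin n → ℂ) X]
  {L : X → Type*} [∀ x, AddCommGroup (L x)] [∀ x, Module ℂ (L x)]
  [TopologicalSpace (TotalSpace ℂ L)] [∀ x, TopologicalSpace (L x)] [FiberBundle ℂ L]
  [VectorBundle ℂ ℂ L]
  {h : ∀ x, L x →ₗ[ℂ] L x →ₗ⋆[ℂ] ℂ} {α : TwoForm n X}
  [ContMDiffVectorBundle 1 ℂ L 𝓘(ℂ, Fin n → ℂ)] [IsManifold 𝓘(ℂ, Fin n → ℂ) ω X]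

namespace IsBergmanData

/-- A crude form of Cauchy–Schwarz and the arithmetic-geometric mean, enough to make `h(s, t)`
integrable. -/
theorem norm_apply_le (hd : IsBergmanData h α) (x : X) (v w : L x) :
    ‖h x v w‖ ≤ (h x v v).re + (h x w w).re := by
  set e := trivializationAt ℂ L x
  have hx : x ∈ e.baseSet := mem_baseSet_trivializationAt ℂ L x
  rw [hd.apply_eq e hx, hd.re_apply_self_eq e hx, hd.re_apply_self_eq e hx, norm_mul, norm_mul,
    RCLike.norm_conj, Complex.norm_real, Real.norm_of_nonneg (hd.frameNorm_pos e hx).le, ← add_mul]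
  refine mul_le_mul_of_nonneg_right ?_ (hd.frameNorm_pos e hx).le
  nlinarith [sq_nonneg (‖(e (TotalSpace.mk' ℂ x v)).2‖ - ‖(e (TotalSpace.mk' ℂ x w)).2‖),
    sq_nonneg ‖(e (TotalSpace.mk' ℂ x v)).2‖, sq_nonneg ‖(e (TotalSpace.mk' ℂ x w)).2‖]

/-- States square integrability as finiteness of a lower integral, the form in which Fatou's lemma
delivers it. -/
theorem mem_l2_iff (hd : IsBergmanData h α) {s : ∀ x, L x} :
    s ∈ l2HolomorphicSections (n := n) h α ↔
      s ∈ holomorphicSections (n := n) L ∧ normSq h α s < ⊤ := by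
  let _ : MeasurableSpace X := borel X
  have : BorelSpace X := ⟨rfl⟩
  refine and_congr_right fun hs => ?_
  have hm : AEStronglyMeasurable (fun x => h x (s x) (s x)) α.volume :=
    (hd.continuous_apply hs hs).aestronglyMeasurable
  change Integrable _ _ ↔ _
  rw [Integrable, and_iff_right hm, HasFiniteIntegral, normSq]
  refine iff_of_eq (congrArg (· < ⊤) (lintegral_congr fun x => ?_))
  rw [hd.apply_self_eq, ← ofReal_norm, Complex.norm_real,
    Real.norm_of_nonneg (hd.apply_self_nonneg _ _), Complex.ofReal_re]

theorem integrable_apply (hd : IsBergmanData h α) {s t : ∀ x, L x}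
    (hs : s ∈ l2HolomorphicSections (n := n) h α) (ht : t ∈ l2HolomorphicSections (n := n) h α) :
    letI : MeasurableSpace X := borel X
    Integrable (fun x => h x (s x) (t x)) α.volume := by
  let _ : MeasurableSpace X := borel X
  have : BorelSpace X := ⟨rfl⟩
  have hs2 : Integrable (fun x => h x (s x) (s x)) α.volume := hs.2
  have ht2 : Integrable (fun x => h x (t x) (t x)) α.volume := ht.2
  refine (hs2.re.add ht2.re).mono' (hd.continuous_apply hs.1 ht.1).aestronglyMeasurable
    (Eventually.of_forall fun x => hd.norm_apply_le x _ _)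

theorem zero_mem_holomorphicSections : (0 : ∀ x, L x) ∈ holomorphicSections (n := n) L :=
  mdifferentiable_zeroSection (𝕜 := ℂ) (E := L)

/-- The square integrable holomorphic sections as a space of sections. -/
def l2Submodule (hd : IsBergmanData h α) : Submodule ℂ (∀ x, L x) where
  carrier := l2HolomorphicSections (n := n) h α
  zero_mem' := by
    let _ : MeasurableSpace X := borel X
    exact ⟨zero_mem_holomorphicSections, by simp⟩
  add_mem' {s t} hs ht := by
    let _ : MeasurableSpace X := borel X
    refine ⟨mdifferentiable_add_section hs.1 ht.1, ?_⟩
    have := ((hd.integrable_apply hs hs).add (hd.integrable_apply ht hs)).add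
      ((hd.integrable_apply hs ht).add (hd.integrable_apply ht ht))
    refine this.congr (Eventually.of_forall fun x => ?_)
    simp [map_add]
  smul_mem' c s hs := by
    let _ : MeasurableSpace X := borel X
    refine ⟨fun x => (hs.1 x).smul_const_section, ?_⟩
    refine ((hd.integrable_apply hs hs).const_mul (c * conj c)).congr
      (Eventually.of_forall fun x => ?_)
    simp [mul_assoc, mul_left_comm]

/-- The space of square integrable holomorphic sections as a type. -/
def L2Space (hd : IsBergmanData h α) : Type _ := hd.l2Submodule

instance (hd : IsBergmanData h α) : AddCommGroup hd.L2Space :=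
  inferInstanceAs (AddCommGroup hd.l2Submodule)

instance (hd : IsBergmanData h α) : Module ℂ hd.L2Space :=
  inferInstanceAs (Module ℂ hd.l2Submodule)

theorem re_sectionInner_self (hd : IsBergmanData h α) {s : ∀ x, L x}
    (hs : s ∈ l2HolomorphicSections (n := n) h α) :
    ENNReal.ofReal (sectionInner h α s s).re = normSq h α s := by
  let _ : MeasurableSpace X := borel X
  have hi := hd.integrable_apply hs hs
  have h1 : (sectionInner h α s s).re = ∫ x, (h x (s x) (s x)).re ∂α.volume :=
    (integral_re hi).symm
  rw [h1]
  exact ofReal_integral_eq_lintegral_ofReal hi.re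
    (Eventually.of_forall fun x => hd.apply_self_nonneg _ _)

theorem re_sectionInner_self_nonneg (hd : IsBergmanData h α) {s : ∀ x, L x}
    (hs : s ∈ l2HolomorphicSections (n := n) h α) : 0 ≤ (sectionInner h α s s).re := by
  let _ : MeasurableSpace X := borel X
  have h1 : (sectionInner h α s s).re = ∫ x, (h x (s x) (s x)).re ∂α.volume :=
    (integral_re (hd.integrable_apply hs hs)).symm
  rw [h1]
  exact integral_nonneg fun x => hd.apply_self_nonneg _ _

theorem eventually_le_sectionInner (hd : IsBergmanData h α) (x₀ : X) :
    ∃ C : ℝ, 0 ≤ C ∧ ∀ᶠ x in 𝓝 x₀, ∀ s ∈ l2HolomorphicSections (n := n) h α,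
      (h x (s x) (s x)).re ≤ C * (sectionInner h α s s).re := by
  obtain ⟨C, hC, hx⟩ := hd.exists_le_normSq x₀
  refine ⟨C, hC, hx.mono fun x hx s hs => ?_⟩
  have h1 := hx s hs.1
  rw [← hd.re_sectionInner_self hs, ← ENNReal.ofReal_mul hC] at h1
  exact (ENNReal.ofReal_le_ofReal_iff (mul_nonneg hC (hd.re_sectionInner_self_nonneg hs))).1 h1

/-- The inner product of `L²` sections. -/
@[reducible] def l2Core (hd : IsBergmanData h α) : InnerProductSpace.Core ℂ hd.L2Space where
  -- The arguments are exchanged because `h` is linear in the first variable and `inner` in the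
  -- second.
  inner s t := sectionInner h α t.1 s.1
  conj_inner_symm s t := by
    let _ : MeasurableSpace X := borel X
    change conj (∫ x, h x (s.1 x) (t.1 x) ∂α.volume) = ∫ x, h x (t.1 x) (s.1 x) ∂α.volume
    rw [← integral_conj]
    exact integral_congr_ae (Eventually.of_forall fun x => (hd.conj_symm x _ _).symm)
  re_inner_nonneg s := hd.re_sectionInner_self_nonneg s.2
  add_left s t u := by
    let _ : MeasurableSpace X := borel X
    change ∫ x, h x (u.1 x) (s.1 x + t.1 x) ∂α.volume = ∫ x, h x (u.1 x) (s.1 x) ∂α.volume +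
      ∫ x, h x (u.1 x) (t.1 x) ∂α.volume
    rw [← integral_add (hd.integrable_apply u.2 s.2) (hd.integrable_apply u.2 t.2)]
    exact integral_congr_ae (Eventually.of_forall fun x => map_add _ _ _)
  smul_left s t c := by
    let _ : MeasurableSpace X := borel X
    change ∫ x, h x (t.1 x) (c • s.1 x) ∂α.volume = conj c * ∫ x, h x (t.1 x) (s.1 x) ∂α.volume
    rw [← integral_const_mul]
    exact integral_congr_ae (Eventually.of_forall fun x => LinearMap.map_smulₛₗ _ _ _)
  -- By the Bergman inequality a section of norm zero vanishes at every point, not just almost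
  -- everywhere; no quotient is needed.
  definite s hs := by
    refine Subtype.ext (funext fun x => ?_)
    by_contra hne
    obtain ⟨C, hC, hx⟩ := hd.eventually_le_sectionInner x
    have h1 := hx.self_of_nhds s.1 s.2
    have h2 : sectionInner h α s.1 s.1 = 0 := hs
    rw [h2, Complex.zero_re, mul_zero] at h1
    exact absurd (hd.positive x _ hne) (not_lt.2 h1)

instance (hd : IsBergmanData h α) : NormedAddCommGroup hd.L2Space :=
  hd.l2Core.toNormedAddCommGroup

instance (hd : IsBergmanData h α) : InnerProductSpace ℂ hd.L2Space :=
  InnerProductSpace.ofCore hd.l2Core.toCore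

theorem norm_sq_eq (hd : IsBergmanData h α) (s : hd.L2Space) :
    ‖s‖ ^ 2 = (sectionInner h α s.1 s.1).re :=
  norm_sq_eq_re_inner (𝕜 := ℂ) s

theorem ofReal_norm_sq (hd : IsBergmanData h α) (s : hd.L2Space) :
    ENNReal.ofReal (‖s‖ ^ 2) = normSq h α s.1 := by
  rw [hd.norm_sq_eq, hd.re_sectionInner_self s.2]

/-- The Bergman inequality divided by a positive lower bound of the frame norm. One constant serves
all sections on a ball, as required for normal family arguments. -/
theorem exists_localRep_le (hd : IsBergmanData h α) (x₁ : X)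
    {c : OpenPartialHomeomorph X (Fin n → ℂ)} {z : Fin n → ℂ}
    (hz : z ∈ localDomain (trivializationAt ℂ L x₁) c) :
    ∃ r > 0, ∃ C : ℝ, 0 ≤ C ∧ Metric.ball z r ⊆ localDomain (trivializationAt ℂ L x₁) c ∧
      ∀ w ∈ Metric.ball z r, ∀ s : hd.L2Space,
        ‖localRep (trivializationAt ℂ L x₁) c s.1 w‖ ^ 2 ≤ C * ‖s‖ ^ 2 := by
  set e := trivializationAt ℂ L x₁ with he
  obtain ⟨C, hC, hx⟩ := hd.eventually_le_sectionInner (c.symm z)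
  have hpos := hd.frameNorm_pos e hz.2
  set a := frameNorm h e (c.symm z) / 2 with ha
  have ha0 : 0 < a := by positivity
  have h1 : ∀ᶠ x in 𝓝 (c.symm z), a < frameNorm h e x :=
    ((hd.continuousOn_frameNorm x₁).continuousAt
      (e.open_baseSet.mem_nhds hz.2)).eventually_const_lt (by linarith)
  have hcs : Tendsto c.symm (𝓝 z) (𝓝 (c.symm z)) := c.symm.continuousAt hz.1
  obtain ⟨r, hr, hball⟩ := Metric.eventually_nhds_iff_ball.1
    ((hcs.eventually (hx.and h1)).and ((isOpen_localDomain e c).mem_nhds hz))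
  refine ⟨r, hr, C / a, by positivity, fun w hw => (hball w hw).2, fun w hw s => ?_⟩
  obtain ⟨⟨h2, h3⟩, h4⟩ := hball w hw
  have h5 := h2 s.1 s.2
  rw [hd.re_apply_self_eq e h4.2, ← hd.norm_sq_eq] at h5
  rw [div_mul_eq_mul_div, le_div_iff₀ ha0]
  exact le_trans (mul_le_mul_of_nonneg_left h3.le (sq_nonneg _)) h5

theorem coord_sub (e : Trivialization ℂ (TotalSpace.proj : TotalSpace ℂ L → X))
    [MemTrivializationAtlas e] {x : X} (hx : x ∈ e.baseSet) (v w : L x) :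
    (e (TotalSpace.mk' ℂ x (v - w))).2 =
      (e (TotalSpace.mk' ℂ x v)).2 - (e (TotalSpace.mk' ℂ x w)).2 :=
  (e.linear ℂ hx).map_sub v w

/-- Convergence of the coordinate of a section at a point thus does not depend on the
trivialization. -/
theorem coord_eq_mul (e e' : Trivialization ℂ (TotalSpace.proj : TotalSpace ℂ L → X))
    [MemTrivializationAtlas e] [MemTrivializationAtlas e'] {x : X} (hx : x ∈ e.baseSet)
    (hx' : x ∈ e'.baseSet) (v : L x) :
    (e' (TotalSpace.mk' ℂ x v)).2 = (e (TotalSpace.mk' ℂ x v)).2 *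
      (e' (TotalSpace.mk' ℂ x (e.symm x (1 : ℂ)))).2 := by
  conv_lhs => rw [eq_smul_frame e hx v]
  exact (e'.linear ℂ hx').map_smul _ _

theorem mem_holomorphicSections_of_localRep {s : ∀ x, L x}
    (hs : ∀ x₀ : X, DifferentiableOn ℂ
      (localRep (trivializationAt ℂ L x₀) (chartAt (Fin n → ℂ) x₀) s)
      (localDomain (trivializationAt ℂ L x₀) (chartAt (Fin n → ℂ) x₀))) :
    s ∈ holomorphicSections (n := n) L := by
  intro x₀
  set c := chartAt (Fin n → ℂ) x₀ with hc
  set e := trivializationAt ℂ L x₀ with he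
  have hx₀ : x₀ ∈ c.source := mem_chart_source _ x₀
  have hx₀e : x₀ ∈ e.baseSet := mem_baseSet_trivializationAt ℂ L x₀
  have hz₀ : c x₀ ∈ localDomain e c := ⟨c.map_source hx₀, by simpa [c.left_inv hx₀] using hx₀e⟩
  refine (mdifferentiableAt_section 𝓘(ℂ, Fin n → ℂ) s).2 ?_
  have h1 : MDifferentiableAt 𝓘(ℂ, Fin n → ℂ) 𝓘(ℂ, ℂ) (localRep e c s) (c x₀) :=
    ((hs x₀).differentiableAt ((isOpen_localDomain e c).mem_nhds hz₀)).mdifferentiableAt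
  have h2 : MDifferentiableAt 𝓘(ℂ, Fin n → ℂ) 𝓘(ℂ, Fin n → ℂ) c x₀ :=
    ((contMDiffOn_chart (n := ω)).contMDiffAt (c.open_source.mem_nhds hx₀)).mdifferentiableAt
      (by simp)
  refine (h1.comp x₀ h2).congr_of_eventuallyEq ?_
  filter_upwards [c.open_source.mem_nhds hx₀] with x hx
  change _ = localRep e c s (c x)
  rw [localRep, c.left_inv hx]

/-- Evaluations are bounded, so a Cauchy sequence converges pointwise. The local bounds make the
convergence locally uniform in coordinates, hence the limit is holomorphic, and Fatou's lemma gives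
convergence in norm. -/
instance (hd : IsBergmanData h α) : CompleteSpace hd.L2Space := by
  refine Metric.complete_of_cauchySeq_tendsto fun u hu => ?_
  obtain ⟨A, -, hA⟩ := cauchySeq_bdd hu
  have hcoord : ∀ x : X, ∃ a : ℂ, Tendsto (fun m =>
      (trivializationAt ℂ L x (TotalSpace.mk' ℂ x ((u m).1 x))).2) atTop (𝓝 a) := by
    intro x
    set e := trivializationAt ℂ L x
    have hx : x ∈ e.baseSet := mem_baseSet_trivializationAt ℂ L x
    have hpos := hd.frameNorm_pos e hx
    obtain ⟨C, hC, hx'⟩ := hd.eventually_le_sectionInner x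
    refine cauchySeq_tendsto_of_complete ?_
    rw [Metric.cauchySeq_iff] at hu ⊢
    intro ε hε
    obtain ⟨δ, hδ, hδC⟩ : ∃ δ > 0, C * δ ^ 2 < ε ^ 2 * frameNorm h e x := by
      have : Tendsto (fun δ : ℝ => C * δ ^ 2) (𝓝[>] 0) (𝓝 0) := by
        have : Continuous fun δ : ℝ => C * δ ^ 2 := by fun_prop
        simpa using (this.tendsto 0).mono_left nhdsWithin_le_nhds
      exact ((this.eventually_lt_const (by positivity)).and self_mem_nhdsWithin).exists.imp
        fun δ hδ => ⟨hδ.2, hδ.1⟩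
    obtain ⟨N, hN⟩ := hu δ hδ
    refine ⟨N, fun m hm k hk => ?_⟩
    have h1 := hx'.self_of_nhds _ (u m - u k).2
    rw [← hd.norm_sq_eq, ← dist_eq_norm, hd.re_apply_self_eq e hx] at h1
    have h2 : (u m - u k).1 x = (u m).1 x - (u k).1 x := rfl
    rw [h2, coord_sub e hx, ← dist_eq_norm] at h1
    have h3 : C * dist (u m) (u k) ^ 2 ≤ C * δ ^ 2 := by
      have := (hN m hm k hk).le
      gcongr
    have h4 := lt_of_mul_lt_mul_right ((h1.trans h3).trans_lt hδC) hpos.le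
    exact lt_of_pow_lt_pow_left₀ 2 hε.le h4
  choose a ha using hcoord
  -- The limit is defined fibrewise, using at each point its own preferred trivialization.
  set s : ∀ x, L x := fun x => (trivializationAt ℂ L x).symm x (a x) with hs
  have hlim : ∀ (x₁ : X), ∀ x ∈ (trivializationAt ℂ L x₁).baseSet, Tendsto (fun m =>
      (trivializationAt ℂ L x₁ (TotalSpace.mk' ℂ x ((u m).1 x))).2) atTop
      (𝓝 (trivializationAt ℂ L x₁ (TotalSpace.mk' ℂ x (s x))).2) := by
    intro x₁ x hx
    have hx' := mem_baseSet_trivializationAt ℂ L x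
    have h1 := coord_eq_mul (trivializationAt ℂ L x) (trivializationAt ℂ L x₁) hx' hx
    have h2 : (trivializationAt ℂ L x (TotalSpace.mk' ℂ x (s x))).2 = a x := by
      rw [hs]
      have := (trivializationAt ℂ L x).apply_mk_symm hx' (a x)
      exact congrArg Prod.snd this
    rw [h1 (s x), h2]
    exact ((ha x).mul_const _).congr fun m => (h1 _).symm
  have hshol : s ∈ holomorphicSections (n := n) L := by
    refine mem_holomorphicSections_of_localRep fun x₀ => ?_
    set c := chartAt (Fin n → ℂ) x₀ with hc
    set e := trivializationAt ℂ L x₀ with he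
    have hcmem : c ∈ IsManifold.maximalAtlas 𝓘(ℂ, Fin n → ℂ) ω X :=
      IsManifold.chart_mem_maximalAtlas x₀
    have hdiff : ∀ m, DifferentiableOn ℂ (localRep e c (u m).1) (localDomain e c) := fun m =>
      differentiableOn_localRep e hcmem (u m).2.1
    refine (differentiableOn_and_tendsto_fderiv (isOpen_localDomain e c)
      (tendstoLocallyUniformlyOn_of_tendsto hdiff (l := atTop) (fun z hz => ?_) fun z hz => ?_)
      (Eventually.of_forall hdiff)).1
    · obtain ⟨r, hr, C, hC, hrU, hle⟩ := hd.exists_localRep_le x₀ hz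
      refine ⟨r, hr, Real.sqrt (C * (A + ‖u 0‖) ^ 2), hrU, fun m w hw => ?_⟩
      refine Real.le_sqrt_of_sq_le ((hle w hw (u m)).trans ?_)
      have h1 : ‖u m‖ ≤ A + ‖u 0‖ := by
        have h2 := (hA m 0).le
        rw [dist_eq_norm] at h2
        have h3 := norm_sub_norm_le (u m) (u 0)
        linarith
      gcongr
    · exact hlim x₀ _ hz.2
  -- Fatou in the index `k` of `u m - u k`, with the Cauchy condition bounding the norms.
  have hfatou : ∀ ε : ℝ, 0 < ε → ∃ N, ∀ m ≥ N,
      normSq h α ((u m).1 - s) ≤ ENNReal.ofReal (ε ^ 2) := by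
    intro ε hε
    obtain ⟨N, hN⟩ := Metric.cauchySeq_iff.1 hu ε hε
    refine ⟨N, fun m hm => ?_⟩
    let _ : MeasurableSpace X := borel X
    have : BorelSpace X := ⟨rfl⟩
    have hpt : ∀ x, Tendsto (fun k => ENNReal.ofReal (h x ((u m - u k).1 x) ((u m - u k).1 x)).re)
        atTop (𝓝 (ENNReal.ofReal (h x (((u m).1 - s) x) (((u m).1 - s) x)).re)) := by
      intro x
      have hx := mem_baseSet_trivializationAt ℂ L x
      refine ENNReal.tendsto_ofReal ?_
      simp_rw [hd.re_apply_self_eq (trivializationAt ℂ L x) hx]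
      refine ((Tendsto.norm ?_).pow 2).mul_const _
      have h1 : ∀ k, (u m - u k).1 x = (u m).1 x - (u k).1 x := fun k => rfl
      simp_rw [h1, Pi.sub_apply, coord_sub _ hx]
      exact (hlim x x hx).const_sub _
    calc normSq h α ((u m).1 - s)
        = ∫⁻ x, liminf (fun k => ENNReal.ofReal
            (h x ((u m - u k).1 x) ((u m - u k).1 x)).re) atTop ∂α.volume :=
          lintegral_congr fun x => (hpt x).liminf_eq.symm
      _ ≤ liminf (fun k => ∫⁻ x, ENNReal.ofReal
            (h x ((u m - u k).1 x) ((u m - u k).1 x)).re ∂α.volume) atTop :=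
          lintegral_liminf_le fun k => (Complex.continuous_re.comp
            (hd.continuous_apply (u m - u k).2.1 (u m - u k).2.1)).measurable.ennreal_ofReal
      _ ≤ liminf (fun _ : ℕ => ENNReal.ofReal (ε ^ 2)) atTop := by
          refine liminf_le_liminf ?_
          filter_upwards [eventually_ge_atTop N] with k hk
          have h1 := hd.ofReal_norm_sq (u m - u k)
          refine (le_of_eq h1.symm).trans (ENNReal.ofReal_le_ofReal ?_)
          rw [← dist_eq_norm]
          have := (hN m hm k hk).le
          gcongr
      _ = ENNReal.ofReal (ε ^ 2) := liminf_const _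
  have hsub : ∀ m, (u m).1 - s ∈ holomorphicSections (n := n) L := fun m =>
    fun x => mdifferentiableAt_sub_section ((u m).2.1 x) (hshol x)
  -- The limit is `u N` minus the square integrable difference `u N - s`.
  have hsl2 : s ∈ hd.l2Submodule := by
    obtain ⟨N, hN⟩ := hfatou 1 one_pos
    have h1 : (u N).1 - s ∈ hd.l2Submodule :=
      hd.mem_l2_iff.2 ⟨hsub N, (hN N le_rfl).trans_lt ENNReal.ofReal_lt_top⟩
    have h2 := hd.l2Submodule.sub_mem (u N).2 h1
    rwa [sub_sub_cancel] at h2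
  let s' : hd.L2Space := ⟨s, hsl2⟩
  refine ⟨s', Metric.tendsto_atTop.2 fun ε hε => ?_⟩
  obtain ⟨N, hN⟩ := hfatou (ε / 2) (by positivity)
  refine ⟨N, fun m hm => ?_⟩
  have h1 := hN m hm
  have h2 := hd.ofReal_norm_sq (u m - s')
  have h3 : normSq h α (u m - s').1 ≤ ENNReal.ofReal ((ε / 2) ^ 2) := h1
  rw [← h2, ENNReal.ofReal_le_ofReal_iff (by positivity), ← dist_eq_norm] at h3
  have h4 := abs_le_of_sq_le_sq' h3 (by positivity)
  linarith [h4.2]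

end IsBergmanData

end Hilbert

end BergmanTower

namespace BergmanTower

/-! ### The Bergman kernel as a reproducing kernel. -/

section Kernel

variable {n : ℕ} {X : Type*} [TopologicalSpace X] [ChartedSpace (Fin n → ℂ) X]
  {L : X → Type*} [∀ x, AddCommGroup (L x)] [∀ x, Module ℂ (L x)]
  [TopologicalSpace (TotalSpace ℂ L)] [∀ x, TopologicalSpace (L x)] [FiberBundle ℂ L]
  [VectorBundle ℂ ℂ L]
  {h : ∀ x, L x →ₗ[ℂ] L x →ₗ⋆[ℂ] ℂ} {α : TwoForm n X}
  [ContMDiffVectorBundle 1 ℂ L 𝓘(ℂ, Fin n → ℂ)] [IsManifold 𝓘(ℂ, Fin n → ℂ) ω X]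
  {V : Set (∀ x, L x)}

theorem maximal_orthonormalBasis (V : Set (∀ x, L x)) :
    Maximal (IsOrthonormalSet h α V) (orthonormalBasis h α V) :=
  (exists_maximal_orthonormalSet h α V).choose_spec

theorem dual_apply_eq (e : Trivialization ℂ (TotalSpace.proj : TotalSpace ℂ L → X))
    [MemTrivializationAtlas e] {x : X} (hx : x ∈ e.baseSet) (ξ : Module.Dual ℂ (L x)) (v : L x) :
    ξ v = (e (TotalSpace.mk' ℂ x v)).2 * ξ (e.symm x (1 : ℂ)) := by
  conv_lhs => rw [eq_smul_frame e hx v]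
  rw [map_smul, smul_eq_mul]

namespace IsBergmanData

/-- A maximal orthonormal set of holomorphic sections consists of square integrable sections. -/
theorem subset_l2_of_isOrthonormalSet (hV : V ⊆ holomorphicSections (n := n) L)
    {B : Set (∀ x, L x)} (hB : IsOrthonormalSet h α V B) :
    B ⊆ l2HolomorphicSections (n := n) h α := by
  intro s hs
  let _ : MeasurableSpace X := borel X
  refine ⟨hV (hB.1 hs), ?_⟩
  by_contra hni
  have h1 := hB.2.1 s hs
  -- The integral of a non-integrable function is zero by convention, which contradicts the
  -- normalization to one.
  rw [sectionInner, integral_undef hni] at h1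
  exact zero_ne_one h1

theorem orthonormalBasis_subset_l2 (hV : V ⊆ holomorphicSections (n := n) L) :
    orthonormalBasis h α V ⊆ l2HolomorphicSections (n := n) h α :=
  subset_l2_of_isOrthonormalSet hV (maximal_orthonormalBasis V).prop

/-- The elements of the chosen orthonormal basis of `V` as elements of the Hilbert space. -/
def basisVector (hd : IsBergmanData h α) (hV : V ⊆ holomorphicSections (n := n) L)
    (s : orthonormalBasis h α V) : hd.L2Space :=
  ⟨s.1, orthonormalBasis_subset_l2 hV s.2⟩

theorem orthonormal_basisVector (hd : IsBergmanData h α)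
    (hV : V ⊆ holomorphicSections (n := n) L) : Orthonormal ℂ (hd.basisVector hV) := by
  have hB : IsOrthonormalSet h α V (orthonormalBasis h α V) := (maximal_orthonormalBasis V).prop
  refine ⟨fun s => ?_, fun s t hst => ?_⟩
  · have h1 : ‖hd.basisVector hV s‖ ^ 2 = 1 := by
      rw [norm_sq_eq]
      exact congrArg Complex.re (hB.2.1 s.1 s.2)
    exact (pow_eq_one_iff_of_nonneg (norm_nonneg _) two_ne_zero).1 h1
  · exact hB.2.2 t.2 s.2 fun hts => hst (Subtype.ext hts.symm)

/-- A nonzero vector orthogonal to the chosen set could be normalized and inserted, against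
maximality. -/
theorem span_basisVector_orthogonal (hd : IsBergmanData h α)
    (hV : V ⊆ holomorphicSections (n := n) L) (hV' : l2HolomorphicSections (n := n) h α ⊆ V) :
    (Submodule.span ℂ (range (hd.basisVector hV)))ᗮ = ⊥ := by
  have hB := maximal_orthonormalBasis (h := h) (α := α) V
  rw [Submodule.eq_bot_iff]
  intro t ht
  by_contra hne
  have horth : ∀ s : orthonormalBasis h α V, inner ℂ (hd.basisVector hV s) t = 0 := fun s =>
    (Submodule.mem_orthogonal _ _).1 ht _ (Submodule.subset_span (mem_range_self s))
  set t' : hd.L2Space := ((‖t‖⁻¹ : ℝ) : ℂ) • t with ht'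
  have hnorm : ‖t'‖ = 1 := by
    rw [ht', norm_smul, Complex.norm_real, norm_inv, norm_norm,
      inv_mul_cancel₀ (norm_ne_zero_iff.2 hne)]
  have horth' : ∀ s : orthonormalBasis h α V, inner ℂ (hd.basisVector hV s) t' = 0 := fun s => by
    rw [ht', inner_smul_right, horth, mul_zero]
  have hone : sectionInner h α t'.1 t'.1 = 1 := by
    have h1 : inner ℂ t' t' = 1 := by
      rw [inner_self_eq_norm_sq_to_K, hnorm]
      simp
    exact h1
  have hins : IsOrthonormalSet h α V (insert t'.1 (orthonormalBasis h α V)) := by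
    refine ⟨insert_subset (hV' t'.2) hB.prop.1, ?_, ?_⟩
    · rintro s (rfl | hs)
      · exact hone
      · exact hB.prop.2.1 s hs
    · refine hB.prop.2.2.insert fun s hs _ => ⟨horth' ⟨s, hs⟩, ?_⟩
      have := horth' ⟨s, hs⟩
      rw [inner_eq_zero_symm] at this
      exact this
  have hmem : t'.1 ∈ orthonormalBasis h α V :=
    hB.le_of_ge hins (subset_insert _ _) (mem_insert _ _)
  have h2 : sectionInner h α t'.1 t'.1 = 0 := horth' ⟨t'.1, hmem⟩
  rw [hone] at h2
  exact one_ne_zero h2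

theorem exists_norm_dual_apply_le (hd : IsBergmanData h α) (x : X) (ξ : Module.Dual ℂ (L x)) :
    ∃ A : ℝ, ∀ s : hd.L2Space, ‖ξ (s.1 x)‖ ≤ A * ‖s‖ := by
  set e := trivializationAt ℂ L x with he
  have hx : x ∈ e.baseSet := mem_baseSet_trivializationAt ℂ L x
  have hpos := hd.frameNorm_pos e hx
  obtain ⟨C, hC, hx'⟩ := hd.eventually_le_sectionInner x
  refine ⟨Real.sqrt (C / frameNorm h e x) * ‖ξ (e.symm x (1 : ℂ))‖, fun s => ?_⟩
  have h1 := hx'.self_of_nhds s.1 s.2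
  rw [← hd.norm_sq_eq, hd.re_apply_self_eq e hx] at h1
  have h2 : ‖(e (TotalSpace.mk' ℂ x (s.1 x))).2‖ ≤ Real.sqrt (C / frameNorm h e x) * ‖s‖ := by
    refine abs_le_of_sq_le_sq (a := ‖(e (TotalSpace.mk' ℂ x (s.1 x))).2‖) ?_ (by positivity)
      |> le_of_abs_le
    rw [mul_pow, Real.sq_sqrt (by positivity), div_mul_eq_mul_div, le_div_iff₀ hpos]
    exact h1
  rw [dual_apply_eq e hx, norm_mul]
  calc _ ≤ (Real.sqrt (C / frameNorm h e x) * ‖s‖) * ‖ξ (e.symm x (1 : ℂ))‖ := by gcongr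
    _ = _ := by ring

/-- Evaluation of square integrable sections. -/
def evalCLM (hd : IsBergmanData h α) (x : X) (ξ : Module.Dual ℂ (L x)) : hd.L2Space →L[ℂ] ℂ :=
  LinearMap.mkContinuousOfExistsBound
    { toFun := fun s => ξ (s.1 x)
      map_add' := fun s t => map_add ξ (s.1 x) (t.1 x)
      map_smul' := fun c s => map_smul ξ c (s.1 x) } (hd.exists_norm_dual_apply_le x ξ)

/-- The representing vector of an evaluation functional. -/
def evalVector (hd : IsBergmanData h α) (x : X) (ξ : Module.Dual ℂ (L x)) : hd.L2Space :=
  (InnerProductSpace.toDual ℂ hd.L2Space).symm (hd.evalCLM x ξ)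

theorem inner_evalVector (hd : IsBergmanData h α) (x : X) (ξ : Module.Dual ℂ (L x))
    (s : hd.L2Space) : inner ℂ (hd.evalVector x ξ) s = ξ (s.1 x) :=
  InnerProductSpace.toDual_symm_apply

/-- Parseval's identity for the two representing vectors. The inclusions on `V` make its orthonormal
basis a Hilbert basis of the `L²` space. -/
theorem hasSum_inner (hd : IsBergmanData h α) (hV : V ⊆ holomorphicSections (n := n) L)
    (hV' : l2HolomorphicSections (n := n) h α ⊆ V) (z w : X) (ξ : Module.Dual ℂ (L z))
    (η : Module.Dual ℂ (L w)) :
    HasSum (fun s : orthonormalBasis h α V => ξ (s.1 z) * conj (η (s.1 w)))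
      (inner ℂ (hd.evalVector z ξ) (hd.evalVector w η)) := by
  let b := HilbertBasis.mkOfOrthogonalEqBot (hd.orthonormal_basisVector hV)
    (hd.span_basisVector_orthogonal hV hV')
  refine (b.hasSum_inner_mul_inner (hd.evalVector z ξ) (hd.evalVector w η)).congr_fun fun s => ?_
  have hb : b s = hd.basisVector hV s :=
    congrFun (HilbertBasis.coe_mkOfOrthogonalEqBot (hd.orthonormal_basisVector hV)
      (hd.span_basisVector_orthogonal hV hV')) s
  rw [hb, hd.inner_evalVector, ← inner_conj_symm, hd.inner_evalVector]
  rfl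

theorem bergmanKernel_eq_inner (hd : IsBergmanData h α)
    (hV : V ⊆ holomorphicSections (n := n) L) (hV' : l2HolomorphicSections (n := n) h α ⊆ V)
    (z w : X) (ξ : Module.Dual ℂ (L z)) (η : Module.Dual ℂ (L w)) :
    bergmanKernel h α V z w ξ η = inner ℂ (hd.evalVector z ξ) (hd.evalVector w η) :=
  (hd.hasSum_inner hV hV' z w ξ η).tsum_eq

theorem hasSum_bergmanKernel (hd : IsBergmanData h α)
    (hV : V ⊆ holomorphicSections (n := n) L) (hV' : l2HolomorphicSections (n := n) h α ⊆ V)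
    (z w : X) (ξ : Module.Dual ℂ (L z)) (η : Module.Dual ℂ (L w)) :
    HasSum (fun s : orthonormalBasis h α V => ξ (s.1 z) * conj (η (s.1 w)))
      (bergmanKernel h α V z w ξ η) := by
  rw [hd.bergmanKernel_eq_inner hV hV']
  exact hd.hasSum_inner hV hV' z w ξ η

theorem bergmanKernel_self_eq (hd : IsBergmanData h α)
    (hV : V ⊆ holomorphicSections (n := n) L) (hV' : l2HolomorphicSections (n := n) h α ⊆ V)
    (z : X) (ξ : Module.Dual ℂ (L z)) :
    bergmanKernel h α V z z ξ ξ = ((‖hd.evalVector z ξ‖ ^ 2 : ℝ) : ℂ) := by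
  rw [hd.bergmanKernel_eq_inner hV hV', inner_self_eq_norm_sq_to_K]
  norm_cast

theorem bergmanKernel_self_re (hd : IsBergmanData h α)
    (hV : V ⊆ holomorphicSections (n := n) L) (hV' : l2HolomorphicSections (n := n) h α ⊆ V)
    (z : X) (ξ : Module.Dual ℂ (L z)) :
    (bergmanKernel h α V z z ξ ξ).re = ‖hd.evalVector z ξ‖ ^ 2 := by
  rw [hd.bergmanKernel_self_eq hV hV', Complex.ofReal_re]

/-- The extremal characterization of the Bergman kernel on the diagonal. -/
theorem bergmanKernel_self_re_le_iff (hd : IsBergmanData h α)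
    (hV : V ⊆ holomorphicSections (n := n) L) (hV' : l2HolomorphicSections (n := n) h α ⊆ V)
    (z : X) (ξ : Module.Dual ℂ (L z)) {c : ℝ} (hc : 0 ≤ c) :
    (bergmanKernel h α V z z ξ ξ).re ≤ c ↔
      ∀ s ∈ l2HolomorphicSections (n := n) h α, ‖ξ (s z)‖ ^ 2 ≤ c * (sectionInner h α s s).re := by
  rw [hd.bergmanKernel_self_re hV hV']
  constructor
  · intro hle s hs
    let s' : hd.L2Space := ⟨s, hs⟩
    have h1 := norm_inner_le_norm (𝕜 := ℂ) (hd.evalVector z ξ) s'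
    rw [hd.inner_evalVector] at h1
    have h2 : ‖s'‖ ^ 2 = _ := hd.norm_sq_eq s'
    calc ‖ξ (s z)‖ ^ 2 ≤ (‖hd.evalVector z ξ‖ * ‖s'‖) ^ 2 := by gcongr
      _ = ‖hd.evalVector z ξ‖ ^ 2 * (sectionInner h α s s).re := by rw [mul_pow, h2]
      _ ≤ c * (sectionInner h α s s).re := by
        have := hd.re_sectionInner_self_nonneg hs
        gcongr
  · intro hle
    -- The supremum is attained at the representing vector, so it serves as the test section.
    have h1 := hle (hd.evalVector z ξ).1 (hd.evalVector z ξ).2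
    rw [← hd.norm_sq_eq, ← hd.inner_evalVector, inner_self_eq_norm_sq_to_K] at h1
    have h3 : ‖((‖hd.evalVector z ξ‖ : ℂ)) ^ 2‖ = ‖hd.evalVector z ξ‖ ^ 2 := by
      rw [norm_pow, Complex.norm_real, norm_norm]
    rcases eq_or_ne ‖hd.evalVector z ξ‖ 0 with h0 | h0
    · rw [h0]; simpa using hc
    · have hpos : 0 < ‖hd.evalVector z ξ‖ ^ 2 := by positivity
      refine le_of_mul_le_mul_right ?_ hpos
      refine le_trans (le_of_eq ?_) h1
      refine Eq.trans ?_ (congrArg (· ^ 2) h3.symm)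
      ring

/-- The case of the constant zero in the extremal characterization. It links base points to zeros of
the kernel. -/
theorem bergmanKernel_self_pos_iff (hd : IsBergmanData h α)
    (hV : V ⊆ holomorphicSections (n := n) L) (hV' : l2HolomorphicSections (n := n) h α ⊆ V)
    (z : X) (ξ : Module.Dual ℂ (L z)) :
    0 < (bergmanKernel h α V z z ξ ξ).re ↔
      ∃ s ∈ l2HolomorphicSections (n := n) h α, ξ (s z) ≠ 0 := by
  rw [← not_le, hd.bergmanKernel_self_re_le_iff hV hV' z ξ le_rfl]
  simp

end IsBergmanData

end Kernel

end BergmanTower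

namespace BergmanTower

/-! ### Polarization and logarithms of kernels. -/

section Polarization

variable {n : ℕ}

/-- The map `z ↦ (z, conj z)`. -/
def conjDiagonal (n : ℕ) : (Fin n → ℂ) →L[ℝ] (Fin n → ℂ) × (Fin n → ℂ) :=
  (ContinuousLinearMap.id ℝ _).prod ((starL' ℝ : (Fin n → ℂ) ≃L[ℝ] (Fin n → ℂ)) :
    (Fin n → ℂ) →L[ℝ] (Fin n → ℂ))

@[simp]
theorem conjDiagonal_apply (z : Fin n → ℂ) : conjDiagonal n z = (z, star z) := rfl

/-- The real derivative given by the chain rule contains two conjugations and is therefore complex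
linear. -/
theorem differentiableAt_conj_comp_star {f : (Fin n → ℂ) → ℂ} {z : Fin n → ℂ}
    (hf : DifferentiableAt ℂ f (star z)) : DifferentiableAt ℂ (fun w => conj (f (star w))) z := by
  let A : (Fin n → ℂ) →L[ℂ] ℂ := LinearMap.toContinuousLinearMap
    { toFun := fun v => conj (fderiv ℂ f (star z) (star v))
      map_add' := fun v w => by simp
      map_smul' := fun a v => by simp [star_smul] }
  have hs : HasFDerivAt (fun w : Fin n → ℂ => star w)
      ((starL' ℝ : (Fin n → ℂ) ≃L[ℝ] (Fin n → ℂ)) : (Fin n → ℂ) →L[ℝ] (Fin n → ℂ)) z :=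
    ((starL' ℝ : (Fin n → ℂ) ≃L[ℝ] (Fin n → ℂ)) :
      (Fin n → ℂ) →L[ℝ] (Fin n → ℂ)).hasFDerivAt
  have h1 : HasFDerivAt (fun w => f (star w)) _ z :=
    HasFDerivAt.comp z (hf.hasFDerivAt.restrictScalars ℝ) hs
  have h2 : HasFDerivAt (fun w => conj (f (star w))) _ z :=
    Complex.conjCLE.toContinuousLinearMap.hasFDerivAt.comp z h1
  exact (hasFDerivAt_of_restrictScalars ℝ h2
    (show A.restrictScalars ℝ = _ by ext v; rfl)).differentiableAt

theorem SmoothTendstoOn.halfIddbar {ι : Type*} {l : Filter ι} {f : ι → (Fin n → ℂ) → ℝ}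
    {g : (Fin n → ℂ) → ℝ} {U : Set (Fin n → ℂ)} (h : SmoothTendstoOn l f g U) (hU : IsOpen U) :
    SmoothTendstoOn l (fun j => halfIddbar (f j)) (halfIddbar g) U := by
  have key : ∀ u : (Fin n → ℂ) → ℝ, ContDiffOn ℝ ∞ u U →
      EqOn (BergmanTower.halfIddbar u)
        (fun z => halfIddbarLinear n (_root_.fderiv ℝ (_root_.fderiv ℝ u) z)) U :=
    fun u hu z hz => halfIddbar_eq ((hu.contDiffAt (hU.mem_nhds hz)).of_le
      (WithTop.coe_le_coe.2 (le_top : (2 : ℕ∞) ≤ ⊤)))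
  exact (((h.fderiv hU).fderiv hU).clm_comp hU (halfIddbarLinear n)).congr hU
    (h.eventually.mono fun j hj => key _ hj) (key _ h.limit)

/-- Convergence of the logarithms of positive functions having convergent holomorphic
polarizations. -/
theorem exists_smoothTendstoOn_log {ι : Type*} {l : Filter ι} [l.NeBot]
    {G : ι → (Fin n → ℂ) × (Fin n → ℂ) → ℂ} {G₀ : (Fin n → ℂ) × (Fin n → ℂ) → ℂ}
    {D : Set ((Fin n → ℂ) × (Fin n → ℂ))} (hD : IsOpen D)
    (hG : ∀ᶠ j in l, DifferentiableOn ℂ (G j) D) (hlim : TendstoLocallyUniformlyOn G G₀ l D)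
    {u : ι → (Fin n → ℂ) → ℝ} {u₀ : (Fin n → ℂ) → ℝ}
    (hu : ∀ᶠ j in l, ∀ z, conjDiagonal n z ∈ D → G j (conjDiagonal n z) = u j z)
    (hu₀ : ∀ z, conjDiagonal n z ∈ D → G₀ (conjDiagonal n z) = u₀ z)
    {z₀ : Fin n → ℂ} (hz₀ : conjDiagonal n z₀ ∈ D) (hpos : 0 < u₀ z₀) :
    ∃ U, IsOpen U ∧ z₀ ∈ U ∧ (∀ z ∈ U, conjDiagonal n z ∈ D) ∧ (∀ z ∈ U, 0 < u₀ z) ∧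
      (∀ᶠ j in l, ∀ z ∈ U, 0 < u j z) ∧
      SmoothTendstoOn l (fun j z => Real.log (u j z)) (fun z => Real.log (u₀ z)) U := by
  have hG₀ : DifferentiableOn ℂ G₀ D := (differentiableOn_and_tendsto_fderiv hD hlim hG).1
  set p₀ := conjDiagonal n z₀ with hp₀
  -- A margin: where the limit has real part above `ρ`, uniform approximation within `ρ` keeps the
  -- real parts positive.
  set ρ := u₀ z₀ / 2 with hρ
  have hρpos : 0 < ρ := by positivity
  have hre : ρ < (G₀ p₀).re := by rw [hu₀ z₀ hz₀, Complex.ofReal_re]; linarith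
  have hev : ∀ᶠ p in 𝓝 p₀, p ∈ D ∧ ρ < (G₀ p).re :=
    (hD.eventually_mem hz₀).and
      ((Complex.continuous_re.continuousAt.comp
        (hG₀.continuousOn.continuousAt (hD.mem_nhds hz₀))).eventually (lt_mem_nhds hre))
  obtain ⟨r, hr, hrD⟩ := Metric.nhds_basis_closedBall.eventually_iff.1 hev
  set B := Metric.ball p₀ r with hB
  have hBK : B ⊆ Metric.closedBall p₀ r := Metric.ball_subset_closedBall
  have hBD : B ⊆ D := fun p hp => (hrD (hBK hp)).1
  have hBo : IsOpen B := Metric.isOpen_ball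
  have hunif := (tendstoLocallyUniformlyOn_iff_forall_isCompact hD).1 hlim _
    (fun p hp => (hrD hp).1) (isCompact_closedBall p₀ r)
  have hjre : ∀ᶠ j in l, ∀ p ∈ B, 0 < (G j p).re := by
    filter_upwards [Metric.tendstoUniformlyOn_iff.1 hunif ρ hρpos] with j hj p hp
    have h1 := hj p (hBK hp)
    rw [dist_eq_norm] at h1
    have h2 := (Complex.abs_re_le_norm _).trans_lt h1
    rw [Complex.sub_re] at h2
    have h3 := (hrD (hBK hp)).2
    have := (abs_lt.1 h2).2
    linarith
  -- On the right half-plane the principal logarithm is holomorphic, so the logarithms are again a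
  -- locally uniformly convergent holomorphic family.
  have hlog : TendstoLocallyUniformlyOn (fun j p => Complex.log (G j p))
      (fun p => Complex.log (G₀ p)) l B := by
    have hslit : ∀ p ∈ B, G₀ p ∈ Complex.slitPlane := fun p hp =>
      Or.inl (hρpos.trans (hrD (hBK hp)).2)
    refine (tendstoLocallyUniformlyOn_iff_tendsto_prod hBo
      ((hG₀.continuousOn.mono hBD).clog hslit)).2 fun p hp => ?_
    exact ((continuousAt_clog (hslit p hp)).tendsto).comp
      ((tendstoLocallyUniformlyOn_iff_tendsto_prod hD hG₀.continuousOn).1 hlim p (hBD hp))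
  have hsm := smoothTendstoOn_of_holomorphic hBo hlog (by
    filter_upwards [hG, hjre] with j hj hj'
    exact (hj.mono hBD).clog fun p hp => Or.inl (hj' p hp))
  refine ⟨conjDiagonal n ⁻¹' B, hBo.preimage (conjDiagonal n).continuous,
    Metric.mem_ball_self hr, fun z hz => hBD hz, fun z hz => ?_, ?_, ?_⟩
  · have h1 := (hrD (hBK hz)).2
    rw [hu₀ z (hBD hz), Complex.ofReal_re] at h1
    exact hρpos.trans h1
  · filter_upwards [hu, hjre] with j hj hj' z hz
    have h1 := hj' _ hz
    rwa [hj z (hBD hz), Complex.ofReal_re] at h1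
  -- Real part and restriction to `(z, conj z)` are real linear operations and preserve smooth
  -- convergence.
  · refine ((hsm.clm_comp hBo Complex.reCLM).comp_clm hBo (conjDiagonal n)).congr
      (hBo.preimage (conjDiagonal n).continuous) ?_ ?_
    · filter_upwards [hu] with j hj z hz
      simp only [Complex.reCLM_apply]
      rw [hj z (hBD hz), Complex.log_ofReal_re]
    · intro z hz
      simp only [Complex.reCLM_apply]
      rw [hu₀ z (hBD hz), Complex.log_ofReal_re]

end Polarization

/-! ### Holomorphy of the polarized Bergman kernel. -/

section LocalKernel

variable {n : ℕ} {X : Type*} [TopologicalSpace X] [ChartedSpace (Fin n → ℂ) X]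
  {L : X → Type*} [∀ x, AddCommGroup (L x)] [∀ x, Module ℂ (L x)]
  [TopologicalSpace (TotalSpace ℂ L)] [∀ x, TopologicalSpace (L x)] [FiberBundle ℂ L]
  [VectorBundle ℂ ℂ L]
  {h : ∀ x, L x →ₗ[ℂ] L x →ₗ⋆[ℂ] ℂ} {α : TwoForm n X}
  {V : Set (∀ x, L x)}

variable (h α V) in
/-- The Bergman kernel in the chart `c` and the trivialization `e`. -/
def localKernel (e : Trivialization ℂ (TotalSpace.proj : TotalSpace ℂ L → X))
    [MemTrivializationAtlas e] (c : OpenPartialHomeomorph X (Fin n → ℂ)) (z w : Fin n → ℂ) : ℂ :=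
  bergmanKernel h α V (c.symm z) (c.symm w) (e.linearMapAt ℂ (c.symm z))
    (e.linearMapAt ℂ (c.symm w))

theorem linearMapAt_eq_localRep (e : Trivialization ℂ (TotalSpace.proj : TotalSpace ℂ L → X))
    [MemTrivializationAtlas e] {c : OpenPartialHomeomorph X (Fin n → ℂ)} {z : Fin n → ℂ}
    (hz : z ∈ localDomain e c) (s : ∀ x, L x) :
    e.linearMapAt ℂ (c.symm z) (s (c.symm z)) = localRep e c s z := by
  rw [e.coe_linearMapAt_of_mem hz.2]
  rfl

theorem bergmanKernel_smul_smul (z w : X) (ξ : Module.Dual ℂ (L z)) (η : Module.Dual ℂ (L w))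
    (a b : ℂ) : bergmanKernel h α V z w (a • ξ) (b • η) =
      a * conj b * bergmanKernel h α V z w ξ η := by
  rw [bergmanKernel, bergmanKernel, ← tsum_mul_left]
  refine tsum_congr fun s => ?_
  simp only [LinearMap.smul_apply, smul_eq_mul, map_mul]
  ring

variable [ContMDiffVectorBundle 1 ℂ L 𝓘(ℂ, Fin n → ℂ)] [IsManifold 𝓘(ℂ, Fin n → ℂ) ω X]

namespace IsBergmanData

theorem localKernel_self (hd : IsBergmanData h α)
    (hV : V ⊆ holomorphicSections (n := n) L) (hV' : l2HolomorphicSections (n := n) h α ⊆ V)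
    (e : Trivialization ℂ (TotalSpace.proj : TotalSpace ℂ L → X))
    [MemTrivializationAtlas e] (c : OpenPartialHomeomorph X (Fin n → ℂ)) (z : Fin n → ℂ) :
    localKernel h α V e c z z = ((localKernel h α V e c z z).re : ℂ) := by
  rw [localKernel, hd.bergmanKernel_self_eq hV hV', Complex.ofReal_re]

/-- Finite partial sums are at most the diagonal kernel, which the extremal characterization bounds
by the norm of the evaluation. The bound is independent of the finite set. -/
theorem sum_sq_localRep_le (hd : IsBergmanData h α)
    (hV : V ⊆ holomorphicSections (n := n) L) (hV' : l2HolomorphicSections (n := n) h α ⊆ V)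
    (e : Trivialization ℂ (TotalSpace.proj : TotalSpace ℂ L → X))
    [MemTrivializationAtlas e] {c : OpenPartialHomeomorph X (Fin n → ℂ)} {z : Fin n → ℂ}
    (hz : z ∈ localDomain e c) {C : ℝ} (hC : 0 ≤ C)
    (hle : ∀ s : hd.L2Space, ‖localRep e c s.1 z‖ ^ 2 ≤ C * ‖s‖ ^ 2)
    (A : Finset (orthonormalBasis h α V)) : ∑ s ∈ A, ‖localRep e c s.1 z‖ ^ 2 ≤ C := by
  have h1 : (localKernel h α V e c z z).re ≤ C := by
    refine (hd.bergmanKernel_self_re_le_iff hV hV' _ _ hC).2 fun s hs => ?_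
    rw [linearMapAt_eq_localRep e hz, ← hd.norm_sq_eq ⟨s, hs⟩]
    exact hle ⟨s, hs⟩
  refine le_trans ?_ h1
  have h2 := Complex.hasSum_re (hd.hasSum_bergmanKernel hV hV' (c.symm z) (c.symm z)
    (e.linearMapAt ℂ (c.symm z)) (e.linearMapAt ℂ (c.symm z)))
  have h3 : ∀ s : orthonormalBasis h α V, ((e.linearMapAt ℂ (c.symm z)) (s.1 (c.symm z)) *
      conj ((e.linearMapAt ℂ (c.symm z)) (s.1 (c.symm z)))).re = ‖localRep e c s.1 z‖ ^ 2 := by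
    intro s
    rw [linearMapAt_eq_localRep e hz, Complex.mul_conj, Complex.ofReal_re,
      Complex.normSq_eq_norm_sq]
  simp only [h3] at h2
  exact sum_le_hasSum A (fun s _ => by positivity) h2

/-- The Bergman kernel is holomorphic in the first and antiholomorphic in the second variable. -/
theorem differentiableOn_localKernel (hd : IsBergmanData h α)
    (hV : V ⊆ holomorphicSections (n := n) L) (hV' : l2HolomorphicSections (n := n) h α ⊆ V)
    (x₁ : X) {c : OpenPartialHomeomorph X (Fin n → ℂ)}
    (hc : c ∈ IsManifold.maximalAtlas 𝓘(ℂ, Fin n → ℂ) ω X) :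
    DifferentiableOn ℂ
      (fun p : (Fin n → ℂ) × (Fin n → ℂ) =>
        localKernel h α V (trivializationAt ℂ L x₁) c p.1 (star p.2))
      (localDomain (trivializationAt ℂ L x₁) c ×ˢ
        (star ⁻¹' localDomain (trivializationAt ℂ L x₁) c)) := by
  set e := trivializationAt ℂ L x₁ with he
  set D := localDomain e c with hD
  have hDo : IsOpen D := isOpen_localDomain e c
  have hDDo : IsOpen (D ×ˢ (star ⁻¹' D)) := hDo.prod (hDo.preimage continuous_star)
  -- The partial sums are holomorphic in both variables after conjugating the second. They converge
  -- pointwise and are locally bounded, so the limit is holomorphic.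
  let S : Finset (orthonormalBasis h α V) → (Fin n → ℂ) × (Fin n → ℂ) → ℂ := fun A p =>
    ∑ s ∈ A, localRep e c s.1 p.1 * conj (localRep e c s.1 (star p.2))
  have hS : ∀ A, DifferentiableOn ℂ (S A) (D ×ˢ (star ⁻¹' D)) := by
    intro A p hp
    refine DifferentiableAt.differentiableWithinAt ?_
    refine DifferentiableAt.fun_sum fun s _ => ?_
    have hs := differentiableOn_localRep e hc (hV ((maximal_orthonormalBasis V).prop.1 s.2))
    refine DifferentiableAt.mul ?_ ?_
    · exact ((hs.differentiableAt (hDo.mem_nhds hp.1))).comp p differentiableAt_fst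
    · exact (differentiableAt_conj_comp_star
        (hs.differentiableAt (hDo.mem_nhds hp.2))).comp p differentiableAt_snd
  refine (differentiableOn_and_tendsto_fderiv hDDo
    (tendstoLocallyUniformlyOn_of_tendsto (l := atTop) (f := S) hS (fun p hp => ?_)
      fun p hp => ?_) (Eventually.of_forall hS)).1
  · obtain ⟨r₁, hr₁, C₁, hC₁, hrD₁, hle₁⟩ := hd.exists_localRep_le x₁ hp.1
    obtain ⟨r₂, hr₂, C₂, hC₂, hrD₂, hle₂⟩ := hd.exists_localRep_le x₁ hp.2
    have hmem : ∀ q ∈ Metric.ball p (min r₁ r₂),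
        q.1 ∈ Metric.ball p.1 r₁ ∧ star q.2 ∈ Metric.ball (star p.2) r₂ := by
      intro q hq
      rw [Metric.mem_ball, Prod.dist_eq, max_lt_iff] at hq
      refine ⟨hq.1.trans_le (min_le_left _ _), ?_⟩
      rw [Metric.mem_ball, dist_star_star]
      exact hq.2.trans_le (min_le_right _ _)
    -- The constant comes from `ab ≤ (a² + b²) / 2` applied termwise.
    refine ⟨min r₁ r₂, lt_min hr₁ hr₂, (C₁ + C₂) / 2, fun q hq =>
      ⟨hrD₁ (hmem q hq).1, hrD₂ (hmem q hq).2⟩, fun A q hq => ?_⟩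
    obtain ⟨hq₁, hq₂⟩ := hmem q hq
    have h1 := hd.sum_sq_localRep_le hV hV' e (hrD₁ hq₁) hC₁ (hle₁ _ hq₁) A
    have h2 := hd.sum_sq_localRep_le hV hV' e (hrD₂ hq₂) hC₂ (hle₂ _ hq₂) A
    calc ‖S A q‖ ≤ ∑ s ∈ A, ‖localRep e c s.1 q.1 * conj (localRep e c s.1 (star q.2))‖ :=
          norm_sum_le _ _
      _ ≤ ∑ s ∈ A, (‖localRep e c s.1 q.1‖ ^ 2 + ‖localRep e c s.1 (star q.2)‖ ^ 2) / 2 := by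
          refine Finset.sum_le_sum fun s _ => ?_
          rw [norm_mul, RCLike.norm_conj]
          nlinarith [sq_nonneg (‖localRep e c s.1 q.1‖ - ‖localRep e c s.1 (star q.2)‖)]
      _ = ((∑ s ∈ A, ‖localRep e c s.1 q.1‖ ^ 2) +
            ∑ s ∈ A, ‖localRep e c s.1 (star q.2)‖ ^ 2) / 2 := by
          rw [← Finset.sum_div, Finset.sum_add_distrib]
      _ ≤ (C₁ + C₂) / 2 := by gcongr
  · have h1 := hd.hasSum_bergmanKernel hV hV' (c.symm p.1) (c.symm (star p.2))
      (e.linearMapAt ℂ (c.symm p.1)) (e.linearMapAt ℂ (c.symm (star p.2)))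
    simp only [linearMapAt_eq_localRep e hp.1, linearMapAt_eq_localRep e hp.2] at h1
    exact h1

end IsBergmanData

end LocalKernel

end BergmanTower

namespace BergmanTower

/-! ### Independence of chart and frame, and smoothness of the Bergman metric. -/

section Metric

variable {n : ℕ} {X : Type*} [TopologicalSpace X] [ChartedSpace (Fin n → ℂ) X]
  {L : X → Type*} [∀ x, AddCommGroup (L x)] [∀ x, Module ℂ (L x)]
  [TopologicalSpace (TotalSpace ℂ L)] [∀ x, TopologicalSpace (L x)] [FiberBundle ℂ L]
  [VectorBundle ℂ ℂ L]
  {h : ∀ x, L x →ₗ[ℂ] L x →ₗ⋆[ℂ] ℂ} {α : TwoForm n X}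
  {V : Set (∀ x, L x)}

/-- Near `z`, `log |g|²` is the real part of the holomorphic function `2 log (g / g z)` plus a
constant. Dividing by `g z` puts the argument near one, in the domain of the principal branch. -/
theorem halfIddbar_log_norm_sq_add {g : (Fin n → ℂ) → ℂ} {v : (Fin n → ℂ) → ℝ} {z : Fin n → ℂ}
    (hg : ∀ᶠ w in 𝓝 z, DifferentiableAt ℂ g w) (hgz : g z ≠ 0) (hv : ContDiffAt ℝ 2 v z) :
    halfIddbar (fun w => Real.log (‖g w‖ ^ 2) + v w) z = halfIddbar v z := by
  let f : (Fin n → ℂ) → ℂ := fun w =>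
    2 * Complex.log (g w / g z) + ((2 * Real.log ‖g z‖ : ℝ) : ℂ)
  have hslit : ∀ᶠ w in 𝓝 z, g w / g z ∈ Complex.slitPlane := by
    have h1 : ContinuousAt (fun w => g w / g z) z := hg.self_of_nhds.continuousAt.div_const _
    refine h1.eventually (Complex.isOpen_slitPlane.mem_nhds ?_)
    simp only [div_self hgz]
    exact Complex.one_mem_slitPlane
  have hf : ∀ᶠ w in 𝓝 z, DifferentiableAt ℂ f w := by
    filter_upwards [hg, hslit] with w hw hw'
    have h1 : DifferentiableAt ℂ (fun w => g w / g z) w := by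
      simpa only [div_eq_mul_inv] using hw.mul_const (g z)⁻¹
    exact ((h1.clog hw').const_mul 2).add_const _
  have hlog : (fun w => Real.log (‖g w‖ ^ 2)) =ᶠ[𝓝 z] fun w => (f w).re := by
    filter_upwards [hslit] with w hw
    have hw0 : g w ≠ 0 := fun h0 => Complex.slitPlane_ne_zero hw (by rw [h0, zero_div])
    have h1 : (f w).re = 2 * Real.log ‖g w / g z‖ + 2 * Real.log ‖g z‖ := by
      simp only [f, Complex.add_re, Complex.mul_re, Complex.ofReal_re, Complex.log_re,
        Complex.re_ofNat, Complex.im_ofNat, zero_mul, sub_zero]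
    rw [h1, norm_div, Real.log_div (norm_ne_zero_iff.2 hw0) (norm_ne_zero_iff.2 hgz),
      Real.log_pow]
    push_cast
    ring
  obtain ⟨U, hU, hUo, hzU⟩ := eventually_nhds_iff.1 hf
  have hfU : DifferentiableOn ℂ f U := fun w hw => (hU w hw).differentiableWithinAt
  have hfsm : ContDiffAt ℝ 2 (fun w => (f w).re) z :=
    Complex.reCLM.contDiff.contDiffAt.comp z
      (((contDiffOn_real_of_differentiableOn hUo hfU).contDiffAt (hUo.mem_nhds hzU)).of_le
        (WithTop.coe_le_coe.2 (le_top : (2 : ℕ∞) ≤ ⊤)))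
  have hadd : (fun w => Real.log (‖g w‖ ^ 2) + v w) =ᶠ[𝓝 z] fun w => (f w).re + v w := by
    filter_upwards [hlog] with w hw
    rw [hw]
  rw [halfIddbar_congr hadd, halfIddbar_add hfsm hv, halfIddbar_re_eq_zero (hUo.mem_nhds hzU) hfU, zero_add]

theorem linearMapAt_eq_smul (e e' : Trivialization ℂ (TotalSpace.proj : TotalSpace ℂ L → X))
    [MemTrivializationAtlas e] [MemTrivializationAtlas e'] {x : X} (hx : x ∈ e.baseSet)
    (hx' : x ∈ e'.baseSet) :
    e.linearMapAt ℂ x = (e'.coordChangeL ℂ e x (1 : ℂ)) • e'.linearMapAt ℂ x := by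
  refine LinearMap.ext fun v => ?_
  rw [dual_apply_eq e' hx', LinearMap.smul_apply, smul_eq_mul, e'.coe_linearMapAt_of_mem hx',
    e'.coordChangeL_apply e ⟨hx', hx⟩, e.coe_linearMapAt_of_mem hx, mul_comm]

variable [ContMDiffVectorBundle 1 ℂ L 𝓘(ℂ, Fin n → ℂ)] [IsManifold 𝓘(ℂ, Fin n → ℂ) ω X]

namespace IsBergmanData

theorem localKernel_re_pos (hd : IsBergmanData h α)
    (hV : V ⊆ holomorphicSections (n := n) L) (hV' : l2HolomorphicSections (n := n) h α ⊆ V)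
    (e : Trivialization ℂ (TotalSpace.proj : TotalSpace ℂ L → X)) [MemTrivializationAtlas e]
    {c : OpenPartialHomeomorph X (Fin n → ℂ)} {z : Fin n → ℂ} (hz : z ∈ localDomain e c)
    {s : ∀ x, L x} (hs : s ∈ l2HolomorphicSections (n := n) h α) (hsz : s (c.symm z) ≠ 0) :
    0 < (localKernel h α V e c z z).re := by
  refine (hd.bergmanKernel_self_pos_iff hV hV' _ _).2 ⟨s, hs, fun h0 => hsz ?_⟩
  have h1 := eq_smul_frame e hz.2 (s (c.symm z))
  rw [linearMapAt_eq_localRep e hz] at h0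
  have h2 : (e (TotalSpace.mk' ℂ (c.symm z) (s (c.symm z)))).2 = 0 := h0
  rwa [h2, zero_smul] at h1

theorem conjDiagonal_mem {D : Set (Fin n → ℂ)} {z : Fin n → ℂ} :
    conjDiagonal n z ∈ D ×ˢ (star ⁻¹' D) ↔ z ∈ D := by
  simp

/-- The limit statement for logarithms of polarized kernels, applied to a constant sequence. -/
theorem exists_contDiffOn_log_localKernel (hd : IsBergmanData h α)
    (hV : V ⊆ holomorphicSections (n := n) L) (hV' : l2HolomorphicSections (n := n) h α ⊆ V)
    (x₁ : X) {c : OpenPartialHomeomorph X (Fin n → ℂ)}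
    (hc : c ∈ IsManifold.maximalAtlas 𝓘(ℂ, Fin n → ℂ) ω X) {z : Fin n → ℂ}
    (hz : z ∈ localDomain (trivializationAt ℂ L x₁) c)
    (hpos : 0 < (localKernel h α V (trivializationAt ℂ L x₁) c z z).re) :
    ∃ U, IsOpen U ∧ z ∈ U ∧ U ⊆ localDomain (trivializationAt ℂ L x₁) c ∧
      (∀ w ∈ U, 0 < (localKernel h α V (trivializationAt ℂ L x₁) c w w).re) ∧
      ContDiffOn ℝ ∞ (fun w => Real.log
        (localKernel h α V (trivializationAt ℂ L x₁) c w w).re) U := by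
  set e := trivializationAt ℂ L x₁ with he
  have hDo : IsOpen (localDomain e c) := isOpen_localDomain e c
  have hG := hd.differentiableOn_localKernel hV hV' x₁ hc
  have hu : ∀ w, conjDiagonal n w ∈ localDomain e c ×ˢ (star ⁻¹' localDomain e c) →
      localKernel h α V e c (conjDiagonal n w).1 (star (conjDiagonal n w).2) =
        ((localKernel h α V e c w w).re : ℂ) := by
    intro w _
    rw [conjDiagonal_apply, star_star]
    exact hd.localKernel_self hV hV' e c w
  obtain ⟨U, hUo, hzU, hUD, hUpos, -, hsm⟩ := exists_smoothTendstoOn_log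
    (G := fun (_ : ℕ) p => localKernel h α V e c p.1 (star p.2)) (l := atTop)
    (hDo.prod (hDo.preimage continuous_star)) (Eventually.of_forall fun _ => hG)
    (fun u hu x _ => ⟨_, self_mem_nhdsWithin, Eventually.of_forall fun _ _ _ =>
      refl_mem_uniformity hu⟩)
    (Eventually.of_forall fun _ => hu) hu (conjDiagonal_mem.2 hz) hpos
  exact ⟨U, hUo, hzU, fun w hw => conjDiagonal_mem.1 (hUD w hw), hUpos, hsm.limit⟩

/-- The Bergman metric can be computed in any chart and any trivialization. -/
theorem inChart_bergmanMetric (hd : IsBergmanData h α)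
    (hV : V ⊆ holomorphicSections (n := n) L) (hV' : l2HolomorphicSections (n := n) h α ⊆ V)
    (x₁ : X) {c : OpenPartialHomeomorph X (Fin n → ℂ)}
    (hc : c ∈ IsManifold.maximalAtlas 𝓘(ℂ, Fin n → ℂ) ω X) {z : Fin n → ℂ}
    (hz : z ∈ localDomain (trivializationAt ℂ L x₁) c)
    (hpos : 0 < (localKernel h α V (trivializationAt ℂ L x₁) c z z).re) :
    (bergmanMetric h α V).inChart c z =
      halfIddbar (fun w => Real.log (localKernel h α V (trivializationAt ℂ L x₁) c w w).re) z := by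
  set e := trivializationAt ℂ L x₁ with he
  set x := c.symm z with hx
  set c' := chartAt (Fin n → ℂ) x with hc'
  set e' := trivializationAt ℂ L x with he'
  have hc'm : c' ∈ IsManifold.maximalAtlas 𝓘(ℂ, Fin n → ℂ) ω X :=
    IsManifold.chart_mem_maximalAtlas x
  have hxc' : x ∈ c'.source := mem_chart_source _ x
  have hxe' : x ∈ e'.baseSet := mem_baseSet_trivializationAt ℂ L x
  set φ : (Fin n → ℂ) → Fin n → ℂ := fun w => c' (c.symm w) with hφ
  have hcont : ContinuousAt c.symm z := c.continuousAt_symm hz.1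
  have hev : ∀ᶠ w in 𝓝 z, w ∈ localDomain e c ∧ c.symm w ∈ c'.source ∧ c.symm w ∈ e'.baseSet :=
    ((isOpen_localDomain e c).eventually_mem hz).and
      ((hcont.eventually (c'.open_source.mem_nhds hxc')).and
        (hcont.eventually (e'.open_baseSet.mem_nhds hxe')))
  have hmdc' : ∀ y ∈ c'.source, MDifferentiableAt 𝓘(ℂ, Fin n → ℂ) 𝓘(ℂ, Fin n → ℂ) c' y :=
    fun y hy => ((contMDiffOn_of_mem_maximalAtlas hc'm).contMDiffAt
      (c'.open_source.mem_nhds hy)).mdifferentiableAt (by simp)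
  have hmdc : MDifferentiableAt 𝓘(ℂ, Fin n → ℂ) 𝓘(ℂ, Fin n → ℂ) c.symm z :=
    ((contMDiffOn_symm_of_mem_maximalAtlas hc).contMDiffAt
      (c.open_target.mem_nhds hz.1)).mdifferentiableAt (by simp)
  have hφd : ∀ᶠ w in 𝓝 z, DifferentiableAt ℂ φ w := by
    filter_upwards [hev] with w hw
    exact differentiableAt_comp_symm hc hw.1.1 (hmdc' _ hw.2.1)
  have hφz : fderiv ℂ φ z = (mfderiv 𝓘(ℂ, Fin n → ℂ) 𝓘(ℂ, Fin n → ℂ) c' x).comp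
      (mfderiv 𝓘(ℂ, Fin n → ℂ) 𝓘(ℂ, Fin n → ℂ) c.symm z) := by
    rw [← mfderiv_eq_fderiv]
    exact mfderiv_comp z (hmdc' x hxc') hmdc
  -- The transition function of the two frames: holomorphic, and the diagonal kernels differ by the
  -- factor `|g|²`. The change of charts is absorbed by the pullback under `φ`.
  set g : (Fin n → ℂ) → ℂ := fun w => e'.coordChangeL ℂ e (c.symm w) (1 : ℂ) with hg
  have hgd : ∀ᶠ w in 𝓝 z, DifferentiableAt ℂ g w := by
    filter_upwards [hev] with w hw
    have h1 := mdifferentiableAt_coordChangeL (IB := 𝓘(ℂ, Fin n → ℂ)) (e := e') (e' := e)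
      hw.2.2 hw.1.2
    have h2 := differentiableAt_comp_symm hc hw.1.1 h1
    exact h2.clm_apply (differentiableAt_const _)
  have hker : ∀ᶠ w in 𝓝 z, (localKernel h α V e c w w).re =
      ‖g w‖ ^ 2 * (localKernel h α V e' c' (φ w) (φ w)).re := by
    filter_upwards [hev] with w hw
    have h1 : localKernel h α V e' c' (φ w) (φ w) = bergmanKernel h α V (c.symm w) (c.symm w)
        (e'.linearMapAt ℂ (c.symm w)) (e'.linearMapAt ℂ (c.symm w)) := by
      rw [localKernel, hφ, c'.left_inv hw.2.1]
    rw [h1, localKernel, linearMapAt_eq_smul e e' hw.1.2 hw.2.2, bergmanKernel_smul_smul,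
      Complex.mul_conj, Complex.re_ofReal_mul, Complex.normSq_eq_norm_sq]
  have hpos' : 0 < ‖g z‖ ^ 2 * (localKernel h α V e' c' (φ z) (φ z)).re := by
    rw [← hker.self_of_nhds]
    exact hpos
  have hgz : g z ≠ 0 := by
    intro h0
    rw [h0, norm_zero] at hpos'
    simp at hpos'
  have hpos'' : 0 < (localKernel h α V e' c' (φ z) (φ z)).re :=
    pos_of_mul_pos_right hpos' (by positivity)
  have hφzmem : φ z ∈ localDomain e' c' := by
    refine ⟨c'.map_source hxc', ?_⟩
    rw [mem_preimage, hφ, c'.left_inv hxc']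
    exact hxe'
  obtain ⟨U, hUo, hzU, hUD, hUpos, hsm⟩ :=
    hd.exists_contDiffOn_log_localKernel hV hV' x hc'm hφzmem hpos''
  set u : (Fin n → ℂ) → ℝ := fun w => Real.log (localKernel h α V e' c' w w).re with hu
  have husm : ContDiffAt ℝ 2 u (φ z) := (hsm.contDiffAt (hUo.mem_nhds hzU)).of_le
    (WithTop.coe_le_coe.2 (le_top : (2 : ℕ∞) ≤ ⊤))
  obtain ⟨W, hW, hWo, hzW⟩ := eventually_nhds_iff.1 hφd
  have hφW : DifferentiableOn ℂ φ W := fun w hw => (hW w hw).differentiableWithinAt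
  have hφsm : ContDiffAt ℝ 2 φ z :=
    ((contDiffOn_real_of_differentiableOn hWo hφW).contDiffAt (hWo.mem_nhds hzW)).of_le
      (WithTop.coe_le_coe.2 (le_top : (2 : ℕ∞) ≤ ⊤))
  have hlog : (fun w => Real.log (localKernel h α V e c w w).re) =ᶠ[𝓝 z]
      fun w => Real.log (‖g w‖ ^ 2) + (u ∘ φ) w := by
    filter_upwards [hker, hφd.self_of_nhds.continuousAt.eventually (hUo.mem_nhds hzU),
      hgd.self_of_nhds.continuousAt.eventually_ne hgz] with w hw hwU hwg
    rw [hw, Real.log_mul (pow_ne_zero _ (norm_ne_zero_iff.2 hwg)) (hUpos _ hwU).ne']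
    rfl
  rw [halfIddbar_congr hlog, halfIddbar_log_norm_sq_add hgd hgz (husm.comp z hφsm),
    halfIddbar_comp (hWo.mem_nhds hzW) hφW husm, hφz]
  rfl

theorem isSmooth_bergmanMetric (hd : IsBergmanData h α)
    (hV : V ⊆ holomorphicSections (n := n) L) (hV' : l2HolomorphicSections (n := n) h α ⊆ V)
    (hbase : ∀ x, ∃ s ∈ l2HolomorphicSections (n := n) h α, s x ≠ 0) :
    (bergmanMetric h α V).IsSmooth := by
  intro c hc z hz
  refine ContDiffAt.contDiffWithinAt ?_
  have hzD : z ∈ localDomain (trivializationAt ℂ L (c.symm z)) c :=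
    ⟨hz, mem_baseSet_trivializationAt ℂ L _⟩
  obtain ⟨s, hs, hsz⟩ := hbase (c.symm z)
  obtain ⟨U, hUo, hzU, hUD, hUpos, hsm⟩ := hd.exists_contDiffOn_log_localKernel hV hV'
    (c.symm z) hc hzD (hd.localKernel_re_pos hV hV' _ hzD hs hsz)
  -- A constant sequence again: the limit in the convergence statement for `halfIddbar` is smooth.
  have h1 : SmoothTendstoOn atTop (fun (_ : ℕ) w => Real.log
      (localKernel h α V (trivializationAt ℂ L (c.symm z)) c w w).re) _ U :=
    ⟨Eventually.of_forall fun _ => hsm, hsm, fun k x hx => ?_⟩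
  · refine ((h1.halfIddbar hUo).limit.contDiffAt (hUo.mem_nhds hzU)).congr_of_eventuallyEq ?_
    filter_upwards [hUo.mem_nhds hzU] with w hw
    exact hd.inChart_bergmanMetric hV hV' _ hc (hUD hw) (hUpos w hw)
  · have h2 := (hsm.continuousOn_iteratedFDerivWithin (m := k) (by exact_mod_cast le_top)
      hUo.uniqueDiffOn).continuousAt (hUo.mem_nhds hx)
    have h3 := h2.congr ((hUo.eventually_mem hx).mono fun y hy =>
      iteratedFDerivWithin_of_isOpen k hUo hy)
    exact h3.tendsto.comp tendsto_snd

end IsBergmanData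

end Metric

end BergmanTower

namespace BergmanTower

/-! ### Linear algebra of real `(1,1)`-forms. -/

section Hermitian

variable {n : ℕ}

/-- The real two-form `η` on `ℂⁿ` is of type `(1,1)`. -/
def IsOneOne (η : (Fin n → ℂ) [⋀^Fin 2]→L[ℝ] ℝ) : Prop :=
  ∀ v w, η ![Complex.I • v, Complex.I • w] = η ![v, w]

theorem form_add_left (η : (Fin n → ℂ) [⋀^Fin 2]→L[ℝ] ℝ) (v v' w : Fin n → ℂ) :
    η ![v + v', w] = η ![v, w] + η ![v', w] :=
  η.toAlternatingMap.map_vecCons_add ![w] v v'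

theorem form_smul_left (η : (Fin n → ℂ) [⋀^Fin 2]→L[ℝ] ℝ) (a : ℝ) (v w : Fin n → ℂ) :
    η ![a • v, w] = a * η ![v, w] :=
  η.toAlternatingMap.map_vecCons_smul ![w] a v

theorem form_swap (η : (Fin n → ℂ) [⋀^Fin 2]→L[ℝ] ℝ) (v w : Fin n → ℂ) :
    η ![v, w] = -η ![w, v] := by
  have h1 := η.toAlternatingMap.map_swap ![w, v] (i := 0) (j := 1) (by simp)
  rw [← show (![w, v] : Fin 2 → Fin n → ℂ) ∘ Equiv.swap (0 : Fin 2) 1 = ![v, w] by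
    ext i; fin_cases i <;> rfl]
  exact h1

theorem form_complex_smul_left (η : (Fin n → ℂ) [⋀^Fin 2]→L[ℝ] ℝ) (a : ℂ) (v w : Fin n → ℂ) :
    η ![a • v, w] = a.re * η ![v, w] + a.im * η ![Complex.I • v, w] := by
  have h1 : a • v = a.re • v + a.im • (Complex.I • v) := by
    conv_lhs => rw [← Complex.re_add_im a]
    rw [add_smul, mul_smul]
    rfl
  rw [h1, form_add_left, form_smul_left, form_smul_left]

namespace IsOneOne

variable {η : (Fin n → ℂ) [⋀^Fin 2]→L[ℝ] ℝ}

theorem I_smul_left (hη : IsOneOne η) (v w : Fin n → ℂ) :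
    η ![Complex.I • v, w] = -η ![v, Complex.I • w] := by
  have h1 := hη (Complex.I • v) w
  rw [smul_smul, Complex.I_mul_I, show ((-1 : ℂ) • v) = (-1 : ℝ) • v by simp,
    form_smul_left] at h1
  linarith

/-- The Hermitian form `(v, w) ↦ η(v, i w) - i η(v, w)`. -/
def hermitianForm (hη : IsOneOne η) : (Fin n → ℂ) →ₗ[ℂ] (Fin n → ℂ) →ₗ⋆[ℂ] ℂ :=
  have hsymm : ∀ v w : Fin n → ℂ, ((η ![v, Complex.I • w] : ℂ) - Complex.I * η ![v, w]) =
      conj ((η ![w, Complex.I • v] : ℂ) - Complex.I * η ![w, v]) := fun v w => by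
    rw [form_swap η v (Complex.I • w), hη.I_smul_left w v, form_swap η v w]
    simp
  have hadd : ∀ v v' w : Fin n → ℂ,
      ((η ![v + v', Complex.I • w] : ℂ) - Complex.I * η ![v + v', w]) =
      ((η ![v, Complex.I • w] : ℂ) - Complex.I * η ![v, w]) +
        ((η ![v', Complex.I • w] : ℂ) - Complex.I * η ![v', w]) := fun v v' w => by
    rw [form_add_left, form_add_left]
    push_cast
    ring
  have hsmul : ∀ (a : ℂ) (v w : Fin n → ℂ),
      ((η ![a • v, Complex.I • w] : ℂ) - Complex.I * η ![a • v, w]) =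
      a * ((η ![v, Complex.I • w] : ℂ) - Complex.I * η ![v, w]) := fun a v w => by
    rw [form_complex_smul_left η a v, form_complex_smul_left η a v, hη v w, hη.I_smul_left v w]
    conv_rhs => rw [← Complex.re_add_im a]
    push_cast
    linear_combination (a.im : ℂ) * (η ![v, w] : ℂ) * Complex.I_mul_I
  LinearMap.mk₂'ₛₗ (RingHom.id ℂ) (starRingEnd ℂ)
    (fun v w => (η ![v, Complex.I • w] : ℂ) - Complex.I * η ![v, w]) hadd hsmul
    (fun v w w' => by rw [hsymm v (w + w'), hadd, map_add, ← hsymm, ← hsymm])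
    (fun a v w => by rw [hsymm v (a • w), hsmul, map_mul, ← hsymm]; rfl)

theorem hermitianForm_apply (hη : IsOneOne η) (v w : Fin n → ℂ) :
    hη.hermitianForm v w = (η ![v, Complex.I • w] : ℂ) - Complex.I * η ![v, w] := rfl

theorem conj_hermitianForm (hη : IsOneOne η) (v w : Fin n → ℂ) :
    conj (hη.hermitianForm v w) = hη.hermitianForm w v := by
  rw [hermitianForm_apply, hermitianForm_apply, form_swap η w (Complex.I • v),
    hη.I_smul_left v w, form_swap η w v]
  simp

theorem hermitianMatrix_apply (hη : IsOneOne η) (a b : Fin n) :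
    hermitianMatrix η a b = hη.hermitianForm (Pi.single a 1) (Pi.single b 1) := by
  rw [hermitianForm_apply, ← Pi.single_smul, smul_eq_mul, mul_one]
  rfl

theorem hermitianForm_eq_sum (hη : IsOneOne η) (v w : Fin n → ℂ) :
    hη.hermitianForm v w = ∑ a, ∑ b, v a * hermitianMatrix η a b * conj (w b) := by
  have h1 : ∀ v : Fin n → ℂ, v = ∑ a, v a • (Pi.single a 1 : Fin n → ℂ) := fun v => by
    simpa using (pi_eq_sum_univ' v)
  conv_lhs => rw [h1 v, h1 w]
  simp only [map_sum, LinearMap.sum_apply, LinearMap.smul_apply,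
    LinearMap.map_smulₛₗ, smul_eq_mul, ← hη.hermitianMatrix_apply, Finset.mul_sum,
    RingHom.id_apply]
  rw [Finset.sum_comm]
  refine Finset.sum_congr rfl fun a _ => Finset.sum_congr rfl fun b _ => ?_
  ring

theorem comp (hη : IsOneOne η) (A : (Fin n → ℂ) →L[ℂ] (Fin n → ℂ)) :
    IsOneOne (η.compContinuousLinearMap (A.restrictScalars ℝ)) := by
  intro v w
  have h1 : ∀ v w : Fin n → ℂ, η.compContinuousLinearMap (A.restrictScalars ℝ) ![v, w] =
      η ![A v, A w] := fun v w => by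
    rw [ContinuousAlternatingMap.compContinuousLinearMap_apply]
    congr 1
    ext i; fin_cases i <;> rfl
  rw [h1, h1, map_smul, map_smul, hη]

theorem hermitianMatrix_comp (hη : IsOneOne η) (A : (Fin n → ℂ) →L[ℂ] (Fin n → ℂ)) :
    hermitianMatrix (η.compContinuousLinearMap (A.restrictScalars ℝ)) =
      (LinearMap.toMatrix' (A : (Fin n → ℂ) →ₗ[ℂ] (Fin n → ℂ))).transpose * hermitianMatrix η *
        (LinearMap.toMatrix' (A : (Fin n → ℂ) →ₗ[ℂ] (Fin n → ℂ))).map conj := by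
  have h1 : ∀ v w : Fin n → ℂ, η.compContinuousLinearMap (A.restrictScalars ℝ) ![v, w] =
      η ![A v, A w] := fun v w => by
    rw [ContinuousAlternatingMap.compContinuousLinearMap_apply]
    congr 1
    ext i; fin_cases i <;> rfl
  ext a b
  rw [(hη.comp A).hermitianMatrix_apply, hermitianForm_apply, h1, h1, map_smul,
    ← hη.hermitianForm_apply, hermitianForm_eq_sum, Matrix.mul_apply, Finset.sum_comm]
  refine Finset.sum_congr rfl fun d _ => ?_
  rw [Matrix.mul_apply, Finset.sum_mul]
  rfl

/-- The matrix becomes `Aᵀ H conj(A)`, and `|det A|²` is the real Jacobian of a complex linear map.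
Thus the density of the volume obeys the change of variables formula. -/
theorem det_hermitianMatrix_comp (hη : IsOneOne η) (A : (Fin n → ℂ) →L[ℂ] (Fin n → ℂ)) :
    (hermitianMatrix (η.compContinuousLinearMap (A.restrictScalars ℝ))).det.re =
      |(A.restrictScalars ℝ).det| * (hermitianMatrix η).det.re := by
  have h1 : (A.restrictScalars ℝ).det = Complex.normSq
      (LinearMap.toMatrix' (A : (Fin n → ℂ) →ₗ[ℂ] (Fin n → ℂ))).det := by
    have := LinearMap.det_restrictScalars (R := ℝ)
      (f := (A : (Fin n → ℂ) →ₗ[ℂ] (Fin n → ℂ)))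
    rw [Algebra.norm_complex_eq, ← LinearMap.det_toMatrix'] at this
    exact this
  have h2 : ((LinearMap.toMatrix' (A : (Fin n → ℂ) →ₗ[ℂ] (Fin n → ℂ))).map conj).det =
      conj (LinearMap.toMatrix' (A : (Fin n → ℂ) →ₗ[ℂ] (Fin n → ℂ))).det :=
    ((starRingEnd ℂ).map_det _).symm
  rw [h1, abs_of_nonneg (Complex.normSq_nonneg _), hη.hermitianMatrix_comp, Matrix.det_mul,
    Matrix.det_mul, Matrix.det_transpose, h2, mul_right_comm, Complex.mul_conj,
    Complex.re_ofReal_mul]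

open scoped ComplexOrder in
theorem det_hermitianMatrix_pos (hη : IsOneOne η)
    (hpos : ∀ v, v ≠ 0 → 0 < η ![v, Complex.I • v]) : 0 < (hermitianMatrix η).det.re := by
  have hself : ∀ v, hη.hermitianForm v v = (η ![v, Complex.I • v] : ℂ) := fun v => by
    have h1 := form_swap η v v
    have h2 : η ![v, v] = 0 := by linarith
    rw [hermitianForm_apply, h2]
    simp
  have hpd : (hermitianMatrix η).PosDef := by
    refine Matrix.PosDef.of_dotProduct_mulVec_pos ?_ fun x hx => ?_
    · ext a b
      rw [Matrix.conjTranspose_apply, hη.hermitianMatrix_apply, hη.hermitianMatrix_apply]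
      exact hη.conj_hermitianForm _ _
    · have hx' : (star x) ≠ 0 := fun h0 => hx (by simpa using congrArg star h0)
      -- The vector is conjugated because the Hermitian form is linear in its first argument, while
      -- the quadratic form of a matrix conjugates that one.
      have h1 : star x ⬝ᵥ (hermitianMatrix η).mulVec x = hη.hermitianForm (star x) (star x) := by
        rw [hermitianForm_eq_sum]
        simp only [dotProduct, Matrix.mulVec, Finset.mul_sum]
        refine Finset.sum_congr rfl fun a _ => Finset.sum_congr rfl fun b _ => ?_
        simp [mul_assoc]
      rw [h1, hself]
      exact_mod_cast hpos _ hx'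
  exact (Complex.lt_def.1 hpd.det_pos).1

end IsOneOne

theorem continuous_det_hermitianMatrix :
    Continuous fun η : (Fin n → ℂ) [⋀^Fin 2]→L[ℝ] ℝ => (hermitianMatrix η).det.re := by
  refine Complex.continuous_re.comp (Continuous.matrix_det ?_)
  refine continuous_matrix fun a b => ?_
  have h1 : ∀ v : Fin 2 → Fin n → ℂ,
      Continuous fun η : (Fin n → ℂ) [⋀^Fin 2]→L[ℝ] ℝ => (η v : ℂ) := fun v =>
    Complex.continuous_ofReal.comp
      (ContinuousAlternatingMap.apply ℝ (Fin n → ℂ) ℝ v).continuous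
  exact (h1 _).sub ((h1 _).const_mul _)

end Hermitian

/-! ### Change of charts for forms, and comparison of the volume with arbitrary charts. -/

section Volume

variable {n : ℕ} {X : Type*} [TopologicalSpace X] [ChartedSpace (Fin n → ℂ) X]

theorem TwoForm.compContinuousLinearMap_congr (α : TwoForm n X) {x y : X} (hxy : x = y)
    {A B : (Fin n → ℂ) →L[ℂ] (Fin n → ℂ)} (hAB : A = B) :
    (α x : (Fin n → ℂ) [⋀^Fin 2]→L[ℝ] ℝ).compContinuousLinearMap (A.restrictScalars ℝ) =
      (α y : (Fin n → ℂ) [⋀^Fin 2]→L[ℝ] ℝ).compContinuousLinearMap (B.restrictScalars ℝ) := by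
  subst hxy hAB
  rfl

theorem isOneOne_inChart {α : TwoForm n X}
    (hα : ∀ (x : X) (v w : TangentSpace 𝓘(ℂ, Fin n → ℂ) x),
      α x ![Complex.I • v, Complex.I • w] = α x ![v, w])
    (c : OpenPartialHomeomorph X (Fin n → ℂ)) (z : Fin n → ℂ) : IsOneOne (α.inChart c z) :=
  IsOneOne.comp (η := (α (c.symm z) : (Fin n → ℂ) [⋀^Fin 2]→L[ℝ] ℝ))
    (fun v w => hα (c.symm z) v w) _

variable [IsManifold 𝓘(ℂ, Fin n → ℂ) ω X]

theorem mdifferentiableAt_chart {c : OpenPartialHomeomorph X (Fin n → ℂ)}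
    (hc : c ∈ IsManifold.maximalAtlas 𝓘(ℂ, Fin n → ℂ) ω X) {x : X} (hx : x ∈ c.source) :
    MDifferentiableAt 𝓘(ℂ, Fin n → ℂ) 𝓘(ℂ, Fin n → ℂ) c x :=
  ((contMDiffOn_of_mem_maximalAtlas hc).contMDiffAt
    (c.open_source.mem_nhds hx)).mdifferentiableAt (by simp)

theorem mdifferentiableAt_chart_symm {c : OpenPartialHomeomorph X (Fin n → ℂ)}
    (hc : c ∈ IsManifold.maximalAtlas 𝓘(ℂ, Fin n → ℂ) ω X) {z : Fin n → ℂ} (hz : z ∈ c.target) :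
    MDifferentiableAt 𝓘(ℂ, Fin n → ℂ) 𝓘(ℂ, Fin n → ℂ) c.symm z :=
  ((contMDiffOn_symm_of_mem_maximalAtlas hc).contMDiffAt
    (c.open_target.mem_nhds hz)).mdifferentiableAt (by simp)

theorem inChart_eq_comp (α : TwoForm n X) {c c' : OpenPartialHomeomorph X (Fin n → ℂ)}
    (hc : c ∈ IsManifold.maximalAtlas 𝓘(ℂ, Fin n → ℂ) ω X)
    (hc' : c' ∈ IsManifold.maximalAtlas 𝓘(ℂ, Fin n → ℂ) ω X) {z : Fin n → ℂ} (hz : z ∈ c.target)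
    (hz' : c.symm z ∈ c'.source) :
    α.inChart c z = (α.inChart c' (c' (c.symm z))).compContinuousLinearMap
      ((fderiv ℂ (fun w => c' (c.symm w)) z).restrictScalars ℝ) := by
  have hd : DifferentiableAt ℂ (fun w => c' (c.symm w)) z :=
    differentiableAt_comp_symm hc hz (mdifferentiableAt_chart hc' hz')
  have hev : (fun w => c'.symm (c' (c.symm w))) =ᶠ[𝓝 z] c.symm := by
    filter_upwards [(c.continuousAt_symm hz).eventually (c'.open_source.mem_nhds hz')] with w hw
    exact c'.left_inv hw
  have h1 : mfderiv 𝓘(ℂ, Fin n → ℂ) 𝓘(ℂ, Fin n → ℂ) c.symm z =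
      ((mfderiv 𝓘(ℂ, Fin n → ℂ) 𝓘(ℂ, Fin n → ℂ) c'.symm (c' (c.symm z)) :
        (Fin n → ℂ) →L[ℂ] (Fin n → ℂ)).comp (fderiv ℂ (fun w => c' (c.symm w)) z) :) := by
    refine hev.symm.mfderiv_eq.trans ?_
    refine (mfderiv_comp z (mdifferentiableAt_chart_symm hc' (c'.map_source hz'))
      (mdifferentiableAt_iff_differentiableAt.2 hd)).trans ?_
    rw [mfderiv_eq_fderiv]
    rfl
  exact (TwoForm.compContinuousLinearMap_congr α (c'.left_inv hz').symm h1).trans rfl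

theorem inChart_comp_mfderiv (α : TwoForm n X) {c : OpenPartialHomeomorph X (Fin n → ℂ)}
    (hc : c ∈ IsManifold.maximalAtlas 𝓘(ℂ, Fin n → ℂ) ω X) {x : X} (hx : x ∈ c.source) :
    (α.inChart c (c x)).compContinuousLinearMap
      ((mfderiv 𝓘(ℂ, Fin n → ℂ) 𝓘(ℂ, Fin n → ℂ) c x).restrictScalars ℝ) = α x := by
  have hev : (fun y => c.symm (c y)) =ᶠ[𝓝 x] id := by
    filter_upwards [c.open_source.mem_nhds hx] with y hy using c.left_inv hy
  have h1 : ((mfderiv 𝓘(ℂ, Fin n → ℂ) 𝓘(ℂ, Fin n → ℂ) c.symm (c x) :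
        (Fin n → ℂ) →L[ℂ] (Fin n → ℂ)).comp
        (mfderiv 𝓘(ℂ, Fin n → ℂ) 𝓘(ℂ, Fin n → ℂ) c x :) :
          (Fin n → ℂ) →L[ℂ] (Fin n → ℂ)) = ContinuousLinearMap.id ℂ (Fin n → ℂ) := by
    refine (mfderiv_comp x (mdifferentiableAt_chart_symm hc (c.map_source hx))
      (mdifferentiableAt_chart hc hx)).symm.trans ?_
    exact hev.mfderiv_eq.trans mfderiv_id
  exact (TwoForm.compContinuousLinearMap_congr α (c.left_inv hx) h1).trans rfl

theorem measurableSet_target_inter_preimage {X : Type*} [TopologicalSpace X]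
    (c : OpenPartialHomeomorph X (Fin n → ℂ)) {A : Set X} (hA : MeasurableSet[borel X] A) :
    MeasurableSet (c.target ∩ c.symm ⁻¹' A) := by
  let _ : MeasurableSpace X := borel X
  have : BorelSpace X := ⟨rfl⟩
  have h1 : MeasurableSet (Subtype.val '' (c.target.domRestrict c.symm ⁻¹' A)) :=
    c.open_target.measurableSet.subtype_image
      ((continuousOn_iff_continuous_domRestrict.1 c.continuousOn_symm).measurable hA)
  convert h1 using 1
  ext z
  simp [Set.domRestrict, and_comm]

theorem map_symm_withDensity_apply {X : Type*} [TopologicalSpace X]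
    (c : OpenPartialHomeomorph X (Fin n → ℂ)) (ρ : (Fin n → ℂ) → ENNReal) {A : Set X}
    (hA : MeasurableSet[borel X] A) :
    letI : MeasurableSpace X := borel X
    Measure.map c.symm (((volume : Measure (Fin n → ℂ)).restrict c.target).withDensity ρ) A =
      ∫⁻ z in c.target ∩ c.symm ⁻¹' A, ρ z := by
  let _ : MeasurableSpace X := borel X
  have : BorelSpace X := ⟨rfl⟩
  have hsymm : AEMeasurable c.symm
      ((volume : Measure (Fin n → ℂ)).restrict c.target) :=
    c.continuousOn_symm.aemeasurable c.open_target.measurableSet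
  show Measure.map c.symm _ A = _
  rw [Measure.map_apply_of_aemeasurable (hsymm.mono_ac (withDensity_absolutelyContinuous _ _)) hA,
    ← restrict_withDensity c.open_target.measurableSet,
    Measure.restrict_apply' c.open_target.measurableSet, inter_comm,
    withDensity_apply _ (measurableSet_target_inter_preimage c hA)]

/-- Every holomorphic chart contributes at most the volume. -/
theorem map_chart_symm_le_volume {α : TwoForm n X}
    (hα : ∀ (x : X) (v w : TangentSpace 𝓘(ℂ, Fin n → ℂ) x),
      α x ![Complex.I • v, Complex.I • w] = α x ![v, w])
    {c : OpenPartialHomeomorph X (Fin n → ℂ)}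
    (hc : c ∈ IsManifold.maximalAtlas 𝓘(ℂ, Fin n → ℂ) ω X) :
    letI : MeasurableSpace X := borel X
    Measure.map c.symm (((volume : Measure (Fin n → ℂ)).restrict c.target).withDensity
      fun z => ENNReal.ofReal (α.density c z)) ≤ α.volume := by
  let _ : MeasurableSpace X := borel X
  have : BorelSpace X := ⟨rfl⟩
  -- Inside the domain of one preferred chart the bound is the change of variables formula for the
  -- transition map.
  have hlocal : ∀ (x : X) (A : Set X), MeasurableSet A → A ⊆ (chartAt (Fin n → ℂ) x).source →
      ∫⁻ z in c.target ∩ c.symm ⁻¹' A, ENNReal.ofReal (α.density c z) ≤ α.volume A := by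
    intro x A hA hAx
    set c' := chartAt (Fin n → ℂ) x with hc'
    have hc'm : c' ∈ IsManifold.maximalAtlas 𝓘(ℂ, Fin n → ℂ) ω X :=
      IsManifold.chart_mem_maximalAtlas x
    set S := c.target ∩ c.symm ⁻¹' A with hS
    set φ : (Fin n → ℂ) → Fin n → ℂ := fun w => c' (c.symm w) with hφ
    have hSmeas : MeasurableSet S := measurableSet_target_inter_preimage c hA
    have hle : Measure.map c'.symm (((volume : Measure (Fin n → ℂ)).restrict
        c'.target).withDensity fun z => ENNReal.ofReal (α.density c' z)) A ≤ α.volume A :=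
      Measure.le_iff.1 (le_iSup (fun x : X => Measure.map (chartAt (Fin n → ℂ) x).symm
        (((volume : Measure (Fin n → ℂ)).restrict
          (chartAt (Fin n → ℂ) x).target).withDensity
            fun z => ENNReal.ofReal (α.density (chartAt (Fin n → ℂ) x) z))) x) A hA
    refine le_trans ?_ hle
    rw [map_symm_withDensity_apply c' _ hA]
    have hinj : InjOn φ S := fun z hz w hw hzw =>
      c.symm.injOn hz.1 hw.1 (c'.injOn (hAx hz.2) (hAx hw.2) hzw)
    have hder : ∀ z ∈ S, HasFDerivWithinAt φ ((fderiv ℂ φ z).restrictScalars ℝ) S z :=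
      fun z hz => ((differentiableAt_comp_symm hc hz.1 (mdifferentiableAt_chart hc'm
        (hAx hz.2))).hasFDerivAt.restrictScalars ℝ).hasFDerivWithinAt
    have himage : φ '' S ⊆ c'.target ∩ c'.symm ⁻¹' A := by
      rintro _ ⟨z, hz, rfl⟩
      refine ⟨c'.map_source (hAx hz.2), ?_⟩
      rw [mem_preimage, hφ, c'.left_inv (hAx hz.2)]
      exact hz.2
    refine le_trans (le_of_eq ?_) (lintegral_mono_set himage)
    rw [lintegral_image_eq_lintegral_abs_det_fderiv_mul volume hSmeas hder hinj]
    refine setLIntegral_congr_fun hSmeas fun z hz => ?_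
    rw [← ENNReal.ofReal_mul (abs_nonneg _), TwoForm.density,
      inChart_eq_comp α hc hc'm hz.1 (hAx hz.2),
      (isOneOne_inChart hα c' _).det_hermitianMatrix_comp]
    rfl
  show Measure.map c.symm _ ≤ α.volume
  refine Measure.le_iff.2 fun A hA => ?_
  rw [map_symm_withDensity_apply c _ hA]
  -- The target of `c` lies in `ℂⁿ`, so it is Lindelöf and countably many preferred charts cover it.
  -- Making them disjoint lets the local bounds be added.
  obtain ⟨T, hT, hTU⟩ := TopologicalSpace.isOpen_iUnion_countable
    (fun x : X => c.target ∩ c.symm ⁻¹' (chartAt (Fin n → ℂ) x).source)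
    (fun x => c.isOpen_inter_preimage_symm (chartAt (Fin n → ℂ) x).open_source)
  have hcover : ∀ z ∈ c.target, ∃ x ∈ T, c.symm z ∈ (chartAt (Fin n → ℂ) x).source := by
    intro z hz
    have h1 : z ∈ ⋃ x ∈ T, c.target ∩ c.symm ⁻¹' (chartAt (Fin n → ℂ) x).source := by
      rw [hTU]
      exact mem_iUnion.2 ⟨c.symm z, hz, mem_chart_source _ _⟩
    obtain ⟨x, hx⟩ := mem_iUnion.1 h1
    obtain ⟨hxT, hx⟩ := mem_iUnion.1 hx
    exact ⟨x, hxT, hx.2⟩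
  rcases T.eq_empty_or_nonempty with rfl | hne
  · have h1 : c.target ∩ c.symm ⁻¹' A = ∅ := by
      refine eq_empty_of_forall_notMem fun z hz => ?_
      obtain ⟨x, hx, -⟩ := hcover z hz.1
      exact hx
    rw [h1]
    simp
  obtain ⟨t, rfl⟩ := hT.exists_eq_range hne
  set B : ℕ → Set X := disjointed fun k => (chartAt (Fin n → ℂ) (t k)).source with hB
  have hBm : ∀ k, MeasurableSet (B k) := fun k =>
    MeasurableSet.disjointed (fun k => (chartAt (Fin n → ℂ) (t k)).open_source.measurableSet) k
  have hBs : ∀ k, B k ⊆ (chartAt (Fin n → ℂ) (t k)).source := fun k => disjointed_subset _ k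
  have hU : c.target ∩ c.symm ⁻¹' A = ⋃ k, c.target ∩ c.symm ⁻¹' (A ∩ B k) := by
    ext z
    constructor
    · intro hz
      obtain ⟨x, ⟨k, rfl⟩, hx⟩ := hcover z hz.1
      have h1 : c.symm z ∈ ⋃ k, B k := by
        rw [hB, iUnion_disjointed]
        exact mem_iUnion.2 ⟨k, hx⟩
      obtain ⟨m, hm⟩ := mem_iUnion.1 h1
      exact mem_iUnion.2 ⟨m, hz.1, hz.2, hm⟩
    · intro hz
      obtain ⟨k, hk⟩ := mem_iUnion.1 hz
      exact ⟨hk.1, hk.2.1⟩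
  rw [hU]
  calc _ ≤ ∑' k, ∫⁻ z in c.target ∩ c.symm ⁻¹' (A ∩ B k), ENNReal.ofReal (α.density c z) :=
        lintegral_iUnion_le _ _
    _ ≤ ∑' k, α.volume (A ∩ B k) := ENNReal.tsum_le_tsum fun k =>
        hlocal (t k) _ (hA.inter (hBm k)) (inter_subset_right.trans (hBs k))
    _ = α.volume (⋃ k, A ∩ B k) := by
        refine (measure_iUnion (fun i j hij => ?_) fun k => hA.inter (hBm k)).symm
        exact (disjoint_disjointed _ hij).mono inter_subset_right inter_subset_right
    _ ≤ α.volume A := measure_mono (iUnion_subset fun k => inter_subset_left)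

end Volume

end BergmanTower

/-! ### The complex structure pulled back by a local homeomorphism. -/

namespace BergmanTower

variable {n : ℕ} {X M : Type*} [TopologicalSpace X] [TopologicalSpace M]
  [ChartedSpace (Fin n → ℂ) X] [ChartedSpace (Fin n → ℂ) M]

/-- The charts of `X` are compositions of local restrictions of `f` with charts of `M`. -/
structure IsAtlasPullback (f : X → M) : Prop where
  exists_chartAt : ∀ x, ∃ e : OpenPartialHomeomorph X M, f = e ∧ x ∈ e.source ∧
    chartAt (Fin n → ℂ) x = e.trans (chartAt (Fin n → ℂ) (f x))
  exists_mem_atlas : ∀ c ∈ atlas (Fin n → ℂ) X, ∃ e : OpenPartialHomeomorph X M, f = e ∧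
    ∃ c' ∈ atlas (Fin n → ℂ) M, c = e.trans c'

theorem isAtlasPullback_pullbackChartedSpace {X : Type*} [TopologicalSpace X] {f : X → M}
    (hf : IsLocalHomeomorph f) :
    letI := pullbackChartedSpace (H := Fin n → ℂ) f hf
    IsAtlasPullback (n := n) f := by
  let _ := pullbackChartedSpace (H := Fin n → ℂ) f hf
  exact ⟨fun x => ⟨(hf x).choose, (hf x).choose_spec.2, (hf x).choose_spec.1, rfl⟩,
    fun c hc => hc⟩

/-- Both local inverses of `f` cancel against `f`, so the transition map is a restriction of the
transition map on `M`. -/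
theorem trans_symm_trans_mem_contDiffGroupoid {X : Type*} [TopologicalSpace X] {f : X → M}
    {e₁ e₂ : OpenPartialHomeomorph X M} (h₁ : f = e₁) (h₂ : f = e₂)
    {c₁ c₂ : OpenPartialHomeomorph M (Fin n → ℂ)}
    (hc₁ : c₁ ∈ IsManifold.maximalAtlas 𝓘(ℂ, Fin n → ℂ) ω M)
    (hc₂ : c₂ ∈ IsManifold.maximalAtlas 𝓘(ℂ, Fin n → ℂ) ω M) :
    (e₁.trans c₁).symm.trans (e₂.trans c₂) ∈ contDiffGroupoid ω 𝓘(ℂ, Fin n → ℂ) := by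
  have h0 : c₁.symm.trans c₂ ∈ contDiffGroupoid ω 𝓘(ℂ, Fin n → ℂ) :=
    StructureGroupoid.compatible_of_mem_maximalAtlas hc₁ hc₂
  set S := ((e₁.trans c₁).symm.trans (e₂.trans c₂)).source with hS
  have hSo : IsOpen S := ((e₁.trans c₁).symm.trans (e₂.trans c₂)).open_source
  have hval : ∀ w ∈ S, e₂ (e₁.symm (c₁.symm w)) = c₁.symm w := by
    intro w hw
    rw [← h₂, h₁]
    refine e₁.right_inv ?_
    simp only [hS, mfld_simps] at hw
    exact hw.1.2
  refine StructureGroupoid.mem_of_eqOnSource _ (closedUnderRestriction' h0 hSo) ⟨?_, ?_⟩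
  · change S = (c₁.symm.trans c₂).source ∩ interior S
    rw [hSo.interior_eq, eq_comm, inter_eq_right]
    intro w hw
    have h1 := hval w hw
    simp only [hS, mfld_simps] at hw
    simp only [mfld_simps]
    refine ⟨hw.1.1, ?_⟩
    rw [← h1]
    exact hw.2.2
  · intro w hw
    exact congrArg c₂ (hval w hw)

namespace IsAtlasPullback

variable {f : X → M} [IsManifold 𝓘(ℂ, Fin n → ℂ) ω M]

theorem isManifold (hf : IsAtlasPullback (n := n) f) : IsManifold 𝓘(ℂ, Fin n → ℂ) ω X where
  compatible := by
    intro c c' hc hc'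
    obtain ⟨e, he, d, hd, rfl⟩ := hf.exists_mem_atlas c hc
    obtain ⟨e', he', d', hd', rfl⟩ := hf.exists_mem_atlas c' hc'
    exact trans_symm_trans_mem_contDiffGroupoid he he'
      (IsManifold.subset_maximalAtlas hd) (IsManifold.subset_maximalAtlas hd')

theorem trans_mem_maximalAtlas (hf : IsAtlasPullback (n := n) f)
    {e : OpenPartialHomeomorph X M} (he : f = e) {c : OpenPartialHomeomorph M (Fin n → ℂ)}
    (hc : c ∈ IsManifold.maximalAtlas 𝓘(ℂ, Fin n → ℂ) ω M) :
    e.trans c ∈ IsManifold.maximalAtlas 𝓘(ℂ, Fin n → ℂ) ω X := by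
  refine mem_maximalAtlas_iff.2 fun c' hc' => ?_
  obtain ⟨e', he', d', hd', rfl⟩ := hf.exists_mem_atlas c' hc'
  exact ⟨trans_symm_trans_mem_contDiffGroupoid he he' hc (IsManifold.subset_maximalAtlas hd'),
    trans_symm_trans_mem_contDiffGroupoid he' he (IsManifold.subset_maximalAtlas hd') hc⟩

theorem contMDiff (hf : IsAtlasPullback (n := n) f) :
    ContMDiff 𝓘(ℂ, Fin n → ℂ) 𝓘(ℂ, Fin n → ℂ) ω f := by
  have := hf.isManifold
  intro x
  obtain ⟨e, he, hxe, hx⟩ := hf.exists_chartAt x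
  set c := chartAt (Fin n → ℂ) (f x) with hc
  have hcm : c ∈ IsManifold.maximalAtlas 𝓘(ℂ, Fin n → ℂ) ω M :=
    IsManifold.chart_mem_maximalAtlas (f x)
  have hfx : f x ∈ c.source := mem_chart_source _ _
  have hxs : x ∈ (e.trans c).source := by
    rw [OpenPartialHomeomorph.trans_source, ← he]
    exact ⟨hxe, hfx⟩
  have hev : f =ᶠ[𝓝 x] c.symm ∘ (e.trans c) := by
    filter_upwards [(e.trans c).open_source.mem_nhds hxs] with y hy
    have h1 : e y ∈ c.source := hy.2
    simp only [Function.comp_apply, OpenPartialHomeomorph.coe_trans, c.left_inv h1, he]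
  refine ContMDiffAt.congr_of_eventuallyEq ?_ hev
  refine ContMDiffAt.comp x ?_ ((contMDiffOn_of_mem_maximalAtlas
    (hf.trans_mem_maximalAtlas he hcm)).contMDiffAt ((e.trans c).open_source.mem_nhds hxs))
  refine (contMDiffOn_symm_of_mem_maximalAtlas hcm).contMDiffAt (c.open_target.mem_nhds ?_)
  exact c.map_source hxs.2

theorem mdifferentiable (hf : IsAtlasPullback (n := n) f) :
    MDifferentiable 𝓘(ℂ, Fin n → ℂ) 𝓘(ℂ, Fin n → ℂ) f :=
  hf.contMDiff.mdifferentiable (by simp)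

/-- Automorphisms of `X` over `M` are holomorphic. -/
theorem mdifferentiable_of_comp_eq (hf : IsAtlasPullback (n := n) f) {g : X → X}
    (hg : Continuous g) (hfg : ∀ x, f (g x) = f x) :
    MDifferentiable 𝓘(ℂ, Fin n → ℂ) 𝓘(ℂ, Fin n → ℂ) g := by
  have := hf.isManifold
  intro x
  obtain ⟨e, he, hxe, hx⟩ := hf.exists_chartAt (g x)
  set c := chartAt (Fin n → ℂ) (f (g x)) with hc
  have hcm : c ∈ IsManifold.maximalAtlas 𝓘(ℂ, Fin n → ℂ) ω M :=
    IsManifold.chart_mem_maximalAtlas _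
  have hfx : f (g x) ∈ c.source := mem_chart_source _ _
  have hxs : g x ∈ (e.trans c).source := by
    rw [OpenPartialHomeomorph.trans_source, ← he]
    exact ⟨hxe, hfx⟩
  -- Over `M` an automorphism is locally a branch of the inverse of `f` after `f`.
  have hev : g =ᶠ[𝓝 x] (e.trans c).symm ∘ (c ∘ f) := by
    filter_upwards [hg.continuousAt.eventually ((e.trans c).open_source.mem_nhds hxs)] with y hy
    have h1 := (e.trans c).left_inv hy
    have h2 : (e.trans c) (g y) = c (f y) := by
      rw [OpenPartialHomeomorph.coe_trans, Function.comp_apply, ← he, hfg]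
    rw [h2] at h1
    exact h1.symm
  refine MDifferentiableAt.congr_of_eventuallyEq ?_ hev
  have h3 : c (f x) = (e.trans c) (g x) := by
    rw [OpenPartialHomeomorph.coe_trans, Function.comp_apply, ← he, hfg]
  refine MDifferentiableAt.comp x ?_ ((mdifferentiableAt_chart hcm (hfg x ▸ hfx)).comp x
    (hf.mdifferentiable x))
  refine mdifferentiableAt_chart_symm (hf.trans_mem_maximalAtlas he hcm) ?_
  rw [Function.comp_apply, h3]
  exact (e.trans c).map_source hxs

theorem map_trans_symm {X : Type*} [TopologicalSpace X] {f : X → M}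
    {e : OpenPartialHomeomorph X M} (he : f = e) {c : OpenPartialHomeomorph M (Fin n → ℂ)}
    {z : Fin n → ℂ} (hz : z ∈ (e.trans c).target) : f ((e.trans c).symm z) = c.symm z := by
  rw [he]
  rw [OpenPartialHomeomorph.trans_target] at hz
  exact e.right_inv hz.2

/-- Pullbacks of forms look like the original forms in the charts of the pulled back atlas. -/
theorem inChart_pullback (hf : IsAtlasPullback (n := n) f) (β : TwoForm n M)
    {e : OpenPartialHomeomorph X M} (he : f = e) {c : OpenPartialHomeomorph M (Fin n → ℂ)}
    (hc : c ∈ IsManifold.maximalAtlas 𝓘(ℂ, Fin n → ℂ) ω M) {z : Fin n → ℂ}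
    (hz : z ∈ (e.trans c).target) :
    (TwoForm.pullback f β).inChart (e.trans c) z = β.inChart c z := by
  have := hf.isManifold
  have hev : (fun w => f ((e.trans c).symm w)) =ᶠ[𝓝 z] c.symm := by
    filter_upwards [(e.trans c).open_target.mem_nhds hz] with w hw
    exact map_trans_symm he hw
  have h1 : ((mfderiv 𝓘(ℂ, Fin n → ℂ) 𝓘(ℂ, Fin n → ℂ) f ((e.trans c).symm z) :
      (Fin n → ℂ) →L[ℂ] (Fin n → ℂ)).comp
      (mfderiv 𝓘(ℂ, Fin n → ℂ) 𝓘(ℂ, Fin n → ℂ) (e.trans c).symm z :) :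
        (Fin n → ℂ) →L[ℂ] (Fin n → ℂ)) =
      mfderiv 𝓘(ℂ, Fin n → ℂ) 𝓘(ℂ, Fin n → ℂ) c.symm z := by
    refine (mfderiv_comp z (hf.mdifferentiable _) (mdifferentiableAt_chart_symm
      (hf.trans_mem_maximalAtlas he hc) hz)).symm.trans ?_
    exact hev.mfderiv_eq
  exact Eq.trans rfl (TwoForm.compContinuousLinearMap_congr β (map_trans_symm he hz) h1)

/-- A form on `X` whose expressions in the charts over a chart of `M` agree descends to `M`. -/
theorem exists_pullback_eq (hf : IsAtlasPullback (n := n) f) (hsurj : Function.Surjective f)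
    (μ : TwoForm n X)
    (hμ : ∀ c ∈ IsManifold.maximalAtlas 𝓘(ℂ, Fin n → ℂ) ω M, ∀ e e' : OpenPartialHomeomorph X M,
      f = e → f = e' → ∀ z ∈ (e.trans c).target, z ∈ (e'.trans c).target →
        μ.inChart (e.trans c) z = μ.inChart (e'.trans c) z) :
    ∃ Ω : TwoForm n M, TwoForm.pullback f Ω = μ := by
  have := hf.isManifold
  -- The value at `m` is read off at an arbitrary preimage; the agreement of chart expressions makes
  -- the choice irrelevant.
  choose σ hσ using hsurj
  choose e he hxe _ using hf.exists_chartAt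
  refine ⟨fun m => (μ.inChart ((e (σ m)).trans (chartAt (Fin n → ℂ) m))
    (chartAt (Fin n → ℂ) m m)).compContinuousLinearMap
      ((mfderiv 𝓘(ℂ, Fin n → ℂ) 𝓘(ℂ, Fin n → ℂ) (chartAt (Fin n → ℂ) m) m).restrictScalars ℝ),
    funext fun x => ?_⟩
  set c := chartAt (Fin n → ℂ) (f x) with hc
  have hcm : c ∈ IsManifold.maximalAtlas 𝓘(ℂ, Fin n → ℂ) ω M :=
    IsManifold.chart_mem_maximalAtlas _
  have hmem : ∀ y, f y = f x → c (f x) ∈ ((e y).trans c).target := by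
    intro y hy
    rw [OpenPartialHomeomorph.trans_target]
    have hs : f x ∈ c.source := mem_chart_source _ _
    refine ⟨c.map_source hs, ?_⟩
    rw [mem_preimage, c.left_inv hs, ← hy]
    conv => enter [2]; rw [he y]
    exact (e y).map_source (hxe y)
  have h1 := hμ c hcm _ _ (he (σ (f x))) (he x) _ (hmem _ (hσ (f x))) (hmem x rfl)
  have hxs : x ∈ ((e x).trans c).source := by
    rw [OpenPartialHomeomorph.trans_source, ← he]
    exact ⟨hxe x, mem_chart_source _ _⟩
  have h2 := inChart_comp_mfderiv μ (hf.trans_mem_maximalAtlas (he x) hcm) hxs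
  have h3 : ((e x).trans c : X → Fin n → ℂ) = c ∘ f := by
    rw [OpenPartialHomeomorph.coe_trans, ← he]
  have h4 : mfderiv 𝓘(ℂ, Fin n → ℂ) 𝓘(ℂ, Fin n → ℂ) ((e x).trans c) x =
      (mfderiv 𝓘(ℂ, Fin n → ℂ) 𝓘(ℂ, Fin n → ℂ) c (f x)).comp
        (mfderiv 𝓘(ℂ, Fin n → ℂ) 𝓘(ℂ, Fin n → ℂ) f x) := by
    rw [h3]
    exact mfderiv_comp x (mdifferentiableAt_chart hcm (mem_chart_source _ _))
      (hf.mdifferentiable x)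
  rw [← h2]
  change ((μ.inChart ((e (σ (f x))).trans c) (c (f x))).compContinuousLinearMap _).compContinuousLinearMap _ = _
  rw [h1, h4, h3]
  rfl

end IsAtlasPullback

/-! ### Pulled back line bundles, metrics and densities. -/

section Bundle

variable {E : M → Type*} [∀ x, AddCommGroup (E x)] [∀ x, Module ℂ (E x)]
  [TopologicalSpace (TotalSpace ℂ E)] [∀ x, TopologicalSpace (E x)] [FiberBundle ℂ E]
  [VectorBundle ℂ ℂ E] {f : C(X, M)}

instance instAddCommGroupPullback {X M : Type*} {E : M → Type*} [∀ x, AddCommGroup (E x)]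
    (f : X → M) (x : X) : AddCommGroup ((f *ᵖ E) x) :=
  inferInstanceAs (AddCommGroup (E (f x)))

theorem pullback_symm_apply (e : Trivialization ℂ (TotalSpace.proj : TotalSpace ℂ E → M))
    {x : X} (hx : f x ∈ e.baseSet) (a : ℂ) : (e.pullback f).symm x a = e.symm (f x) a := by
  have h1 : (e.pullback f) (TotalSpace.mk' ℂ x ((e.pullback f).symm x a)) = (x, a) :=
    (e.pullback f).apply_mk_symm hx a
  have h2 : (e (TotalSpace.mk' ℂ (f x) ((e.pullback f).symm x a))).2 = a := congrArg Prod.snd h1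
  have h3 := e.symm_apply_apply_mk hx ((e.pullback f).symm x a)
  rw [h2] at h3
  exact h3.symm

variable [IsManifold 𝓘(ℂ, Fin n → ℂ) ω M]

theorem IsAtlasPullback.contMDiffVectorBundle (hf : IsAtlasPullback (n := n) f)
    [ContMDiffVectorBundle 1 ℂ E 𝓘(ℂ, Fin n → ℂ)] :
    ContMDiffVectorBundle 1 ℂ (f *ᵖ E) 𝓘(ℂ, Fin n → ℂ) :=
  let F : ContMDiffMap 𝓘(ℂ, Fin n → ℂ) 𝓘(ℂ, Fin n → ℂ) X M 1 :=
    ⟨f, hf.contMDiff.of_le (by simp)⟩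
  { contMDiffOn_coordChangeL := by
      rintro _ _ ⟨e, he, rfl⟩ ⟨e', he', rfl⟩
      refine ((contMDiffOn_coordChangeL e e').comp F.contMDiff.contMDiffOn fun b hb => hb).congr ?_
      rintro b (hb : f b ∈ e.baseSet ∩ e'.baseSet)
      refine ContinuousLinearMap.ext fun v => ?_
      change ((e.pullback f).coordChangeL ℂ (e'.pullback f) b) v =
        (e.coordChangeL ℂ e' (f b)) v
      rw [e.coordChangeL_apply e' hb, (e.pullback f).coordChangeL_apply' _]
      exacts [rfl, hb] }

variable {h : ∀ x, E x →ₗ[ℂ] E x →ₗ⋆[ℂ] ℂ} {κ : TwoForm n M}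

theorem IsHermitianMetric.continuousOn_frameNorm (hh : IsHermitianMetric (n := n) E h)
    (e : Trivialization ℂ (TotalSpace.proj : TotalSpace ℂ E → M)) [MemTrivializationAtlas e] :
    ContinuousOn (frameNorm h e) e.baseSet := by
  intro m hm
  refine ContinuousAt.continuousWithinAt ?_
  set c := chartAt (Fin n → ℂ) m with hc
  have hms : m ∈ c.source := mem_chart_source _ m
  have hz : c m ∈ c.target ∩ c.symm ⁻¹' e.baseSet :=
    ⟨c.map_source hms, by rw [mem_preimage, c.left_inv hms]; exact hm⟩
  have h1 := ((hh.smooth e c (IsManifold.chart_mem_maximalAtlas m)).continuousOn.continuousAt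
    ((c.isOpen_inter_preimage_symm e.open_baseSet).mem_nhds hz)).comp (c.continuousAt hms)
  refine h1.congr ?_
  filter_upwards [c.open_source.mem_nhds hms] with y hy
  change frameNorm h e (c.symm (c y)) = _
  rw [c.left_inv hy]

/-- The differential of the inverse chart is injective, so positivity of the form carries over to
`ℂⁿ` and makes the determinant positive. -/
theorem TwoForm.IsKaehler.density_pos (hκ : κ.IsKaehler)
    {c : OpenPartialHomeomorph M (Fin n → ℂ)}
    (hc : c ∈ IsManifold.maximalAtlas 𝓘(ℂ, Fin n → ℂ) ω M) {z : Fin n → ℂ} (hz : z ∈ c.target) :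
    0 < κ.density c z := by
  refine (isOneOne_inChart hκ.type_one_one c z).det_hermitianMatrix_pos fun v hv => ?_
  have hinj : mfderiv 𝓘(ℂ, Fin n → ℂ) 𝓘(ℂ, Fin n → ℂ) c.symm z v ≠ 0 := by
    intro h0
    have hev : (fun y => c (c.symm y)) =ᶠ[𝓝 z] id := by
      filter_upwards [c.open_target.mem_nhds hz] with y hy using c.right_inv hy
    have h1 := hev.mfderiv_eq (I := 𝓘(ℂ, Fin n → ℂ)) (I' := 𝓘(ℂ, Fin n → ℂ))
    have h2 := mfderiv_comp z (mdifferentiableAt_chart hc (c.map_target hz))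
      (mdifferentiableAt_chart_symm hc hz)
    have h3 : v = mfderiv 𝓘(ℂ, Fin n → ℂ) 𝓘(ℂ, Fin n → ℂ) c (c.symm z)
        (mfderiv 𝓘(ℂ, Fin n → ℂ) 𝓘(ℂ, Fin n → ℂ) c.symm z v) := by
      have h4 := DFunLike.congr_fun (h2.symm.trans (h1.trans mfderiv_id)) v
      exact h4.symm
    rw [h0, map_zero] at h3
    exact hv h3
  have h5 := hκ.positive (c.symm z) _ hinj
  refine h5.trans_le (le_of_eq ?_)
  change _ = (κ (c.symm z)) _
  congr 1
  ext i
  fin_cases i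
  · rfl
  · exact ((mfderiv 𝓘(ℂ, Fin n → ℂ) 𝓘(ℂ, Fin n → ℂ) c.symm z).map_smul Complex.I v).symm

/-- In the pulled back charts and trivializations, densities and frame norms are those of `M`. -/
theorem IsAtlasPullback.isBergmanData (hf : IsAtlasPullback (n := n) f) (hκ : κ.IsKaehler)
    (hh : IsHermitianMetric (n := n) E h) :
    IsBergmanData (L := f *ᵖ E) (fun x => h (f x)) (TwoForm.pullback f κ) := by
  have hden : ∀ x₀ : X, EqOn ((TwoForm.pullback f κ).density (chartAt (Fin n → ℂ) x₀))
      (κ.density (chartAt (Fin n → ℂ) (f x₀))) (chartAt (Fin n → ℂ) x₀).target ∧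
      (chartAt (Fin n → ℂ) x₀).target ⊆ (chartAt (Fin n → ℂ) (f x₀)).target := by
    intro x₀
    obtain ⟨e, he, hxe, hx⟩ := hf.exists_chartAt x₀
    rw [hx]
    refine ⟨fun z hz => ?_, fun z hz => ?_⟩
    · rw [TwoForm.density, TwoForm.density,
        hf.inChart_pullback κ he (IsManifold.chart_mem_maximalAtlas _) hz]
    · rw [OpenPartialHomeomorph.trans_target] at hz
      exact hz.1
  refine ⟨fun x => hh.conj_symm (f x), fun x => hh.positive (f x), fun x₀ => ?_, fun x₀ => ?_,
    fun x₀ z hz => ?_⟩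
  · refine ((hh.continuousOn_frameNorm (trivializationAt ℂ E (f x₀))).comp
      f.continuous.continuousOn fun x hx => hx).congr fun x hx => ?_
    change (h (f x) ((trivializationAt ℂ E (f x₀)).pullback f |>.symm x 1)
      ((trivializationAt ℂ E (f x₀)).pullback f |>.symm x 1)).re = _
    rw [pullback_symm_apply _ hx]
    rfl
  · refine ContinuousOn.congr ?_ (hden x₀).1
    exact continuous_det_hermitianMatrix.comp_continuousOn
      ((hκ.smooth _ (IsManifold.chart_mem_maximalAtlas (f x₀))).continuousOn.mono (hden x₀).2)
  · rw [(hden x₀).1 hz]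
    exact hκ.density_pos (IsManifold.chart_mem_maximalAtlas (f x₀)) ((hden x₀).2 hz)

end Bundle

end BergmanTower

namespace BergmanTower

variable {n : ℕ} {X M : Type*} [TopologicalSpace X] [TopologicalSpace M]
  [ChartedSpace (Fin n → ℂ) X] [ChartedSpace (Fin n → ℂ) M]

/-! ### Invariance of the volume under automorphisms over the base. -/

section Volume

variable [IsManifold 𝓘(ℂ, Fin n → ℂ) ω M] {f : X → M} {κ : TwoForm n M}

namespace IsAtlasPullback

/-- Composing a chart with `g` gives another chart over the same chart of `M`, in which the pulled
back form looks the same. That arbitrary charts are dominated by the volume then yields this half;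
the inverse of `g` supplies the other. -/
theorem volume_le_map (hf : IsAtlasPullback (n := n) f)
    (hκ : ∀ (x : M) (v w : TangentSpace 𝓘(ℂ, Fin n → ℂ) x),
      κ x ![Complex.I • v, Complex.I • w] = κ x ![v, w])
    (g : X ≃ₜ X) (hg : ∀ x, f (g x) = f x) :
    letI : MeasurableSpace X := borel X
    (TwoForm.pullback f κ).volume ≤ Measure.map g (TwoForm.pullback f κ).volume := by
  let _ : MeasurableSpace X := borel X
  have : BorelSpace X := ⟨rfl⟩
  have := hf.isManifold
  have hone : ∀ (x : X) (v w : TangentSpace 𝓘(ℂ, Fin n → ℂ) x),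
      TwoForm.pullback f κ x ![Complex.I • v, Complex.I • w] =
        TwoForm.pullback f κ x ![v, w] := fun x v w =>
    IsOneOne.comp (η := (κ (f x) : (Fin n → ℂ) [⋀^Fin 2]→L[ℝ] ℝ)) (fun v w => hκ (f x) v w)
      (mfderiv 𝓘(ℂ, Fin n → ℂ) 𝓘(ℂ, Fin n → ℂ) f x) v w
  refine iSup_le fun x => Measure.le_iff.2 fun A hA => ?_
  obtain ⟨e, he, hxe, hx⟩ := hf.exists_chartAt x
  rw [hx, Measure.map_apply g.continuous.measurable hA]
  set c := chartAt (Fin n → ℂ) (f x) with hc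
  have hcm : c ∈ IsManifold.maximalAtlas 𝓘(ℂ, Fin n → ℂ) ω M :=
    IsManifold.chart_mem_maximalAtlas _
  have he' : f = g.transOpenPartialHomeomorph e := by
    funext y
    rw [Homeomorph.transOpenPartialHomeomorph_apply, Function.comp_apply, ← he, hg]
  have h1 := Measure.le_iff.1 (map_chart_symm_le_volume hone (hf.trans_mem_maximalAtlas he' hcm))
    (g ⁻¹' A) (g.continuous.measurable hA)
  refine le_trans (le_of_eq ?_) h1
  rw [map_symm_withDensity_apply _ _ hA,
    map_symm_withDensity_apply _ _ (g.continuous.measurable hA)]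
  have hset : (e.trans c).target ∩ (e.trans c).symm ⁻¹' A =
      ((g.transOpenPartialHomeomorph e).trans c).target ∩
        ((g.transOpenPartialHomeomorph e).trans c).symm ⁻¹' (g ⁻¹' A) := by
    have h2 : ∀ z, g (((g.transOpenPartialHomeomorph e).trans c).symm z) =
        (e.trans c).symm z := fun z => g.apply_symm_apply _
    ext z
    simp only [mem_inter_iff, mem_preimage, h2]
    rfl
  rw [← hset]
  refine setLIntegral_congr_fun (measurableSet_target_inter_preimage _ hA) fun z hz => ?_
  have hz' : z ∈ ((g.transOpenPartialHomeomorph e).trans c).target := (hset ▸ hz).1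
  rw [TwoForm.density, hf.inChart_pullback κ he' hcm hz', ← hf.inChart_pullback κ he hcm hz.1]

/-- Automorphisms of `X` over `M` preserve the volume of forms pulled back from `M`. -/
theorem measurePreserving (hf : IsAtlasPullback (n := n) f)
    (hκ : ∀ (x : M) (v w : TangentSpace 𝓘(ℂ, Fin n → ℂ) x),
      κ x ![Complex.I • v, Complex.I • w] = κ x ![v, w])
    (g : X ≃ₜ X) (hg : ∀ x, f (g x) = f x) :
    letI : MeasurableSpace X := borel X
    MeasurePreserving g (TwoForm.pullback f κ).volume (TwoForm.pullback f κ).volume := by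
  let _ : MeasurableSpace X := borel X
  have : BorelSpace X := ⟨rfl⟩
  refine ⟨g.continuous.measurable, le_antisymm ?_ (hf.volume_le_map hκ g hg)⟩
  have h1 := hf.volume_le_map hκ g.symm fun x => by rw [← hg (g.symm x), g.apply_symm_apply]
  refine (Measure.map_mono h1 g.continuous.measurable).trans (le_of_eq ?_)
  rw [Measure.map_map g.continuous.measurable g.symm.continuous.measurable]
  simp

end IsAtlasPullback

end Volume

/-! ### Invariance of the diagonal kernel and descent of the Bergman metric. -/

section Sections

variable {E : M → Type*} [∀ x, AddCommGroup (E x)] [∀ x, Module ℂ (E x)]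
  [TopologicalSpace (TotalSpace ℂ E)] [∀ x, TopologicalSpace (E x)] [FiberBundle ℂ E]
  [VectorBundle ℂ ℂ E] {f : C(X, M)}

/-- The pullback of a section of `f *ᵖ E` under an automorphism of `X` over `M`. -/
def pullSection {g : X → X} (hg : ∀ x, f (g x) = f x) (s : ∀ x, (f *ᵖ E) x) :
    ∀ x, (f *ᵖ E) x := fun x =>
  Eq.rec (motive := fun m _ => E m) (s (g x)) (hg x)

/-- Removes the transport along `f (g x) = f x` from any quantity depending only on a point of `E`.
-/
theorem apply_pullSection {g : X → X} (hg : ∀ x, f (g x) = f x) (s : ∀ x, (f *ᵖ E) x)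
    {A : Type*} (F : ∀ m, E m → A) (x : X) :
    F (f x) (pullSection hg s x) = F (f (g x)) (s (g x)) := by
  have h1 : ∀ {a b : M} (hab : a = b) (v : E a),
      F b (Eq.rec (motive := fun m _ => E m) v hab) = F a v := by
    rintro a _ rfl v
    rfl
  exact h1 (hg x) (s (g x))

theorem linearMapAt_pullback (e : Trivialization ℂ (TotalSpace.proj : TotalSpace ℂ E → M))
    [MemTrivializationAtlas e] (x : X) :
    (e.pullback f).linearMapAt ℂ x =
      (e.linearMapAt ℂ (f x) : Module.Dual ℂ (E (f x))) := by
  refine LinearMap.ext fun v => ?_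
  by_cases hx : f x ∈ e.baseSet
  · have hx' : x ∈ (e.pullback f).baseSet := hx
    rw [(e.pullback f).coe_linearMapAt_of_mem hx']
    exact (congrFun (e.coe_linearMapAt_of_mem (R := ℂ) hx) v).symm
  · have hx' : x ∉ (e.pullback f).baseSet := hx
    rw [(e.pullback f).linearMapAt_def_of_notMem hx']
    exact (congrArg (fun (F : E (f x) →ₗ[ℂ] ℂ) => F v)
      (e.linearMapAt_def_of_notMem (R := ℂ) hx)).symm

variable [IsManifold 𝓘(ℂ, Fin n → ℂ) ω M] [ContMDiffVectorBundle 1 ℂ E 𝓘(ℂ, Fin n → ℂ)]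

theorem IsAtlasPullback.pullSection_mem_holomorphicSections (hf : IsAtlasPullback (n := n) f)
    {g : X → X} (hgc : Continuous g) (hg : ∀ x, f (g x) = f x) {s : ∀ x, (f *ᵖ E) x}
    (hs : s ∈ holomorphicSections (n := n) (f *ᵖ E)) :
    pullSection hg s ∈ holomorphicSections (n := n) (f *ᵖ E) := by
  have := hf.isManifold
  have := hf.contMDiffVectorBundle (E := E)
  intro x
  let e := trivializationAt ℂ (f *ᵖ E) x
  have hx : x ∈ e.baseSet := mem_baseSet_trivializationAt ℂ (f *ᵖ E) x
  have hgx : g x ∈ e.baseSet := by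
    have h1 : f x ∈ (trivializationAt ℂ E (f x)).baseSet := hx
    change f (g x) ∈ (trivializationAt ℂ E (f x)).baseSet
    rwa [hg]
  refine (e.mdifferentiableAt_section_iff 𝓘(ℂ, Fin n → ℂ) _ hx).2 ?_
  have h1 := (e.mdifferentiableAt_section_iff 𝓘(ℂ, Fin n → ℂ) s hgx).1 (hs (g x))
  have h2 := MDifferentiableAt.comp x h1 (hf.mdifferentiable_of_comp_eq hgc hg x)
  refine h2.congr_of_eventuallyEq (Eventually.of_forall fun y => ?_)
  exact apply_pullSection hg s
    (fun m v => ((trivializationAt ℂ E (f x)) (TotalSpace.mk' ℂ m v)).2) y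

variable {h : ∀ x, E x →ₗ[ℂ] E x →ₗ⋆[ℂ] ℂ} {κ : TwoForm n M}

theorem IsAtlasPullback.integrable_pullSection (hf : IsAtlasPullback (n := n) f)
    (hκ : κ.IsKaehler) (g : X ≃ₜ X) (hg : ∀ x, f (g x) = f x) {s : ∀ x, (f *ᵖ E) x}
    (hs : s ∈ l2HolomorphicSections (n := n) (L := f *ᵖ E) (fun x => h (f x))
      (TwoForm.pullback f κ)) :
    pullSection hg s ∈ l2HolomorphicSections (n := n) (L := f *ᵖ E) (fun x => h (f x))
      (TwoForm.pullback f κ) := by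
  let _ : MeasurableSpace X := borel X
  have : BorelSpace X := ⟨rfl⟩
  refine ⟨hf.pullSection_mem_holomorphicSections g.continuous hg hs.1, ?_⟩
  have h1 := ((hf.measurePreserving hκ.type_one_one g hg).integrable_comp_emb
    g.measurableEmbedding).2 hs.2
  refine h1.congr (Eventually.of_forall fun x => ?_)
  exact (apply_pullSection hg s (fun m v => h m v v) x).symm

theorem IsAtlasPullback.sectionInner_pullSection (hf : IsAtlasPullback (n := n) f)
    (hκ : κ.IsKaehler) (g : X ≃ₜ X) (hg : ∀ x, f (g x) = f x) (s : ∀ x, (f *ᵖ E) x) :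
    sectionInner (L := f *ᵖ E) (fun x => h (f x)) (TwoForm.pullback f κ)
      (pullSection hg s) (pullSection hg s) =
    sectionInner (L := f *ᵖ E) (fun x => h (f x)) (TwoForm.pullback f κ) s s := by
  let _ : MeasurableSpace X := borel X
  have : BorelSpace X := ⟨rfl⟩
  have h1 := (hf.measurePreserving hκ.type_one_one g hg).integral_comp g.measurableEmbedding
    (fun x => h (f x) (s x) (s x))
  refine Eq.trans ?_ h1
  refine integral_congr_ae (Eventually.of_forall fun x => ?_)
  exact apply_pullSection hg s (fun m v => h m v v) x

variable {V : Set (∀ x, (f *ᵖ E) x)}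

variable (h κ V) in
/-- The Bergman kernel of the pulled back bundle on the diagonal, in a trivialization of the bundle
on the base. -/
def diagonalKernel (e : Trivialization ℂ (TotalSpace.proj : TotalSpace ℂ E → M))
    [MemTrivializationAtlas e] (x : X) : ℝ :=
  (bergmanKernel (L := f *ᵖ E) (fun x => h (f x)) (TwoForm.pullback f κ) V x x
    (e.linearMapAt ℂ (f x) : Module.Dual ℂ (E (f x)))
    (e.linearMapAt ℂ (f x) : Module.Dual ℂ (E (f x)))).re

/-- By the extremal characterization: a test section at `g x` pulls back to one at `x` with the same
norm and the same value. -/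
theorem IsAtlasPullback.diagonalKernel_le (hf : IsAtlasPullback (n := n) f)
    (hκ : κ.IsKaehler) (hh : IsHermitianMetric (n := n) E h)
    (hV : V ⊆ holomorphicSections (n := n) (f *ᵖ E))
    (hV' : l2HolomorphicSections (n := n) (L := f *ᵖ E) (fun x => h (f x))
      (TwoForm.pullback f κ) ⊆ V) (g : X ≃ₜ X) (hg : ∀ x, f (g x) = f x)
    (e : Trivialization ℂ (TotalSpace.proj : TotalSpace ℂ E → M))
    [MemTrivializationAtlas e] (x : X) :
    diagonalKernel h κ V e (g x) ≤ diagonalKernel h κ V e x := by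
  have := hf.isManifold
  have := hf.contMDiffVectorBundle (E := E)
  have hd := hf.isBergmanData hκ hh
  have hnonneg : 0 ≤ diagonalKernel h κ V e x :=
    (sq_nonneg _).trans_eq (hd.bergmanKernel_self_re hV hV' x
      (e.linearMapAt ℂ (f x) : Module.Dual ℂ (E (f x)))).symm
  refine (hd.bergmanKernel_self_re_le_iff hV hV' _ _ hnonneg).2 fun s hs => ?_
  have h1 := (hd.bergmanKernel_self_re_le_iff hV hV' x
    (e.linearMapAt ℂ (f x) : Module.Dual ℂ (E (f x))) hnonneg).1 le_rfl _
    (hf.integrable_pullSection hκ g hg hs)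
  rw [hf.sectionInner_pullSection hκ g hg] at h1
  refine le_trans (le_of_eq ?_) h1
  exact (apply_pullSection hg s (fun m v => ‖(e.linearMapAt ℂ m) v‖ ^ 2) x).symm

theorem IsAtlasPullback.diagonalKernel_eq (hf : IsAtlasPullback (n := n) f)
    (hκ : κ.IsKaehler) (hh : IsHermitianMetric (n := n) E h)
    (hV : V ⊆ holomorphicSections (n := n) (f *ᵖ E))
    (hV' : l2HolomorphicSections (n := n) (L := f *ᵖ E) (fun x => h (f x))
      (TwoForm.pullback f κ) ⊆ V) (g : X ≃ₜ X) (hg : ∀ x, f (g x) = f x)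
    (e : Trivialization ℂ (TotalSpace.proj : TotalSpace ℂ E → M))
    [MemTrivializationAtlas e] (x : X) :
    diagonalKernel h κ V e (g x) = diagonalKernel h κ V e x := by
  refine le_antisymm (hf.diagonalKernel_le hκ hh hV hV' g hg e x) ?_
  have h1 := hf.diagonalKernel_le hκ hh hV hV' g.symm
    (fun x => by rw [← hg (g.symm x), g.apply_symm_apply]) e (g x)
  rwa [g.symm_apply_apply] at h1

theorem localKernel_pullback (x₁ : X) (c : OpenPartialHomeomorph X (Fin n → ℂ))
    (z w : Fin n → ℂ) :
    localKernel (L := f *ᵖ E) (fun x => h (f x)) (TwoForm.pullback f κ) V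
      (trivializationAt ℂ (f *ᵖ E) x₁) c z w =
    bergmanKernel (L := f *ᵖ E) (fun x => h (f x)) (TwoForm.pullback f κ) V (c.symm z) (c.symm w)
      ((trivializationAt ℂ E (f x₁)).linearMapAt ℂ (f (c.symm z)) : Module.Dual ℂ (E _))
      ((trivializationAt ℂ E (f x₁)).linearMapAt ℂ (f (c.symm w)) : Module.Dual ℂ (E _)) := by
  rw [← linearMapAt_pullback, ← linearMapAt_pullback]
  rfl

theorem localKernel_pullback_self (x₁ : X) (c : OpenPartialHomeomorph X (Fin n → ℂ))
    (z : Fin n → ℂ) :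
    (localKernel (L := f *ᵖ E) (fun x => h (f x)) (TwoForm.pullback f κ) V
      (trivializationAt ℂ (f *ᵖ E) x₁) c z z).re =
    diagonalKernel h κ V (trivializationAt ℂ E (f x₁)) (c.symm z) := by
  rw [localKernel_pullback]
  rfl

/-- The group of automorphisms of `X` over `M` acts transitively on the fibres of `f`. -/
def IsTransitiveOver (f : X → M) : Prop :=
  ∀ x y, f x = f y → ∃ g : X ≃ₜ X, (∀ x, f (g x) = f x) ∧ g x = y

/-- The Bergman metric descends along Galois coverings. -/
theorem IsAtlasPullback.exists_pullback_eq_bergmanMetric (hf : IsAtlasPullback (n := n) f)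
    (hκ : κ.IsKaehler) (hh : IsHermitianMetric (n := n) E h)
    (hV : V ⊆ holomorphicSections (n := n) (f *ᵖ E))
    (hV' : l2HolomorphicSections (n := n) (L := f *ᵖ E) (fun x => h (f x))
      (TwoForm.pullback f κ) ⊆ V) (hsurj : Function.Surjective f) (htrans : IsTransitiveOver f)
    (hbase : ∀ x, ∃ s ∈ l2HolomorphicSections (n := n) (L := f *ᵖ E) (fun x => h (f x))
      (TwoForm.pullback f κ), s x ≠ 0) :
    ∃ Ω : TwoForm n M, TwoForm.pullback f Ω =
      bergmanMetric (L := f *ᵖ E) (fun x => h (f x)) (TwoForm.pullback f κ) V := by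
  have := hf.isManifold
  have := hf.contMDiffVectorBundle (E := E)
  have hd := hf.isBergmanData hκ hh
  refine hf.exists_pullback_eq hsurj _ fun c hc e e' he he' z hz hz' => ?_
  have hx₁ : f ((e.trans c).symm z) = c.symm z := map_trans_symm he hz
  set x₁ := (e.trans c).symm z with hx₁def
  have hmem : ∀ d : OpenPartialHomeomorph X M, ⇑f = d → z ∈ (d.trans c).target →
      z ∈ localDomain (trivializationAt ℂ (f *ᵖ E) x₁) (d.trans c) := by
    intro d hd hzd
    refine ⟨hzd, ?_⟩
    change f ((d.trans c).symm z) ∈ (trivializationAt ℂ E (f x₁)).baseSet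
    rw [map_trans_symm hd hzd, hx₁]
    exact mem_baseSet_trivializationAt ℂ E _
  have hpos : ∀ d : OpenPartialHomeomorph X M, ⇑f = d → z ∈ (d.trans c).target →
      0 < (localKernel (L := f *ᵖ E) (fun x => h (f x)) (TwoForm.pullback f κ) V
        (trivializationAt ℂ (f *ᵖ E) x₁) (d.trans c) z z).re := by
    intro d hd' hzd
    obtain ⟨s, hs, hsz⟩ := hbase ((d.trans c).symm z)
    exact hd.localKernel_re_pos hV hV' _ (hmem d hd' hzd) hs hsz
  rw [hd.inChart_bergmanMetric hV hV' x₁ (hf.trans_mem_maximalAtlas he hc) (hmem e he hz)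
      (hpos e he hz),
    hd.inChart_bergmanMetric hV hV' x₁ (hf.trans_mem_maximalAtlas he' hc) (hmem e' he' hz')
      (hpos e' he' hz')]
  -- It suffices that the potentials coincide near `z`. The automorphism relating the two points
  -- over `c.symm w` may depend on `w`.
  refine halfIddbar_congr ?_
  filter_upwards [(e.trans c).open_target.mem_nhds hz, (e'.trans c).open_target.mem_nhds hz']
    with w hw hw'
  obtain ⟨g, hg, hgw⟩ := htrans ((e.trans c).symm w) ((e'.trans c).symm w)
    (by rw [map_trans_symm he hw, map_trans_symm he' hw'])
  rw [localKernel_pullback_self, localKernel_pullback_self, ← hgw,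
    hf.diagonalKernel_eq hκ hh hV hV' g hg]

end Sections

/-- Every point of a chart of `M` is covered by a chart of `X` in which the pullback has the same
expression. -/
theorem IsAtlasPullback.isSmooth_of_pullback [IsManifold 𝓘(ℂ, Fin n → ℂ) ω M] {f : X → M}
    (hf : IsAtlasPullback (n := n) f) (hsurj : Function.Surjective f) {Ω : TwoForm n M}
    (hΩ : (TwoForm.pullback f Ω).IsSmooth) : Ω.IsSmooth := by
  intro c hc z hz
  obtain ⟨x, hx⟩ := hsurj (c.symm z)
  obtain ⟨e, he, hxe, -⟩ := hf.exists_chartAt x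
  have hzt : z ∈ (e.trans c).target := by
    rw [OpenPartialHomeomorph.trans_target]
    refine ⟨hz, ?_⟩
    rw [mem_preimage, ← hx, he]
    exact e.map_source hxe
  refine ContDiffAt.contDiffWithinAt ?_
  refine ((hΩ _ (hf.trans_mem_maximalAtlas he hc)).contDiffAt
    ((e.trans c).open_target.mem_nhds hzt)).congr_of_eventuallyEq ?_
  filter_upwards [(e.trans c).open_target.mem_nhds hzt] with w hw
  exact (hf.inChart_pullback Ω he hc hw).symm

end BergmanTower

/-! ### Deck transformations and common charts of the tower. -/

namespace BergmanTower

namespace CoveringTower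

variable {n : ℕ} {Y M : Type*} [TopologicalSpace Y] [SimplyConnectedSpace Y]
  [TopologicalSpace M] (T : CoveringTower Y M)

/-- The covering map lifts through itself with prescribed value at one point. The lifts in the two
directions are mutually inverse by uniqueness of lifts. -/
theorem exists_deckGroup_apply_eq [LocallyPathConnectedSpace Y] {y y' : Y}
    (h : T.p y = T.p y') : ∃ g : DeckGroup T.p, g.1 y = y' := by
  obtain ⟨F, ⟨hF, hpF⟩, -⟩ := T.isCoveringMap.existsUnique_continuousMap_lifts T.p y y' h.symm
  obtain ⟨G, ⟨hG, hpG⟩, -⟩ := T.isCoveringMap.existsUnique_continuousMap_lifts T.p y' y h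
  have huniq : ∀ (H : C(Y, Y)) (z : Y), H z = z → T.p ∘ H = T.p → H = ContinuousMap.id Y := by
    intro H z hz hH
    obtain ⟨K, -, hK⟩ := T.isCoveringMap.existsUnique_continuousMap_lifts T.p z z rfl
    exact (hK H ⟨hz, hH⟩).trans (hK (ContinuousMap.id Y) ⟨rfl, rfl⟩).symm
  have hGF : G.comp F = ContinuousMap.id Y := by
    refine huniq _ y (by simp [hF, hG]) ?_
    rw [ContinuousMap.coe_comp, ← Function.comp_assoc, hpG, hpF]
  have hFG : F.comp G = ContinuousMap.id Y := by
    refine huniq _ y' (by simp [hF, hG]) ?_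
    rw [ContinuousMap.coe_comp, ← Function.comp_assoc, hpF, hpG]
  let g : Y ≃ₜ Y :=
    { toFun := F
      invFun := G
      left_inv := fun z => DFunLike.congr_fun hGF z
      right_inv := fun z => DFunLike.congr_fun hFG z
      continuous_toFun := F.continuous
      continuous_invFun := G.continuous }
  exact ⟨⟨g, fun z => congrFun hpF z⟩, hF⟩

theorem isTransitiveOver_toBase [LocallyPathConnectedSpace Y] : IsTransitiveOver T.toBase := by
  intro x y hxy
  obtain ⟨g, hg⟩ := T.exists_deckGroup_apply_eq hxy
  exact ⟨g.1, g.2, hg⟩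

theorem continuous_toLevel (j : ℕ) : Continuous (T.toLevel j) := continuous_quot_mk

theorem surjective_toLevel (j : ℕ) : Function.Surjective (T.toLevel j) := Quotient.mk_surjective

theorem isOpenMap_toLevel (j : ℕ) : IsOpenMap (T.toLevel j) := by
  have : ContinuousConstSMul (T.Γ j) Y := ⟨fun g => g.1.1.continuous⟩
  exact isOpenMap_quotient_mk'_mul (Γ := T.Γ j) (T := Y)

theorem levelToBase_toLevel (j : ℕ) (y : T.Univ) : T.levelToBase j (T.toLevel j y) = T.toBase y :=
  rfl

theorem surjective_toBase : Function.Surjective T.toBase := T.surjective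

theorem surjective_levelToBase (j : ℕ) : Function.Surjective (T.levelToBase j) := fun m => by
  obtain ⟨y, hy⟩ := T.surjective_toBase m
  exact ⟨T.toLevel j y, hy⟩

/-- Normality of `Γ_j`: if `γ` relates `y'` to `y`, then its conjugate by `g` relates the images. -/
theorem toLevel_apply_eq (j : ℕ) (g : DeckGroup T.p) {y y' : Y}
    (h : T.toLevel j y = T.toLevel j y') : T.toLevel j (g.1 y) = T.toLevel j (g.1 y') := by
  obtain ⟨γ, hγ⟩ := Quotient.exact h
  refine Quotient.sound ⟨⟨g * γ.1 * g⁻¹, (T.Γ_normal j).conj_mem _ γ.2 g⟩, ?_⟩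
  have h1 : γ.1.1 y' = y := hγ
  change g.1 (γ.1.1 (g.1.symm (g.1 y'))) = g.1 y
  rw [g.1.symm_apply_apply, h1]

/-- The automorphism of `M_j` induced by a deck transformation of the universal covering. -/
def levelMap (j : ℕ) (g : DeckGroup T.p) : T.Level j → T.Level j :=
  Quotient.lift (fun y => T.toLevel j (g.1 y))
    fun _ _ h => T.toLevel_apply_eq j g (Quotient.sound h)

theorem continuous_levelMap (j : ℕ) (g : DeckGroup T.p) : Continuous (T.levelMap j g) :=
  ((T.continuous_toLevel j).comp g.1.continuous).quotient_lift _

theorem isTransitiveOver_levelToBase [LocallyPathConnectedSpace Y] (j : ℕ) :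
    IsTransitiveOver (T.levelToBase j) := by
  intro a b hab
  obtain ⟨y, rfl⟩ := T.surjective_toLevel j a
  obtain ⟨y', rfl⟩ := T.surjective_toLevel j b
  obtain ⟨g, hg⟩ := T.exists_deckGroup_apply_eq (y := y) (y' := y') hab
  have hinv : ∀ (g : DeckGroup T.p) (x : T.Level j), T.levelMap j g⁻¹ (T.levelMap j g x) = x := by
    intro g x
    obtain ⟨z, rfl⟩ := T.surjective_toLevel j x
    exact congrArg (T.toLevel j) (g.1.symm_apply_apply z)
  refine ⟨{ toFun := T.levelMap j g
            invFun := T.levelMap j g⁻¹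
            left_inv := hinv g
            right_inv := fun x => by
              have := hinv g⁻¹ x
              rwa [inv_inv] at this
            continuous_toFun := T.continuous_levelMap j g
            continuous_invFun := T.continuous_levelMap j g⁻¹ }, fun x => ?_, ?_⟩
  · obtain ⟨z, rfl⟩ := T.surjective_toLevel j x
    exact g.2 z
  · exact congrArg (T.toLevel j) hg

/-- The local section `p_j ∘ e⁻¹` of `q_j`, for a local section `e⁻¹` of `p_0`. -/
def levelChart (j : ℕ) (e : OpenPartialHomeomorph T.Univ M) (he : ⇑T.toBase = e) :
    OpenPartialHomeomorph (T.Level j) M where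
  toFun := T.levelToBase j
  invFun m := T.toLevel j (e.symm m)
  source := T.toLevel j '' e.source
  target := e.target
  map_source' := by
    rintro _ ⟨y, hy, rfl⟩
    have := e.map_source hy
    rwa [← he] at this
  map_target' m hm := ⟨_, e.map_target hm, rfl⟩
  left_inv' := by
    rintro _ ⟨y, hy, rfl⟩
    rw [levelToBase_toLevel, he, e.left_inv hy]
  right_inv' m hm := by
    rw [levelToBase_toLevel, he, e.right_inv hm]
  open_source := T.isOpenMap_toLevel j _ e.open_source
  open_target := e.open_target
  continuousOn_toFun := (T.levelToBase j).continuous.continuousOn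
  continuousOn_invFun := (T.continuous_toLevel j).comp_continuousOn e.continuousOn_symm

theorem coe_levelChart (j : ℕ) {e : OpenPartialHomeomorph T.Univ M} (he : ⇑T.toBase = e) :
    ⇑(T.levelToBase j) = T.levelChart j e he := rfl

section Manifold

variable [ChartedSpace (Fin n → ℂ) M]

theorem isAtlasPullback_toBase : IsAtlasPullback (n := n) T.toBase :=
  isAtlasPullback_pullbackChartedSpace T.isLocalHomeomorph_toBase

theorem isAtlasPullback_levelToBase (j : ℕ) : IsAtlasPullback (n := n) (T.levelToBase j) :=
  isAtlasPullback_pullbackChartedSpace (T.isLocalHomeomorph_levelToBase j)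

/-- The lifting criterion needs local path connectedness, which the pulled back charts provide. -/
theorem locallyPathConnectedSpace (T : CoveringTower Y M) (n : ℕ) [ChartedSpace (Fin n → ℂ) M] :
    LocallyPathConnectedSpace Y :=
  ChartedSpace.locallyPathConnectedSpace (Fin n → ℂ) T.Univ

end Manifold

end CoveringTower

end BergmanTower

/-! ### Local convergence of kernels and metrics along the tower. -/

namespace BergmanTower

namespace CoveringTower

variable {n : ℕ} {Y M : Type*} [TopologicalSpace Y] [SimplyConnectedSpace Y]
  [TopologicalSpace M] {T : CoveringTower Y M} [ChartedSpace (Fin n → ℂ) M]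
  [IsManifold 𝓘(ℂ, Fin n → ℂ) ω M] {κ : TwoForm n M}
  {E : M → Type*} [∀ x, AddCommGroup (E x)] [∀ x, Module ℂ (E x)]
  [TopologicalSpace (TotalSpace ℂ E)] [∀ x, TopologicalSpace (E x)] [FiberBundle ℂ E]
  [VectorBundle ℂ ℂ E] [ContMDiffVectorBundle 1 ℂ E 𝓘(ℂ, Fin n → ℂ)]
  {h : ∀ x, E x →ₗ[ℂ] E x →ₗ⋆[ℂ] ℂ}

theorem isBergmanData_toBase (hκ : κ.IsKaehler) (hh : IsHermitianMetric (n := n) E h) :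
    IsBergmanData (L := T.toBase *ᵖ E) (fun x => h (T.toBase x)) (κ.pullback T.toBase) :=
  T.isAtlasPullback_toBase.isBergmanData hκ hh

theorem isBergmanData_levelToBase (hκ : κ.IsKaehler) (hh : IsHermitianMetric (n := n) E h)
    (j : ℕ) : IsBergmanData (L := T.levelToBase j *ᵖ E) (fun x => h (T.levelToBase j x))
      (κ.pullback (T.levelToBase j)) :=
  (T.isAtlasPullback_levelToBase j).isBergmanData hκ hh

variable (T κ h) in
/-- The square integrable holomorphic sections on `M_j`. -/
def levelL2Sections (j : ℕ) : Set (∀ x, (T.levelToBase j *ᵖ E) x) :=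
  l2HolomorphicSections (L := T.levelToBase j *ᵖ E) (fun x => h (T.levelToBase j x))
    (κ.pullback (T.levelToBase j))

variable (T κ h) in
/-- The Bergman kernel of `M_j` in the chart of `M_j` over the chart `c` of `M` given by `e`. -/
def levelLocalKernel (y₀ : T.Univ) (e : OpenPartialHomeomorph T.Univ M) (he : ⇑T.toBase = e)
    (c : OpenPartialHomeomorph M (Fin n → ℂ)) (j : ℕ) (z w : Fin n → ℂ) : ℂ :=
  localKernel (L := T.levelToBase j *ᵖ E) (fun x => h (T.levelToBase j x))
    (κ.pullback (T.levelToBase j)) (holomorphicSections (n := n) (T.levelToBase j *ᵖ E))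
    (trivializationAt ℂ (T.levelToBase j *ᵖ E) (T.toLevel j y₀)) ((T.levelChart j e he).trans c)
    z w

variable (T κ h) in
/-- The Bergman kernel of the universal covering in the chart over the chart `c` of `M` given by
`e`. -/
def univLocalKernel (y₀ : T.Univ) (e : OpenPartialHomeomorph T.Univ M)
    (c : OpenPartialHomeomorph M (Fin n → ℂ)) (z w : Fin n → ℂ) : ℂ :=
  localKernel (L := T.toBase *ᵖ E) (fun x => h (T.toBase x))
    (κ.pullback T.toBase) (T.univSections κ h)
    (trivializationAt ℂ (T.toBase *ᵖ E) y₀) (e.trans c) z w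

/-- Stability is expressed with functionals of `h`-norm at most one. A small multiple of the frame
coordinate is such a functional near `y₀`, and the kernel scales by the square of its modulus. -/
theorem exists_uniform_localKernel (hκ : κ.IsKaehler) (hh : IsHermitianMetric (n := n) E h)
    (hstable : T.BergmanStable κ h) (y₀ : T.Univ) {e : OpenPartialHomeomorph T.Univ M}
    (he : ⇑T.toBase = e) {c : OpenPartialHomeomorph M (Fin n → ℂ)} {z₀ : Fin n → ℂ}
    (hz₀ : z₀ ∈ (e.trans c).target) (hy₀ : (e.trans c).symm z₀ = y₀) :
    ∃ D, IsOpen D ∧ z₀ ∈ D ∧ D ⊆ localDomain (trivializationAt ℂ (T.toBase *ᵖ E) y₀) (e.trans c) ∧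
      ∀ ε > (0 : ℝ), ∀ᶠ j in atTop, ∀ z ∈ D, ∀ w ∈ D,
        ‖T.levelLocalKernel κ h y₀ e he c j z w - T.univLocalKernel κ h y₀ e c z w‖ ≤ ε := by
  have hd := isBergmanData_toBase (T := T) hκ hh
  set t := trivializationAt ℂ (T.toBase *ᵖ E) y₀ with ht
  set tE := trivializationAt ℂ E (T.toBase y₀) with htE
  set σ := (e.trans c).symm with hσ
  let N : T.Univ → ℝ := frameNorm (L := T.toBase *ᵖ E) (fun x => h (T.toBase x)) t
  have hy₀t : y₀ ∈ t.baseSet := mem_baseSet_trivializationAt ℂ (T.toBase *ᵖ E) y₀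
  have hNpos : 0 < N y₀ := hd.frameNorm_pos t hy₀t
  have hσc : ContinuousAt σ z₀ := (e.trans c).continuousAt_symm hz₀
  have hNc : ContinuousAt N (σ z₀) := by
    rw [hy₀]
    exact (hd.continuousOn_frameNorm y₀).continuousAt (t.open_baseSet.mem_nhds hy₀t)
  obtain ⟨U, hU, W, hW, hUW⟩ := hstable y₀ y₀
  rw [← hy₀] at hU hW
  have hz₀D : z₀ ∈ localDomain t (e.trans c) := ⟨hz₀, by
    rw [mem_preimage]
    exact hy₀.symm ▸ hy₀t⟩
  have hev : ∀ᶠ z in 𝓝 z₀, z ∈ localDomain t (e.trans c) ∧ N y₀ / 2 < N (σ z) ∧ σ z ∈ U ∧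
      σ z ∈ W := by
    refine ((isOpen_localDomain t (e.trans c)).eventually_mem hz₀D).and
      (((hNc.comp hσc).eventually (lt_mem_nhds ?_)).and
        ((hσc.eventually hU).and (hσc.eventually hW)))
    simp only [Function.comp_apply, hy₀]
    linarith
  obtain ⟨D, hD, hDo, hz₀D'⟩ := eventually_nhds_iff.1 hev
  refine ⟨D, hDo, hz₀D', fun z hz => (hD z hz).1, fun ε hε => ?_⟩
  set m := N y₀ / 2 with hm
  have hmpos : 0 < m := by positivity
  -- Here `m` is a lower bound of the frame norm on `D`, so `a` times the coordinate has norm at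
  -- most one. Asking stability for `m * ε` compensates the factor `a * conj a = m`.
  let a : ℂ := (Real.sqrt m : ℝ)
  have ha : a * conj a = (m : ℂ) := by
    rw [Complex.conj_ofReal, ← Complex.ofReal_mul, Real.mul_self_sqrt hmpos.le]
  have ha' : ‖a‖ ^ 2 = m := by
    rw [Complex.norm_real, Real.norm_eq_abs, sq_abs, Real.sq_sqrt hmpos.le]
  have hξ : ∀ z ∈ D, ∀ v : E (T.toBase (σ z)),
      ‖(a • (tE.linearMapAt ℂ (T.toBase (σ z)) : Module.Dual ℂ (E (T.toBase (σ z))))) v‖ ^ 2 ≤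
        (h _ v v).re := by
    intro z hz v
    have h1 := hd.re_apply_self_eq t (hD z hz).1.2 v
    have h2 : (tE.linearMapAt ℂ (T.toBase (σ z))) v = (t (TotalSpace.mk' ℂ (σ z) v)).2 :=
      congrFun (tE.coe_linearMapAt_of_mem (R := ℂ) (hD z hz).1.2) v
    have h3 : (h _ v v).re = ‖(t (TotalSpace.mk' ℂ (σ z) v)).2‖ ^ 2 * N (σ z) := h1
    rw [h3, LinearMap.smul_apply, smul_eq_mul, norm_mul, mul_pow, ha', h2, mul_comm]
    exact mul_le_mul_of_nonneg_left (hD z hz).2.1.le (sq_nonneg _)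
  obtain ⟨J, hJ⟩ := hUW (m * ε) (by positivity)
  filter_upwards [eventually_ge_atTop J] with j hj z hz w hw
  have h1 := hJ j hj (σ z) (hD z hz).2.2.1 (σ w) (hD w hw).2.2.2 _ _ (hξ z hz) (hξ w hw)
  have h2 : T.levelKernel κ h j (T.toLevel j (σ z)) (T.toLevel j (σ w))
      (a • (tE.linearMapAt ℂ (T.toBase (σ z)) : Module.Dual ℂ (E (T.toBase (σ z)))))
      (a • (tE.linearMapAt ℂ (T.toBase (σ w)) : Module.Dual ℂ (E (T.toBase (σ w))))) =
      a * conj a * T.levelLocalKernel κ h y₀ e he c j z w := by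
    refine (bergmanKernel_smul_smul (L := T.levelToBase j *ᵖ E) _ _ _ _ _ _).trans ?_
    congr 1
  have h3 : T.univKernel κ h (σ z) (σ w)
      (a • (tE.linearMapAt ℂ (T.toBase (σ z)) : Module.Dual ℂ (E (T.toBase (σ z)))))
      (a • (tE.linearMapAt ℂ (T.toBase (σ w)) : Module.Dual ℂ (E (T.toBase (σ w))))) =
      a * conj a * T.univLocalKernel κ h y₀ e c z w := by
    refine (bergmanKernel_smul_smul (L := T.toBase *ᵖ E) _ _ _ _ _ _).trans ?_
    congr 1
  rw [h2, h3, ha, ← mul_sub, norm_mul, Complex.norm_real, Real.norm_of_nonneg hmpos.le] at h1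
  exact le_of_mul_le_mul_left h1 hmpos

/-- One local inverse of `p_0` provides charts of all `M_j` over `c`. There the polarized kernels
converge to one that is positive at `z₀`, so the logarithms and their `∂∂̄` converge smoothly. The
same positivity produces nonvanishing sections on `M_j` for large `j`. -/
theorem exists_smoothTendstoOn_levelMetric (hκ : κ.IsKaehler)
    (hh : IsHermitianMetric (n := n) E h) (hstable : T.BergmanStable κ h)
    (hbase : T.univBaseLocus κ h = ∅) {c : OpenPartialHomeomorph M (Fin n → ℂ)}
    (hc : c ∈ IsManifold.maximalAtlas 𝓘(ℂ, Fin n → ℂ) ω M) {z₀ : Fin n → ℂ} (hz₀ : z₀ ∈ c.target) :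
    ∃ (e : OpenPartialHomeomorph T.Univ M) (he : ⇑T.toBase = e) (U : Set (Fin n → ℂ)),
      IsOpen U ∧ z₀ ∈ U ∧ U ⊆ (e.trans c).target ∧
      (∀ᶠ j in atTop, ∀ z ∈ U, ∃ x, T.levelToBase j x = c.symm z ∧
        ∃ s ∈ T.levelL2Sections κ h j, s x ≠ 0) ∧
      SmoothTendstoOn atTop
        (fun j => (T.levelMetric κ h j).inChart ((T.levelChart j e he).trans c))
        ((T.univMetric κ h).inChart (e.trans c)) U := by
  have hX := T.isAtlasPullback_toBase (n := n)
  have hXj := T.isAtlasPullback_levelToBase (n := n)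
  have := hX.isManifold
  have := hX.contMDiffVectorBundle (E := E)
  have := fun j => (hXj j).isManifold
  have := fun j => (hXj j).contMDiffVectorBundle (E := E)
  have hd := isBergmanData_toBase (T := T) hκ hh
  have hdj := isBergmanData_levelToBase (T := T) hκ hh
  obtain ⟨y₀, hy₀⟩ := T.surjective_toBase (c.symm z₀)
  obtain ⟨e, he, hy₀e, -⟩ := hX.exists_chartAt y₀
  have hey₀ : e y₀ = c.symm z₀ := by rw [← he, hy₀]
  have hz₀' : z₀ ∈ (e.trans c).target := by
    rw [OpenPartialHomeomorph.trans_target]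
    refine ⟨hz₀, ?_⟩
    rw [mem_preimage, ← hey₀]
    exact e.map_source hy₀e
  have hsymm : (e.trans c).symm z₀ = y₀ := by
    change e.symm (c.symm z₀) = y₀
    rw [← hey₀, e.left_inv hy₀e]
  obtain ⟨D, hDo, hz₀D, hDD, hunif⟩ :=
    exists_uniform_localKernel hκ hh hstable y₀ he hz₀' hsymm
  -- The coordinate domains for `M_j` and the universal covering coincide by definition, as both lie
  -- over the same chart and trivialization of `M`.
  have hDDj : ∀ j, D ⊆ localDomain (trivializationAt ℂ (T.levelToBase j *ᵖ E) (T.toLevel j y₀))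
      ((T.levelChart j e he).trans c) := fun j z hz => hDD hz
  have hVu : T.univSections κ h ⊆ holomorphicSections (n := n) (T.toBase *ᵖ E) :=
    fun s hs => hs.1
  have hVj : ∀ j, T.levelL2Sections κ h j ⊆
      holomorphicSections (n := n) (T.levelToBase j *ᵖ E) := fun j s hs => hs.1
  have hDDo : IsOpen (D ×ˢ (star ⁻¹' D) : Set ((Fin n → ℂ) × (Fin n → ℂ))) :=
    hDo.prod (hDo.preimage continuous_star)
  have hG : ∀ j, DifferentiableOn ℂ (fun p : (Fin n → ℂ) × (Fin n → ℂ) =>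
      T.levelLocalKernel κ h y₀ e he c j p.1 (star p.2)) (D ×ˢ (star ⁻¹' D)) := fun j =>
    ((hdj j).differentiableOn_localKernel Subset.rfl (hVj j) (T.toLevel j y₀)
      ((hXj j).trans_mem_maximalAtlas (T.coe_levelChart j he) hc)).mono
      (prod_mono (hDDj j) (preimage_mono (hDDj j)))
  have hlim : TendstoLocallyUniformlyOn
      (fun j (p : (Fin n → ℂ) × (Fin n → ℂ)) => T.levelLocalKernel κ h y₀ e he c j p.1 (star p.2))
      (fun p => T.univLocalKernel κ h y₀ e c p.1 (star p.2)) atTop (D ×ˢ (star ⁻¹' D)) := by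
    refine TendstoUniformlyOn.tendstoLocallyUniformlyOn (Metric.tendstoUniformlyOn_iff.2
      fun ε hε => ?_)
    filter_upwards [hunif (ε / 2) (by positivity)] with j hj p hp
    rw [dist_comm, dist_eq_norm]
    exact (hj p.1 hp.1 _ hp.2).trans_lt (by linarith)
  have hpos : 0 < (T.univLocalKernel κ h y₀ e c z₀ z₀).re := by
    have h1 : (e.trans c).symm z₀ ∉ T.univBaseLocus κ h := by
      rw [hbase]
      exact notMem_empty _
    simp only [univBaseLocus, baseLocus, mem_ofPred_eq, not_forall] at h1
    obtain ⟨s, hs, hsz⟩ := h1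
    exact hd.localKernel_re_pos hVu Subset.rfl _ (hDD hz₀D) hs hsz
  obtain ⟨U, hUo, hz₀U, hUD, hUpos, hUposj, hsm⟩ := exists_smoothTendstoOn_log hDDo
    (Eventually.of_forall hG) hlim (u := fun j z => (T.levelLocalKernel κ h y₀ e he c j z z).re)
    (u₀ := fun z => (T.univLocalKernel κ h y₀ e c z z).re)
    (Eventually.of_forall fun j z _ => by
      rw [conjDiagonal_apply, star_star]
      exact (hdj j).localKernel_self Subset.rfl (hVj j) _ _ z)
    (fun z _ => by
      rw [conjDiagonal_apply, star_star]
      exact hd.localKernel_self hVu Subset.rfl _ _ z)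
    (IsBergmanData.conjDiagonal_mem.2 hz₀D) hpos
  have hUD' : U ⊆ D := fun z hz => IsBergmanData.conjDiagonal_mem.1 (hUD z hz)
  refine ⟨e, he, U, hUo, hz₀U, fun z hz => (hDD (hUD' hz)).1, ?_, ?_⟩
  · filter_upwards [hUposj] with j hj z hz
    obtain ⟨s, hs, hsz⟩ := ((hdj j).bergmanKernel_self_pos_iff Subset.rfl (hVj j) _ _).1 (hj z hz)
    refine ⟨_, IsAtlasPullback.map_trans_symm (T.coe_levelChart j he) (hDDj j (hUD' hz)).1, s, hs, fun h0 => ?_⟩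
    rw [h0, map_zero] at hsz
    exact hsz rfl
  · refine (hsm.halfIddbar hUo).congr hUo ?_ fun z hz => ?_
    · filter_upwards [hUposj] with j hj z hz
      exact (hdj j).inChart_bergmanMetric Subset.rfl (hVj j) (T.toLevel j y₀)
        ((hXj j).trans_mem_maximalAtlas (T.coe_levelChart j he) hc) (hDDj j (hUD' hz)) (hj z hz)
    · exact hd.inChart_bergmanMetric hVu Subset.rfl y₀ (hX.trans_mem_maximalAtlas he hc)
        (hDD (hUD' hz)) (hUpos z hz)

/-- An automorphism of `M_j` over `M` moves `x` to the good point of its fibre, and the good section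
is pulled back along it. -/
theorem exists_levelL2Sections_ne_zero (hκ : κ.IsKaehler) {j : ℕ}
    (hj : ∀ m, ∃ x, T.levelToBase j x = m ∧ ∃ s ∈ T.levelL2Sections κ h j, s x ≠ 0)
    (x : T.Level j) : ∃ s ∈ T.levelL2Sections κ h j, s x ≠ 0 := by
  have := T.locallyPathConnectedSpace n
  obtain ⟨x', hx', s, hs, hsx'⟩ := hj (T.levelToBase j x)
  obtain ⟨g, hg, rfl⟩ := T.isTransitiveOver_levelToBase j x x' hx'.symm
  refine ⟨_, (T.isAtlasPullback_levelToBase j).integrable_pullSection hκ g hg hs, fun h0 => hsx' ?_⟩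
  have h1 := apply_pullSection hg s (fun m v => (v = 0 : Prop)) x
  exact h1.mp h0

end CoveringTower

end BergmanTower

end

/-! ### The theorem: a uniform index, descent, and convergence on `M`. -/

open BergmanTower

theorem mainTheorem8 {n : ℕ}
    {M : Type*} [TopologicalSpace M] [T2Space M] [CompactSpace M] [ConnectedSpace M]
    [ChartedSpace (Fin n → ℂ) M] [IsManifold 𝓘(ℂ, Fin n → ℂ) ω M]
    (κ : BergmanTower.TwoForm n M) (hκ : κ.IsKaehler)
    {E : M → Type*} [∀ x, AddCommGroup (E x)] [∀ x, Module ℂ (E x)]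
    [TopologicalSpace (TotalSpace ℂ E)] [∀ x, TopologicalSpace (E x)] [FiberBundle ℂ E]
    [VectorBundle ℂ ℂ E] [ContMDiffVectorBundle ω ℂ E 𝓘(ℂ, Fin n → ℂ)]
    (h : ∀ x, E x →ₗ[ℂ] E x →ₗ⋆[ℂ] ℂ) (hh : BergmanTower.IsHermitianMetric (n := n) E h)
    {Y : Type*} [TopologicalSpace Y] [SimplyConnectedSpace Y]
    (T : BergmanTower.CoveringTower Y M)
    (hstable : T.BergmanStable κ h) (hbase : T.univBaseLocus κ h = ∅) :
    ∃ J : ℕ,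
      (∀ j ≥ J, T.levelBaseLocus n E j = ∅ ∧ (T.levelMetric κ h j).IsSmooth) ∧
      ∃ (Ω : ℕ → BergmanTower.TwoForm n M) (Ω' : BergmanTower.TwoForm n M),
        (∀ j ≥ J, (Ω j).IsSmooth ∧ (Ω j).pullback (T.levelToBase j) = T.levelMetric κ h j) ∧
        Ω'.IsSmooth ∧ Ω'.pullback T.toBase = T.univMetric κ h ∧
        BergmanTower.TendstoSmooth Ω Ω' := by
  have : ContMDiffVectorBundle 1 ℂ E 𝓘(ℂ, Fin n → ℂ) :=
    ContMDiffVectorBundle.of_le (n := ω) (by simp)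
  have hX := T.isAtlasPullback_toBase (n := n)
  have hXj := T.isAtlasPullback_levelToBase (n := n)
  have := hX.isManifold
  have := hX.contMDiffVectorBundle (E := E)
  have := fun j => (hXj j).isManifold
  have := fun j => (hXj j).contMDiffVectorBundle (E := E)
  have hd := CoveringTower.isBergmanData_toBase (T := T) hκ hh
  have hdj := CoveringTower.isBergmanData_levelToBase (T := T) hκ hh
  have := T.locallyPathConnectedSpace n
  have hVu : T.univSections κ h ⊆ holomorphicSections (n := n) (T.toBase *ᵖ E) :=
    fun s hs => hs.1
  have hVj : ∀ j, T.levelL2Sections κ h j ⊆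
      holomorphicSections (n := n) (T.levelToBase j *ᵖ E) := fun j s hs => hs.1
  have hbaseu : ∀ x, ∃ s ∈ T.univSections κ h, s x ≠ 0 := by
    intro x
    have h1 : x ∉ T.univBaseLocus κ h := by
      rw [hbase]
      exact notMem_empty _
    simpa only [CoveringTower.univBaseLocus, baseLocus, mem_ofPred_eq, not_forall,
      exists_prop] using h1
  -- Locally on `M` the condition holds for large `j`. It passes to finite unions, so compactness
  -- yields one index for all of `M`.
  have hevent : ∀ᶠ j in atTop, ∀ m ∈ (univ : Set M), ∃ x, T.levelToBase j x = m ∧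
      ∃ s ∈ T.levelL2Sections κ h j, s x ≠ 0 := by
    refine isCompact_univ.induction_on (p := fun S => ∀ᶠ j in atTop, ∀ m ∈ S, ∃ x,
      T.levelToBase j x = m ∧ ∃ s ∈ T.levelL2Sections κ h j, s x ≠ 0) (by simp)
      (fun S S' hSS' hS' => hS'.mono fun j hj m hm => hj m (hSS' hm))
      (fun S S' hS hS' => by
        filter_upwards [hS, hS'] with j hj hj' m hm using hm.elim (hj m) (hj' m)) fun m _ => ?_
    have hm : m ∈ (chartAt (Fin n → ℂ) m).source := mem_chart_source _ m
    obtain ⟨e, he, U, hUo, hmU, -, hU, -⟩ := CoveringTower.exists_smoothTendstoOn_levelMetric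
      hκ hh hstable hbase (IsManifold.chart_mem_maximalAtlas m)
      ((chartAt (Fin n → ℂ) m).map_source hm)
    refine ⟨_, mem_nhdsWithin_of_mem_nhds (inter_mem
      ((chartAt (Fin n → ℂ) m).open_source.mem_nhds hm)
      (((chartAt (Fin n → ℂ) m).continuousAt hm).preimage_mem_nhds (hUo.mem_nhds hmU))), ?_⟩
    filter_upwards [hU] with j hj m' hm'
    obtain ⟨x, hx, hs⟩ := hj _ hm'.2
    exact ⟨x, hx.trans ((chartAt (Fin n → ℂ) m).left_inv hm'.1), hs⟩
  obtain ⟨J, hJ⟩ := eventually_atTop.1 hevent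
  have hbasej : ∀ j ≥ J, ∀ x, ∃ s ∈ T.levelL2Sections κ h j, s x ≠ 0 := fun j hj x =>
    CoveringTower.exists_levelL2Sections_ne_zero hκ (fun m => hJ j hj m (mem_univ m)) x
  have hsmj : ∀ j ≥ J, (T.levelMetric κ h j).IsSmooth := fun j hj =>
    (hdj j).isSmooth_bergmanMetric Subset.rfl (hVj j) (hbasej j hj)
  have hsmu : (T.univMetric κ h).IsSmooth := hd.isSmooth_bergmanMetric hVu Subset.rfl hbaseu
  obtain ⟨Ω', hΩ'⟩ := hX.exists_pullback_eq_bergmanMetric hκ hh hVu Subset.rfl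
    T.surjective_toBase T.isTransitiveOver_toBase hbaseu
  have hex : ∀ j, ∃ Ω : TwoForm n M, j ≥ J → Ω.pullback (T.levelToBase j) = T.levelMetric κ h j := by
    intro j
    by_cases hj : j ≥ J
    · obtain ⟨Ω, hΩ⟩ := (hXj j).exists_pullback_eq_bergmanMetric hκ hh Subset.rfl (hVj j)
        (T.surjective_levelToBase j) (T.isTransitiveOver_levelToBase j) (hbasej j hj)
      exact ⟨Ω, fun _ => hΩ⟩
    -- Below `J` nothing is required of the form, and `Ω'` is an arbitrary filler.
    · exact ⟨Ω', fun h0 => absurd h0 hj⟩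
  choose Ω hΩ using hex
  have hΩ'sm : Ω'.IsSmooth := hX.isSmooth_of_pullback T.surjective_toBase (hΩ' ▸ hsmu)
  have hΩsm : ∀ j ≥ J, (Ω j).IsSmooth := fun j hj =>
    (hXj j).isSmooth_of_pullback (T.surjective_levelToBase j) ((hΩ j hj).symm ▸ hsmj j hj)
  refine ⟨J, fun j hj => ⟨?_, hsmj j hj⟩, Ω, Ω', fun j hj => ⟨hΩsm j hj, hΩ j hj⟩, hΩ'sm, hΩ', ?_⟩
  · refine eq_empty_of_forall_notMem fun x hx => ?_
    obtain ⟨s, hs, hsx⟩ := hbasej j hj x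
    exact hsx (hx s (hVj j hs))
  · intro c hc K hK hKc k
    -- Smooth convergence is tested near each point, where the descended forms have the chart
    -- expressions of the metrics on the coverings. Uniformity on `K` follows by compactness.
    have hsm : SmoothTendstoOn atTop (fun j => (Ω j).inChart c) (Ω'.inChart c) c.target := by
      refine ⟨eventually_atTop.2 ⟨J, fun j hj => hΩsm j hj c hc⟩, hΩ'sm c hc, fun k z hz => ?_⟩
      obtain ⟨e, he, U, hUo, hzU, hUt, -, hU⟩ :=
        CoveringTower.exists_smoothTendstoOn_levelMetric hκ hh hstable hbase hc hz
      refine (hU.congr hUo (f' := fun j => (Ω j).inChart c) (g' := Ω'.inChart c)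
        (eventually_atTop.2 ⟨J, fun j hj w hw => ?_⟩) fun w hw => ?_).tendsto k z hzU
      · rw [← hΩ j hj]
        exact ((hXj j).inChart_pullback (Ω j) (T.coe_levelChart j he) hc (hUt hw)).symm
      · change _ = (bergmanMetric _ _ _).inChart _ w
        rw [← hΩ']
        exact (hX.inChart_pullback Ω' he hc (hUt hw)).symm
    exact hsm.tendstoUniformlyOn c.open_target hK hKc k
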